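/- Let $\Omega\subset\mathbb R^2$ be a nonempty connected open set with $\Omega=\operatorname{int}\overline\Omega$, and let $\sigma>0$. Then there are constants $c,d>0$, depending only on $\Omega$ and $\sigma$, such that the following holds for every $\beta>0$ and every finite conforming triangulation of $\overline\Omega$ (so $\Omega$ is a bounded polygonal domain) that has at least one node inside $\Omega$ and is quasi-uniform with constant $\sigma$: every triangle contains a disc of radius $\sigma h$, where the mesh size $h$ is the largest diameter of a triangle. Let $\phi_1,\dots,\phi_n$ be the nodal basis of the continuous piecewise linear finite elements on the triangulation, let $m_B$ be the number of nodes on $\partial\Omega$, and let $\psi_1,\dots,\psi_{m_B}$ be the restrictions to $\partial\Omega$ of the basis functions of the boundary nodes. Put $$M_{ij}=\int_\Omega\phi_i\phi_j,\quad K_{ij}=\int_\Omega\nabla\phi_i\cdot\nabla\phi_j,\quad [M_b]_{ij}=\int_{\partial\Omega}\psi_i\psi_j\,ds,\quad [N_b]_{kj}=\int_{\partial\Omega}\phi_k\psi_j\,ds,\quad \omega_j=\int_\Omega\phi_j,$$ or, alternatively, replace $M$ and $M_b$ by their lumped forms (the diagonal matrices of their row sums) and $N_b$ by the matrix whose rows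 at the boundary nodes form the lumped $M_b$ and whose other rows vanish. Let $\mathbf 1=(1,\dots,1)^T\in\mathbb R^n$ and define $$M_e=\begin{pmatrix}M&0\\0&0\end{pmatrix},\quad K_e=\begin{pmatrix}K&\omega\\ \omega^T&0\end{pmatrix},\quad Z_e=\begin{pmatrix}0&\omega\\0&0\end{pmatrix},\quad M_{be}=\begin{pmatrix}\beta M_b&0\\0&\omega^T\mathbf 1\end{pmatrix},\quad N_{be}=\begin{pmatrix}N_b&0\\0&0\end{pmatrix},$$ where $M_e,K_e$ are of size $(n+1)\times(n+1)$, $Z_e,N_{be}$ of size $(n+1)\times(m_B+1)$ and $M_{be}$ of size $(m_B+1)\times(m_B+1)$. Let $$\mathcal A=\begin{pmatrix}K_e&-N_{be}&0\\ Z_e^T&M_{be}&-N_{be}^T\\ M_e&Z_e&K_e\end{pmatrix},\qquad \widehat S=\begin{pmatrix}M_{be}&-N_{be}^T\\0&K_e\end{pmatrix},\qquad \widehat{\mathcal P}_2=\begin{pmatrix}K_e&(-N_{be}\;\;0)\\0&\widehat S\end{pmatrix},$$ where $\mathcal A$ and $\widehat{\mathcal P}_2$ are of size $2n+m_B+3$.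 Then $\widehat{\mathcal P}_2$ is invertible, $1$ is an eigenvalue of $\widehat{\mathcal P}_2^{-1}\mathcal A$ of algebraic multiplicity $2n+3$, and the other $m_B$ eigenvalues (counted with algebraic multiplicity) are real and lie in $$\Big[\,1+\frac{c\,h^{3}}{\beta},\;1+\frac{d\,h^{-1}}{\beta}\,\Big].$$ -/

import Mathlib

open scoped MeasureTheory Matrix

noncomputable section

namespace NeumannControl

/-- The Euclidean plane. -/
abbrev Plane : Type := EuclideanSpace ℝ (Fin 2)

/-- A conforming triangulation of (the closure of) a planar domain `Ω`: a finite geometric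
simplicial complex, every simplex of which is contained in a triangle, and whose triangles
cover exactly the closure of `Ω`. -/
structure Mesh (Ω : Set Plane) extends Geometry.SimplicialComplex ℝ Plane where
  finite_faces : faces.Finite
  pure_dim_two : ∀ s ∈ faces, ∃ t ∈ faces, s ⊆ t ∧ t.card = 3
  space_eq_closure : toSimplicialComplex.space = closure Ω

variable {Ω : Set Plane}

namespace Mesh

/-- The nodes of the mesh; their number is the `n` of the finite element space. -/
def Node (T : Mesh Ω) : Type := {p : Plane // p ∈ T.toSimplicialComplex.vertices}

/-- The position of a node in the plane. -/
def Node.pos {T : Mesh Ω} (p : T.Node) : Plane := p.1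

theorem Node.pos_injective (T : Mesh Ω) :
    Function.Injective (Node.pos : T.Node → Plane) := Subtype.val_injective

theorem finite_vertices (T : Mesh Ω) : T.toSimplicialComplex.vertices.Finite := by
  refine Set.Finite.of_finite_image (f := fun p : Plane => ({p} : Finset Plane))
    (T.finite_faces.subset ?_) (Set.injOn_of_injective (Finset.singleton_injective))
  rintro _ ⟨p, hp, rfl⟩
  exact hp

instance (T : Mesh Ω) : Fintype T.Node := T.finite_vertices.fintype

instance (T : Mesh Ω) : DecidableEq T.Node := Classical.decEq _

/-- The nodes lying on the boundary `∂Ω`; their number is `m_B`. -/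
def BNode (T : Mesh Ω) : Type := {p : T.Node // p.pos ∈ frontier Ω}

/-- A boundary node, as a node. -/
def BNode.toNode {T : Mesh Ω} (i : T.BNode) : T.Node := i.1

instance (T : Mesh Ω) : Fintype T.BNode :=
  @Fintype.ofFinite _ (inferInstanceAs (Finite {p : T.Node // p.pos ∈ frontier Ω}))

instance (T : Mesh Ω) : DecidableEq T.BNode := Classical.decEq _

/-- The mesh size `h`: the largest diameter of a triangle of the mesh. -/
def size (T : Mesh Ω) : ℝ :=
  sSup {r : ℝ | ∃ t ∈ T.faces, t.card = 3 ∧ r = Metric.diam (convexHull ℝ (t : Set Plane))}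

/-- Quasi-uniformity with constant `σ`: every triangle of the mesh contains a disc of
radius `σ h`. -/
def QuasiUniform (T : Mesh Ω) (σ : ℝ) : Prop :=
  ∀ t ∈ T.faces, t.card = 3 →
    ∃ x : Plane, Metric.closedBall x (σ * T.size) ⊆ convexHull ℝ (t : Set Plane)

/-- `w` is the family of barycentric coordinates of the point `x` in the mesh: convex weights
at the nodes of one simplex of the mesh whose barycentre is `x`. -/
def IsBarycentric (T : Mesh Ω) (x : Plane) (w : T.Node → ℝ) : Prop :=
  (∀ p, 0 ≤ w p) ∧ ∑ p, w p = 1 ∧ ∑ p, w p • p.pos = x ∧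
    ∃ s ∈ T.faces, ∀ p, w p ≠ 0 → p.pos ∈ s

/-- Barycentric coordinates are unique, so that `hat` below is well defined. -/
theorem IsBarycentric.unique {T : Mesh Ω} {x : Plane} {w w' : T.Node → ℝ}
    (hw : T.IsBarycentric x w) (hw' : T.IsBarycentric x w') : w = w' := by
  -- weights supported on one simplex are determined by their barycentre
  have key : ∀ (s : Finset Plane), s ∈ T.faces → ∀ u v : T.Node → ℝ,
      ∑ p, u p = 1 → ∑ p, v p = 1 → ∑ p, u p • p.pos = ∑ p, v p • p.pos →
      (∀ p, u p ≠ 0 → p.pos ∈ s) → (∀ p, v p ≠ 0 → p.pos ∈ s) → u = v := by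
    intro s hs u v hu hv huv hus hvs
    have hind : AffineIndependent ℝ (fun p : {p : T.Node // p.pos ∈ s} => p.1.pos) :=
      (T.indep hs).comp_embedding
        ⟨fun p : {p : T.Node // p.pos ∈ s} => (⟨p.1.pos, p.2⟩ : s), fun a b h =>
          Subtype.ext (Node.pos_injective T (by simpa using h))⟩
    classical
    rw [affineIndependent_iff] at hind
    have conv : ∀ {E : Type} [AddCommGroup E] (f : T.Node → E),
        (∀ p, p.pos ∉ s → f p = 0) →
        ∑ p : {p : T.Node // p.pos ∈ s}, f p.1 = ∑ p, f p := by
      intro E _ f hf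
      rw [← Finset.sum_subtype (Finset.univ.filter fun p : T.Node => p.pos ∈ s)
        (fun p => by simp) f, Finset.sum_filter_of_ne]
      intro p _ hp
      by_contra h
      exact hp (hf p h)
    have z : ∀ p, p.pos ∉ s → u p - v p = 0 := by
      intro p hp
      have h1 : u p = 0 := by by_contra h; exact hp (hus p h)
      have h2 : v p = 0 := by by_contra h; exact hp (hvs p h)
      rw [h1, h2, sub_zero]
    have h0 := hind Finset.univ (fun p => u p.1 - v p.1)
      (by rw [conv (fun p => u p - v p) z, Finset.sum_sub_distrib, hu, hv, sub_self])
      (by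
        rw [conv (fun p => (u p - v p) • p.pos) (fun p hp => by rw [z p hp, zero_smul])]
        simp only [sub_smul, Finset.sum_sub_distrib, huv, sub_self])
    funext p
    by_cases hp : p.pos ∈ s
    · exact sub_eq_zero.mp (h0 ⟨p, hp⟩ (Finset.mem_univ _))
    · exact sub_eq_zero.mp (z p hp)
  -- such a barycentre lies in the simplex
  have mem : ∀ (s : Finset Plane) (u : T.Node → ℝ), (∀ p, 0 ≤ u p) → ∑ p, u p = 1 →
      ∑ p, u p • p.pos = x → (∀ p, u p ≠ 0 → p.pos ∈ s) → x ∈ convexHull ℝ (s : Set Plane) := by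
    intro s u h0 h1 h2 h3
    classical
    have e1 : ∑ p with u p ≠ 0, u p = 1 := by rw [Finset.sum_filter_ne_zero, h1]
    have e2 : ∑ p with u p ≠ 0, u p • p.pos = x := by
      rw [Finset.sum_filter_of_ne, h2]
      intro p _ hp h
      exact hp (by rw [h, zero_smul])
    rw [← e2]
    exact (convex_convexHull ℝ _).sum_mem (fun p _ => h0 p) e1
      (fun p hp => subset_convexHull ℝ _ (h3 p (Finset.mem_filter.mp hp).2))
  obtain ⟨a0, a1, a2, s, hs, as⟩ := hw
  obtain ⟨b0, b1, b2, t, ht, bt⟩ := hw'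
  classical
  have hx := T.inter_subset_convexHull hs ht ⟨mem s w a0 a1 a2 as, mem t w' b0 b1 b2 bt⟩
  rw [← Finset.coe_inter, Finset.mem_convexHull'] at hx
  obtain ⟨g, g0, g1, g2⟩ := hx
  let u : T.Node → ℝ := fun p => if p.pos ∈ s ∩ t then g p.pos else 0
  have conv : ∀ {E : Type} [AddCommGroup E] (f : Plane → E),
      ∑ p : T.Node, (if p.pos ∈ s ∩ t then f p.pos else 0) = ∑ y ∈ s ∩ t, f y := by
    intro E _ f
    rw [← Finset.sum_filter]
    refine Finset.sum_bij (fun p _ => p.pos) (fun p hp => (Finset.mem_filter.mp hp).2)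
      (fun p _ q _ h => Node.pos_injective T h) (fun y hy => ?_) (fun _ _ => rfl)
    have hv : y ∈ T.toSimplicialComplex.vertices :=
      T.down_closed hs (Finset.singleton_subset_iff.mpr (Finset.mem_inter.mp hy).1)
        (Finset.singleton_nonempty y)
    exact ⟨⟨y, hv⟩, Finset.mem_filter.mpr ⟨Finset.mem_univ _, hy⟩, rfl⟩
  have u1 : ∑ p, u p = 1 := (conv g).trans g1
  have u2 : ∑ p, u p • p.pos = x := by
    rw [← g2, ← conv (fun y => g y • y)]
    refine Finset.sum_congr rfl fun p _ => ?_
    simp only [u, ite_smul, zero_smul]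
  have us : ∀ p, u p ≠ 0 → p.pos ∈ s ∩ t := by
    intro p hp
    by_contra h
    exact hp (if_neg h)
  exact (key s hs w u a1 u1 (a2.trans u2.symm) as
      (fun p hp => (Finset.mem_inter.mp (us p hp)).1)).trans
    (key t ht u w' u1 b1 (u2.trans b2.symm)
      (fun p hp => (Finset.mem_inter.mp (us p hp)).2) bt)

open Classical in
/-- The nodal (hat) basis function `φ_p` of the space of continuous piecewise linear (P1)
functions: its value at a point of the triangulated set is the barycentric coordinate of that
point with respect to the node `p`. Outside the closure of `Ω` it is irrelevant and set to `0`. -/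
def hat (T : Mesh Ω) (p : T.Node) (x : Plane) : ℝ :=
  if h : ∃ w, T.IsBarycentric x w then h.choose p else 0

theorem IsBarycentric.hat_eq {T : Mesh Ω} {x : Plane} {w : T.Node → ℝ}
    (hw : T.IsBarycentric x w) (p : T.Node) : T.hat p x = w p := by
  have h : ∃ w, T.IsBarycentric x w := ⟨w, hw⟩
  rw [hat, dif_pos h, h.choose_spec.unique hw]

/-- The nodal property `φ_p(q) = δ_{pq}`. -/
theorem hat_pos (T : Mesh Ω) (p q : T.Node) : T.hat p q.pos = if p = q then 1 else 0 := by
  refine IsBarycentric.hat_eq (w := fun p => if p = q then 1 else 0)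
    ⟨fun p => by positivity, by simp, by simp, {q.pos}, q.2, fun p hp => ?_⟩ p
  by_cases h : p = q
  · simp [h]
  · simp [h] at hp

/-! ### Finite element matrices -/

/-- How the mass matrices `M`, `M_b` and the coupling matrix `N_b` are evaluated: by exact
integration (consistent), or in lumped (row-sum) form. -/
inductive MassRule
  | consistent
  | lumped

/-- The row-sum lumping of a square matrix. -/
def lump {ι : Type} [Fintype ι] [DecidableEq ι] (A : Matrix ι ι ℝ) : Matrix ι ι ℝ :=
  Matrix.diagonal fun i => ∑ j, A i j

/-- `∫_Ω φ_i φ_j`. -/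
def consistentMass (T : Mesh Ω) : Matrix T.Node T.Node ℝ :=
  Matrix.of fun i j => ∫ x in Ω, T.hat i x * T.hat j x

/-- `∫_{∂Ω} ψ_i ψ_j ds`, where `ψ_i` is the trace on `∂Ω` of the basis function of the boundary
node `i`, and `ds` is arc length. -/
def consistentBoundaryMass (T : Mesh Ω) : Matrix T.BNode T.BNode ℝ :=
  Matrix.of fun i j => ∫ x in frontier Ω, T.hat i.toNode x * T.hat j.toNode x ∂μH[1]

/-- The mass matrix `M`. -/
def massMatrix (T : Mesh Ω) : MassRule → Matrix T.Node T.Node ℝ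
  | .consistent => T.consistentMass
  | .lumped => lump T.consistentMass

/-- The boundary mass matrix `M_b`. -/
def boundaryMassMatrix (T : Mesh Ω) : MassRule → Matrix T.BNode T.BNode ℝ
  | .consistent => T.consistentBoundaryMass
  | .lumped => lump T.consistentBoundaryMass

/-- The matrix `N_b` with entries `∫_{∂Ω} φ_k ψ_j ds`. In the lumped case the boundary integral
is replaced by the same nodal quadrature that turns `M_b` into its lumped form. -/
def couplingMatrix (T : Mesh Ω) : MassRule → Matrix T.Node T.BNode ℝ
  | .consistent => Matrix.of fun k j =>
      ∫ x in frontier Ω, T.hat k x * T.hat j.toNode x ∂μH[1]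
  | .lumped => Matrix.of fun k j =>
      if k = j.toNode then ∑ i, T.consistentBoundaryMass j i else 0

/-- The stiffness matrix `K` with entries `∫_Ω ∇φ_i · ∇φ_j`. -/
def stiffnessMatrix (T : Mesh Ω) : Matrix T.Node T.Node ℝ :=
  Matrix.of fun i j => ∫ x in Ω, inner ℝ (gradient (T.hat i) x) (gradient (T.hat j) x)

/-- The vector `ω` with entries `∫_Ω φ_j`. -/
def omega (T : Mesh Ω) (j : T.Node) : ℝ := ∫ x in Ω, T.hat j x

/-! ### Extended matrices and the preconditioner -/

/-- Index set of the extended states and adjoints, of size `n + 1`. -/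
abbrev ENode (T : Mesh Ω) : Type := T.Node ⊕ Unit

/-- Index set of the extended controls, of size `m_B + 1`. -/
abbrev EBNode (T : Mesh Ω) : Type := T.BNode ⊕ Unit

/-- `M_e = [[M, 0], [0, 0]]`. -/
def Me (T : Mesh Ω) (r : MassRule) : Matrix T.ENode T.ENode ℝ :=
  Matrix.fromBlocks (T.massMatrix r) 0 0 0

/-- The extended stiffness matrix `K_e = [[K, ω], [ωᵀ, 0]]`. -/
def Ke (T : Mesh Ω) : Matrix T.ENode T.ENode ℝ :=
  Matrix.fromBlocks T.stiffnessMatrix (Matrix.replicateCol Unit T.omega)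
    (Matrix.replicateRow Unit T.omega) 0

/-- `Z_e = [[0, ω], [0, 0]]`. -/
def Ze (T : Mesh Ω) : Matrix T.ENode T.EBNode ℝ :=
  Matrix.fromBlocks 0 (Matrix.replicateCol Unit T.omega) 0 0

/-- `M_be = [[β M_b, 0], [0, ωᵀ1]]`. -/
def Mbe (T : Mesh Ω) (r : MassRule) (β : ℝ) : Matrix T.EBNode T.EBNode ℝ :=
  Matrix.fromBlocks (β • T.boundaryMassMatrix r) 0 0 (Matrix.of fun _ _ => ∑ j, T.omega j)

/-- `N_be = [[N_b, 0], [0, 0]]`. -/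
def Nbe (T : Mesh Ω) (r : MassRule) : Matrix T.ENode T.EBNode ℝ :=
  Matrix.fromBlocks (T.couplingMatrix r) 0 0 0

/-- Index set of the whole system (states, controls, adjoints), of size `2 n + m_B + 3`. -/
abbrev SysIndex (T : Mesh Ω) : Type := T.ENode ⊕ (T.EBNode ⊕ T.ENode)

/-- The row-permuted extended saddle-point matrix
`𝒜 = [[K_e, -N_be, 0], [Z_eᵀ, M_be, -N_beᵀ], [M_e, Z_e, K_e]]`. -/
def systemMatrix (T : Mesh Ω) (r : MassRule) (β : ℝ) : Matrix T.SysIndex T.SysIndex ℝ :=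
  Matrix.fromBlocks T.Ke (Matrix.fromCols (-(T.Nbe r)) 0)
    (Matrix.fromRows (T.Ze)ᵀ (T.Me r))
    (Matrix.fromBlocks (T.Mbe r β) (-(T.Nbe r)ᵀ) T.Ze T.Ke)

/-- The approximation `Ŝ = [[M_be, -N_beᵀ], [0, K_e]]` of the Schur complement. -/
def schurApprox (T : Mesh Ω) (r : MassRule) (β : ℝ) :
    Matrix (T.EBNode ⊕ T.ENode) (T.EBNode ⊕ T.ENode) ℝ :=
  Matrix.fromBlocks (T.Mbe r β) (-(T.Nbe r)ᵀ) 0 T.Ke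

/-- The block upper triangular preconditioner `𝒫̂₂ = [[K_e, (-N_be  0)], [0, Ŝ]]`. -/
def preconditioner (T : Mesh Ω) (r : MassRule) (β : ℝ) : Matrix T.SysIndex T.SysIndex ℝ :=
  Matrix.fromBlocks T.Ke (Matrix.fromCols (-(T.Nbe r)) 0) 0 (T.schurApprox r β)

end Mesh

end NeumannControl

end

/-! ### Block matrix algebra and characteristic polynomials. -/

noncomputable section

namespace Matrix

open Polynomial

/-! The system matrix differs from the preconditioner only by the blocks Z_eᵀ, M_e and Z_e. Solving
with K_e produces mean-free states, so the products of Z_e with K_e⁻¹N_be vanish. Since AB and BA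
have the same characteristic polynomial up to powers of X, the problem shrinks to the control space
(`charpoly_blockPreconditioned`, `charpoly_preconditioned_saddle`): the nontrivial eigenvalues are 1
+ μ with μ an eigenvalue of (βM_b)⁻¹YᵀMY, where y = Yu solves Ky + lω = N_b u, ωᵀy = 0. As M_b is
positive definite, each μ is real and equals yᵀMy / (β uᵀM_b u) for some u.

Put q = Σ ω_i y_i², which is comparable with yᵀMy, and E = uᵀM_b u. For the upper bound, test the
state equation with y: the multiplier l drops out, and the Poincaré inequality together with M_b ≲
h⁻¹ diag(ω) gives q ≲ h⁻¹E. For the lower bound, read the equation backwards. At interior nodes Ky =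
-lω, and the total weight of these nodes is bounded below, so Ky controls l; at boundary nodes M_b u
= Ky + lω. With the inverse estimate K ≲ h⁻² diag(ω), ω_i ≲ h² and M_b ≳ h this gives E ≲ h⁻³q.
`preconditioned_saddle_spectrum` is this argument with abstract constants.

The rest provides the constants. Mass and stiffness bounds come from single triangles. The lower
bound for M_b needs a boundary edge at every boundary node (`exists_boundary_edge`), a topological
fact resting on Ω = int cl Ω. The Poincaré constant must not depend on the mesh: squared increments
between sets are bounded by the energy on convex sets and passed along chains of discs
(`exists_linked_ball`, `linked_self`, `exists_poincare`). The weight of the interior nodes is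
treated in `exists_le_sum_interior_omega`. -/

theorem charpoly_one_add {n : Type} [Fintype n] [DecidableEq n] (Y : Matrix n n ℝ) :
    (1 + Y).charpoly = Y.charpoly.comp (X - C 1) := by
  have h := charpoly_sub_scalar Y (-1)
  have e : Y - scalar n (-1 : ℝ) = 1 + Y := by
    rw [map_neg, map_one, sub_neg_eq_add, add_comm]
  rw [e] at h
  rw [h]; simp [sub_eq_add_neg]

/-- The characteristic polynomial of a block saddle point matrix preconditioned by its upper
triangular part, when the coupling with `Z` degenerates. -/
theorem charpoly_blockPreconditioned {a b : Type} [Fintype a] [DecidableEq a] [Fintype b]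
    [DecidableEq b] (Ke Me : Matrix a a ℝ) (W : Matrix b b ℝ) (N Z : Matrix a b ℝ)
    (hK : IsUnit Ke) (hW : IsUnit W) (h1 : Zᵀ * Ke⁻¹ * N = 0) (h2 : Nᵀ * Ke⁻¹ * Z = 0) :
    let P : Matrix (a ⊕ (b ⊕ a)) (a ⊕ (b ⊕ a)) ℝ :=
      fromBlocks Ke (fromCols (-N) 0) 0 (fromBlocks W (-Nᵀ) 0 Ke)
    let A : Matrix (a ⊕ (b ⊕ a)) (a ⊕ (b ⊕ a)) ℝ :=
      fromBlocks Ke (fromCols (-N) 0) (fromRows Zᵀ Me) (fromBlocks W (-Nᵀ) Z Ke)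
    IsUnit P ∧ (P⁻¹ * A).charpoly =
      (X - C 1) ^ (2 * Fintype.card a) *
        (W⁻¹ * (Nᵀ * Ke⁻¹ * Me * Ke⁻¹ * N)).charpoly.comp (X - C 1) := by
  intro P A
  have hK' : IsUnit Ke.det := (isUnit_iff_isUnit_det _).mp hK
  have hW' : IsUnit W.det := (isUnit_iff_isUnit_det _).mp hW
  set S : Matrix (b ⊕ a) (b ⊕ a) ℝ := fromBlocks W (-Nᵀ) 0 Ke with hSdef
  have hS' : IsUnit S.det := by
    rw [hSdef, det_fromBlocks_zero₂₁]; exact hW'.mul hK'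
  have hP' : IsUnit P.det := by
    change IsUnit (fromBlocks Ke (fromCols (-N) 0) 0 S).det
    rw [det_fromBlocks_zero₂₁]; exact hK'.mul hS'
  refine ⟨(isUnit_iff_isUnit_det _).mpr hP', ?_⟩
  set G : Matrix a b ℝ := Me * Ke⁻¹ * N + Z with hG
  let N₀ : Matrix a (b ⊕ a) ℝ := fromCols N 0
  let V₁ : Matrix a (b ⊕ a) ℝ := Ke⁻¹ * N₀ * S⁻¹
  let V : Matrix (a ⊕ (b ⊕ a)) (b ⊕ a) ℝ := fromRows V₁ S⁻¹
  -- `R` carries the blocks of `A` missing from `P`, so A = P + JR and P⁻¹A = 1 + VR with V = P⁻¹J.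
  let R : Matrix (b ⊕ a) (a ⊕ (b ⊕ a)) ℝ := fromCols (fromRows Zᵀ Me) (fromBlocks 0 0 Z 0)
  let J : Matrix (a ⊕ (b ⊕ a)) (b ⊕ a) ℝ := fromRows 0 1
  have hPV : P * V = J := by
    change fromBlocks Ke (fromCols (-N) 0) 0 S * fromRows _ _ = fromRows 0 1
    have h3 : Ke * V₁ = N₀ * S⁻¹ := by
      simp only [V₁, Matrix.mul_assoc]
      rw [mul_nonsing_inv_cancel_left _ _ hK']
    have h4 : N₀ + fromCols (-N) 0 = 0 := by
      ext i (j | j) <;> simp [N₀]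
    rw [fromBlocks_mul_fromRows, h3, mul_nonsing_inv _ hS', Matrix.zero_mul, zero_add,
      ← Matrix.add_mul, h4, Matrix.zero_mul]
  have hAP : A = P + J * R := by
    ext (i | i | i) (j | j | j) <;> simp [A, P, J, R, fromRows_mul]
  have hV : P⁻¹ * J = V := by rw [← hPV, nonsing_inv_mul_cancel_left _ _ hP']
  have hPA : P⁻¹ * A = 1 + V * R := by
    rw [hAP, Matrix.mul_add, nonsing_inv_mul _ hP', ← Matrix.mul_assoc, hV]
  let J' : Matrix (b ⊕ a) a ℝ := fromRows 0 1
  let G' : Matrix a (b ⊕ a) ℝ := fromCols G 0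
  -- The first block row of RV is ZᵀKe⁻¹N times a factor, hence zero by `h1`; so RV factors through
  -- a space of the size of `a`.
  have hRV : R * V = J' * (G' * S⁻¹) := by
    change fromCols _ _ * fromRows _ _ = _
    have h3 : fromRows Zᵀ Me * V₁ = fromRows Zᵀ Me * (Ke⁻¹ * N₀) * S⁻¹ := by
      simp only [V₁, Matrix.mul_assoc]
    have h4 : fromRows Zᵀ Me * (Ke⁻¹ * N₀) + fromBlocks 0 0 Z 0 = J' * G' := by
      simp only [N₀, J', G', fromRows_mul, mul_fromCols, ← Matrix.mul_assoc]
      rw [h1]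
      ext (i | i) (j | j) <;> simp [G]
    rw [fromCols_mul_fromRows, h3, ← Matrix.add_mul, h4, Matrix.mul_assoc]
  let U : Matrix b a ℝ := W⁻¹ * Nᵀ * Ke⁻¹
  have hSJ : S⁻¹ * J' = fromRows U Ke⁻¹ := by
    have : S * fromRows U Ke⁻¹ = J' := by
      rw [hSdef, fromBlocks_mul_fromRows, mul_nonsing_inv _ hK']
      simp only [U, ← Matrix.mul_assoc]
      rw [mul_nonsing_inv _ hW', Matrix.one_mul, Matrix.neg_mul, add_neg_cancel]
      simp [J']
    rw [← this, nonsing_inv_mul_cancel_left _ _ hS']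
  have hGSJ : G' * S⁻¹ * J' = G * U := by
    rw [Matrix.mul_assoc, hSJ, fromCols_mul_fromRows]; simp
  have hUG : U * G = W⁻¹ * (Nᵀ * Ke⁻¹ * Me * Ke⁻¹ * N) := by
    have : U * G = W⁻¹ * (Nᵀ * Ke⁻¹ * Me * Ke⁻¹ * N) + W⁻¹ * (Nᵀ * Ke⁻¹ * Z) := by
      simp only [U, G, Matrix.mul_add, Matrix.mul_assoc]
    rw [this, h2]; simp
  -- Three exchanges of factors lead from VR of size a + b + a down to UG of size b; the powers of X
  -- account for the lost dimension 2a.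
  have e1 := charpoly_mul_comm' V R
  have e2 := charpoly_mul_comm' J' (G' * S⁻¹)
  have e3 := charpoly_mul_comm' G U
  rw [hRV] at e1
  rw [hGSJ] at e2
  rw [hUG] at e3
  simp only [Fintype.card_sum, pow_add] at e1 e2
  have hx : ∀ k : ℕ, (X : ℝ[X]) ^ k ≠ 0 := fun k => pow_ne_zero _ X_ne_zero
  have e4 : (V * R).charpoly = X ^ (2 * Fintype.card a) *
      (W⁻¹ * (Nᵀ * Ke⁻¹ * Me * Ke⁻¹ * N)).charpoly := by
    have hc := mul_ne_zero (hx (Fintype.card b)) (hx (Fintype.card a))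
    have hxa := hx (Fintype.card a)
    apply mul_left_cancel₀ hc
    apply mul_left_cancel₀ hxa
    rw [two_mul, pow_add]
    linear_combination X ^ (Fintype.card a) * e1 +
      X ^ (Fintype.card a) * X ^ (Fintype.card a) * X ^ (Fintype.card b) * e2 +
      X ^ (Fintype.card a) * X ^ (Fintype.card a) * X ^ (Fintype.card a) *
        X ^ (Fintype.card b) * e3
  rw [hPA, charpoly_one_add, e4, mul_comp, pow_comp, X_comp]

/-- The spectrum of a symmetric matrix relative to a positive definite one. -/
theorem exists_charpoly_inv_mul_eq_prod {κ : Type} [Fintype κ] [DecidableEq κ]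
    {B Q : Matrix κ κ ℝ} (hB : B.PosDef) (hQ : Qᵀ = Q) :
    ∃ μ : κ → ℝ, (B⁻¹ * Q).charpoly = ∏ i, (X - C (μ i)) ∧
      ∀ i, ∃ u : κ → ℝ, 0 < u ⬝ᵥ B *ᵥ u ∧ u ⬝ᵥ Q *ᵥ u = μ i * (u ⬝ᵥ B *ᵥ u) := by
  classical
  -- With B = DᵀD, exchanging factors turns B⁻¹Q into the symmetric matrix D⁻ᵀQD⁻¹; an eigenvector w
  -- of the latter yields the test vector u = D⁻¹w.
  obtain ⟨D, hD⟩ : ∃ D : Matrix κ κ ℝ, B = Dᵀ * D := by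
    open scoped MatrixOrder in
    obtain ⟨D, hD⟩ := CStarAlgebra.nonneg_iff_eq_star_mul_self.mp hB.posSemidef.nonneg
    exact ⟨D, by simpa [star_eq_conjTranspose] using hD⟩
  have hBu : IsUnit B.det := (isUnit_iff_isUnit_det _).mp hB.isUnit
  have hDu : IsUnit D.det := by
    rw [hD, det_mul] at hBu; exact isUnit_of_mul_isUnit_right hBu
  have hDtu : IsUnit Dᵀ.det := by rwa [det_transpose]
  set H : Matrix κ κ ℝ := Dᵀ⁻¹ * Q * D⁻¹ with hH
  have hherm : H.IsHermitian := by
    rw [IsHermitian, conjTranspose_eq_transpose_of_trivial, hH, transpose_mul, transpose_mul, hQ,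
      transpose_nonsing_inv, transpose_nonsing_inv, transpose_transpose, Matrix.mul_assoc]
  refine ⟨hherm.eigenvalues, ?_, fun i => ?_⟩
  · have : B⁻¹ * Q = D⁻¹ * (Dᵀ⁻¹ * Q) := by rw [hD, mul_inv_rev, Matrix.mul_assoc]
    rw [this, charpoly_mul_comm, ← hH, hherm.charpoly_eq]
    rfl
  · set w : κ → ℝ := (hherm.eigenvectorBasis i).ofLp
    have hw : H *ᵥ w = hherm.eigenvalues i • w := hherm.mulVec_eigenvectorBasis i
    have hw0 : w ≠ 0 := by
      intro h0
      have := hherm.eigenvectorBasis.orthonormal.ne_zero i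
      apply this
      ext j
      exact congrFun h0 j
    have hDw : D *ᵥ (D⁻¹ *ᵥ w) = w := by
      rw [mulVec_mulVec, mul_nonsing_inv _ hDu, one_mulVec]
    have hB' : (D⁻¹ *ᵥ w) ⬝ᵥ B *ᵥ (D⁻¹ *ᵥ w) = w ⬝ᵥ w := by
      rw [hD, ← mulVec_mulVec, hDw, dotProduct_mulVec, ← mulVec_transpose, transpose_transpose, hDw]
    refine ⟨D⁻¹ *ᵥ w, ?_, ?_⟩
    · rw [hB']
      have := dotProduct_star_self_pos_iff.mpr hw0
      simpa using this
    · rw [hB']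
      have : w ⬝ᵥ H *ᵥ w = (D⁻¹ *ᵥ w) ⬝ᵥ Q *ᵥ (D⁻¹ *ᵥ w) := by
        rw [hH, ← mulVec_mulVec, ← mulVec_mulVec, dotProduct_mulVec w, ← mulVec_transpose,
          transpose_nonsing_inv, transpose_transpose]
      rw [← this, hw, dotProduct_smul, smul_eq_mul]

end Matrix

end

/-! ### Reduction to the control space and abstract eigenvalue bounds. -/

noncomputable section

namespace Matrix

open Polynomial

/-- Cauchy–Schwarz for a semidefinite form: the quadratic polynomial x ↦ (xw + y)ᵀK(xw + y) is
nonnegative, so its discriminant is not positive. -/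
theorem sq_dotProduct_mulVec_le {ι : Type} [Fintype ι] {K : Matrix ι ι ℝ} (hs : Kᵀ = K)
    (h0 : ∀ y, 0 ≤ y ⬝ᵥ K *ᵥ y) (w y : ι → ℝ) :
    (w ⬝ᵥ K *ᵥ y) ^ 2 ≤ (w ⬝ᵥ K *ᵥ w) * (y ⬝ᵥ K *ᵥ y) := by
  have hsymm : y ⬝ᵥ K *ᵥ w = w ⬝ᵥ K *ᵥ y := by
    rw [dotProduct_mulVec, ← mulVec_transpose, hs, dotProduct_comm]
  have h := discrim_le_zero (a := w ⬝ᵥ K *ᵥ w) (b := 2 * (w ⬝ᵥ K *ᵥ y)) (c := y ⬝ᵥ K *ᵥ y)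
    (fun x => by
      have := h0 (x • w + y)
      simp only [mulVec_add, mulVec_smul, dotProduct_add, add_dotProduct, smul_dotProduct,
        dotProduct_smul, smul_eq_mul, hsymm] at this
      linarith)
  rw [discrim] at h
  linarith

/-- The extended stiffness matrix, a bordering of `K` by `ω`. -/
abbrev bordered {ι : Type} (K : Matrix ι ι ℝ) (ω : ι → ℝ) : Matrix (ι ⊕ Unit) (ι ⊕ Unit) ℝ :=
  fromBlocks K (replicateCol Unit ω) (replicateRow Unit ω) 0

/-- A kernel vector (y, l) satisfies Ky = -lω and ωᵀy = 0, so yᵀKy = 0, which forces y = 0 and then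
lω = 0. -/
theorem isUnit_bordered {ι : Type} [Fintype ι] [DecidableEq ι] {K : Matrix ι ι ℝ} {ω : ι → ℝ}
    (h0 : ∀ y, ω ⬝ᵥ y = 0 → y ⬝ᵥ K *ᵥ y = 0 → y = 0) (hω : ω ≠ 0) :
    IsUnit (bordered K ω) := by
  rw [← mulVec_injective_iff_isUnit]
  refine (injective_iff_map_eq_zero (mulVecLin (bordered K ω))).mpr fun x hx => ?_
  obtain ⟨y, l, rfl⟩ : ∃ (y : ι → ℝ) (l : Unit → ℝ), x = Sum.elim y l :=
    ⟨x ∘ Sum.inl, x ∘ Sum.inr, (Sum.elim_comp_inl_inr x).symm⟩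
  rw [mulVecLin_apply, bordered, fromBlocks_mulVec] at hx
  have h1 : ∀ i, (K *ᵥ y) i + ω i * l () = 0 := fun i => by
    have := congrFun hx (Sum.inl i)
    simpa [mulVec, dotProduct] using this
  have h2 : ω ⬝ᵥ y = 0 := by
    have := congrFun hx (Sum.inr ())
    simpa [mulVec, dotProduct] using this
  have h3 : y ⬝ᵥ K *ᵥ y = 0 := by
    have : K *ᵥ y = (-l ()) • ω := by
      ext i; have := h1 i; simp; linarith
    rw [this, dotProduct_smul, dotProduct_comm, h2, smul_zero]
  have hy := h0 y h2 h3
  obtain ⟨i, hi⟩ : ∃ i, ω i ≠ 0 := by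
    by_contra! h; exact hω (funext h)
  have hl : l () = 0 := by
    have := h1 i
    rw [hy, mulVec_zero] at this
    simpa [hi] using this
  ext (i | i)
  · simp [hy]
  · simpa using hl

/-- Reduction of the preconditioned optimality system to the control space. -/
theorem charpoly_preconditioned_saddle {ι κ : Type} [Fintype ι] [DecidableEq ι] [Fintype κ]
    [DecidableEq κ] (K M : Matrix ι ι ℝ) (ω : ι → ℝ) (B : Matrix κ κ ℝ) (N : Matrix ι κ ℝ) (s : ℝ)
    (hs : s ≠ 0) (hKs : Kᵀ = K) (hB : IsUnit B) (hKe : IsUnit (bordered K ω)) :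
    let Ne : Matrix (ι ⊕ Unit) (κ ⊕ Unit) ℝ := fromBlocks N 0 0 0
    let Ze : Matrix (ι ⊕ Unit) (κ ⊕ Unit) ℝ := fromBlocks 0 (replicateCol Unit ω) 0 0
    let Me : Matrix (ι ⊕ Unit) (ι ⊕ Unit) ℝ := fromBlocks M 0 0 0
    let W : Matrix (κ ⊕ Unit) (κ ⊕ Unit) ℝ := fromBlocks B 0 0 (Matrix.of fun _ _ => s)
    let P : Matrix ((ι ⊕ Unit) ⊕ ((κ ⊕ Unit) ⊕ (ι ⊕ Unit)))
        ((ι ⊕ Unit) ⊕ ((κ ⊕ Unit) ⊕ (ι ⊕ Unit))) ℝ :=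
      fromBlocks (bordered K ω) (fromCols (-Ne) 0) 0 (fromBlocks W (-Neᵀ) 0 (bordered K ω))
    let A : Matrix ((ι ⊕ Unit) ⊕ ((κ ⊕ Unit) ⊕ (ι ⊕ Unit)))
        ((ι ⊕ Unit) ⊕ ((κ ⊕ Unit) ⊕ (ι ⊕ Unit))) ℝ :=
      fromBlocks (bordered K ω) (fromCols (-Ne) 0) (fromRows Zeᵀ Me)
        (fromBlocks W (-Neᵀ) Ze (bordered K ω))
    ∃ (Y : Matrix ι κ ℝ) (Λ : κ → ℝ), K * Y + vecMulVec ω Λ = N ∧ ω ᵥ* Y = 0 ∧ IsUnit P ∧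
      (P⁻¹ * A).charpoly = (X - C 1) ^ (2 * Fintype.card ι + 3) *
        (B⁻¹ * (Yᵀ * M * Y)).charpoly.comp (X - C 1) := by
  intro Ne Ze Me W P A
  have hKe' := (isUnit_iff_isUnit_det _).mp hKe
  have hB' := (isUnit_iff_isUnit_det _).mp hB
  set N₀ : Matrix (ι ⊕ Unit) κ ℝ := fromRows N 0 with hN₀
  -- Column j of `Y` is the mean-free discrete state driven by the j-th column of `N`; `L` holds the
  -- multipliers that make the singular equation solvable.
  set F : Matrix (ι ⊕ Unit) κ ℝ := (bordered K ω)⁻¹ * N₀ with hF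
  set Y : Matrix ι κ ℝ := F.toRows₁
  set L : Matrix Unit κ ℝ := F.toRows₂
  have hFYL : F = fromRows Y L := (fromRows_toRows F).symm
  have hsol : bordered K ω * fromRows Y L = N₀ := by
    rw [← hFYL, hF, mul_nonsing_inv_cancel_left _ _ hKe']
  rw [bordered, fromBlocks_mul_fromRows, hN₀] at hsol
  have hY1 : K * Y + replicateCol Unit ω * L = N := by
    ext i j; exact congrFun (congrFun hsol (Sum.inl i)) j
  have hY2 : replicateRow Unit ω * Y = 0 := by
    ext i j
    have := congrFun (congrFun hsol (Sum.inr i)) j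
    simpa using this
  have hKes : (bordered K ω)ᵀ = bordered K ω := by
    rw [bordered, fromBlocks_transpose, hKs]; rfl
  have hKeis : ((bordered K ω)⁻¹)ᵀ = (bordered K ω)⁻¹ := by
    rw [transpose_nonsing_inv, hKes]
  have hKN : (bordered K ω)⁻¹ * Ne = fromBlocks Y 0 L 0 := by
    have : Ne = bordered K ω * fromBlocks Y 0 L 0 := by
      rw [bordered, fromBlocks_multiply, hY1, Matrix.zero_mul, add_zero, hY2]; simp [Ne]
    rw [this, nonsing_inv_mul_cancel_left _ _ hKe']
  -- `Zeᵀ` sees only ωᵀY, which is zero by the last row of the bordered system.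
  have hZKN : Zeᵀ * (bordered K ω)⁻¹ * Ne = 0 := by
    rw [Matrix.mul_assoc, hKN]
    simp only [Ze, fromBlocks_transpose, fromBlocks_multiply]
    simp [hY2]
  have hNKZ : Neᵀ * (bordered K ω)⁻¹ * Ze = 0 := by
    have := congrArg transpose hZKN
    rw [transpose_mul, transpose_mul, hKeis, transpose_transpose, transpose_zero,
      ← Matrix.mul_assoc] at this
    exact this
  have hW' : IsUnit W.det := by
    have h1 : ((Matrix.of fun _ _ => s : Matrix Unit Unit ℝ)).det = s := by simp
    rw [det_fromBlocks_zero₂₁, h1]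
    exact hB'.mul (isUnit_iff_ne_zero.mpr hs)
  have hQ : Neᵀ * (bordered K ω)⁻¹ * Me * (bordered K ω)⁻¹ * Ne =
      fromBlocks (Yᵀ * M * Y) 0 0 0 := by
    have h1 : Neᵀ * (bordered K ω)⁻¹ = fromBlocks Yᵀ Lᵀ 0 0 := by
      have := congrArg transpose hKN
      rw [transpose_mul, hKeis] at this
      rw [this, fromBlocks_transpose, transpose_zero, transpose_zero]
    rw [Matrix.mul_assoc _ _ Ne, hKN, h1]
    simp only [Me, fromBlocks_multiply]
    simp
  have hWQ : W⁻¹ * (Neᵀ * (bordered K ω)⁻¹ * Me * (bordered K ω)⁻¹ * Ne) =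
      fromBlocks (B⁻¹ * (Yᵀ * M * Y)) 0 0 0 := by
    have h1 : W * fromBlocks (B⁻¹ * (Yᵀ * M * Y)) 0 0 0 = fromBlocks (Yᵀ * M * Y) 0 0 0 := by
      simp only [W, fromBlocks_multiply, mul_nonsing_inv_cancel_left _ _ hB']
      simp
    rw [hQ, ← h1, nonsing_inv_mul_cancel_left _ _ hW']
  obtain ⟨hP, hch⟩ := charpoly_blockPreconditioned (bordered K ω) Me W Ne Ze hKe
    ((isUnit_iff_isUnit_det _).mpr hW') hZKN hNKZ
  refine ⟨Y, fun j => L () j, ?_, ?_, hP, ?_⟩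
  · rw [← hY1]; congr 1; ext i j; simp [vecMulVec, mul_apply]
  · ext j
    exact congrFun (congrFun hY2 ()) j
  -- Blocks of size n + 1 give the exponent 2(n + 1); the zero corner of size one adds one more
  -- factor X - 1, in total 2n + 3.
  · rw [hch, hWQ, charpoly_fromBlocks_zero₂₁, charpoly_zero]
    simp only [Fintype.card_sum, Fintype.card_unit, pow_one, mul_comp, X_comp]
    ring

/-- Eigenvalue localization for the preconditioned optimality system in terms of the discrete
estimates: spectral equivalence of mass, stiffness and boundary mass matrices with the diagonal
matrix of `ω`, and a discrete Poincaré inequality. -/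
theorem preconditioned_saddle_spectrum {ι κ : Type} [Fintype ι] [DecidableEq ι] [Nonempty ι]
    [Fintype κ] [DecidableEq κ] (K M : Matrix ι ι ℝ) (ω : ι → ℝ) (B : Matrix κ κ ℝ)
    (N : Matrix ι κ ℝ) (e : κ → ι) (he : Function.Injective e) (β c₁ k CP c₂ c₃ c₄ c₅ a : ℝ)
    (hβ : 0 < β) (hc₁ : 0 < c₁) (hCP : 0 < CP) (hc₂ : 0 < c₂) (hc₃ : 0 < c₃)
    (hc₄ : 0 < c₄) (hc₅ : 0 < c₅) (hk : 0 < k) (hω : ∀ i, 0 < ω i) (hKs : Kᵀ = K)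
    (hK0 : ∀ y, 0 ≤ y ⬝ᵥ K *ᵥ y) (hK1 : ∀ y, y ⬝ᵥ K *ᵥ y ≤ k * ∑ i, ω i * y i ^ 2)
    (hP : ∀ y, ω ⬝ᵥ y = 0 → ∑ i, ω i * y i ^ 2 ≤ CP * (y ⬝ᵥ K *ᵥ y))
    (hMs : Mᵀ = M) (hM1 : ∀ y, c₁ * ∑ i, ω i * y i ^ 2 ≤ y ⬝ᵥ M *ᵥ y)
    (hM2 : ∀ y, y ⬝ᵥ M *ᵥ y ≤ ∑ i, ω i * y i ^ 2)
    (hBs : Bᵀ = B) (hB1 : ∀ u, c₂ * ∑ i, u i ^ 2 ≤ u ⬝ᵥ B *ᵥ u)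
    (hB2 : ∀ u, u ⬝ᵥ B *ᵥ u ≤ c₃ * ∑ i, ω (e i) * u i ^ 2)
    (hNb : ∀ i j, N (e i) j = B i j) (hN0 : ∀ k, k ∉ Set.range e → ∀ j, N k j = 0)
    (s : Finset ι) (hs : ∀ i ∈ s, i ∉ Set.range e) (h₄ : c₄ ≤ ∑ i ∈ s, ω i)
    (ha : ∑ i, ω i ≤ a) (h₅ : ∀ i, ω i ≤ c₅) :
    let Ne : Matrix (ι ⊕ Unit) (κ ⊕ Unit) ℝ := fromBlocks N 0 0 0
    let Ze : Matrix (ι ⊕ Unit) (κ ⊕ Unit) ℝ := fromBlocks 0 (replicateCol Unit ω) 0 0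
    let Me : Matrix (ι ⊕ Unit) (ι ⊕ Unit) ℝ := fromBlocks M 0 0 0
    let W : Matrix (κ ⊕ Unit) (κ ⊕ Unit) ℝ :=
      fromBlocks (β • B) 0 0 (Matrix.of fun _ _ => ∑ i, ω i)
    let P : Matrix ((ι ⊕ Unit) ⊕ ((κ ⊕ Unit) ⊕ (ι ⊕ Unit)))
        ((ι ⊕ Unit) ⊕ ((κ ⊕ Unit) ⊕ (ι ⊕ Unit))) ℝ :=
      fromBlocks (bordered K ω) (fromCols (-Ne) 0) 0 (fromBlocks W (-Neᵀ) 0 (bordered K ω))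
    let A : Matrix ((ι ⊕ Unit) ⊕ ((κ ⊕ Unit) ⊕ (ι ⊕ Unit)))
        ((ι ⊕ Unit) ⊕ ((κ ⊕ Unit) ⊕ (ι ⊕ Unit))) ℝ :=
      fromBlocks (bordered K ω) (fromCols (-Ne) 0) (fromRows Zeᵀ Me)
        (fromBlocks W (-Neᵀ) Ze (bordered K ω))
    IsUnit P ∧ ∃ μ : κ → ℝ,
      (P⁻¹ * A).charpoly = (X - C 1) ^ (2 * Fintype.card ι + 3) * ∏ i, (X - C (μ i)) ∧
      ∀ i, μ i ∈ Set.Icc (1 + c₁ * c₂ / (c₅ * (2 * (1 + a / c₄) * k ^ 2)) / β)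
        (1 + CP ^ 2 * c₃ / β) := by
  intro Ne Ze Me W P A
  have hωpos : 0 < ∑ i, ω i := Finset.sum_pos (fun i _ => hω i) Finset.univ_nonempty
  have ha0 : 0 < a := hωpos.trans_le ha
  have hzero : ∀ y : ι → ℝ, ∑ i, ω i * y i ^ 2 ≤ 0 → y = 0 := fun y hy => by
    ext i
    have h1 := (Finset.sum_eq_zero_iff_of_nonneg
      (fun i _ => mul_nonneg (hω i).le (sq_nonneg (y i)))).mp
      (le_antisymm hy (Finset.sum_nonneg fun i _ => mul_nonneg (hω i).le (sq_nonneg (y i)))) i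
      (Finset.mem_univ i)
    simpa [(hω i).ne'] using h1
  have hKe : IsUnit (bordered K ω) := by
    refine isUnit_bordered (fun y h1 h2 => hzero y ?_) ?_
    · simpa [h2] using hP y h1
    · intro h
      have := hω (Classical.arbitrary ι)
      simp [h] at this
  have hBpd : B.PosDef := by
    refine PosDef.of_dotProduct_mulVec_pos (by
      rw [IsHermitian, conjTranspose_eq_transpose_of_trivial, hBs]) fun u hu => ?_
    obtain ⟨i, hi⟩ : ∃ i, u i ≠ 0 := by
      by_contra! h; exact hu (funext h)
    have h1 : 0 < ∑ i, u i ^ 2 :=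
      Finset.sum_pos' (fun i _ => sq_nonneg _) ⟨i, Finset.mem_univ i, by positivity⟩
    simpa using (mul_pos hc₂ h1).trans_le (hB1 u)
  have hβB : (β • B).PosDef := hBpd.smul hβ
  have hB0 : ∀ u, 0 ≤ u ⬝ᵥ B *ᵥ u := fun u =>
    (mul_nonneg hc₂.le (Finset.sum_nonneg fun i _ => sq_nonneg _)).trans (hB1 u)
  obtain ⟨Y, Λ, hY1, hY2, hPu, hch⟩ := charpoly_preconditioned_saddle K M ω (β • B) N
    (∑ i, ω i) hωpos.ne' hKs hβB.isUnit hKe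
  refine ⟨hPu, ?_⟩
  obtain ⟨μ, hμ, hμu⟩ := exists_charpoly_inv_mul_eq_prod hβB (Q := Yᵀ * M * Y) (by
    rw [transpose_mul, transpose_mul, transpose_transpose, hMs, Matrix.mul_assoc])
  refine ⟨fun i => 1 + μ i, ?_, fun i => ?_⟩
  · refine hch.trans ?_
    rw [hμ, prod_comp]
    congr 1
    refine Finset.prod_congr rfl fun i _ => ?_
    simp only [sub_comp, X_comp, C_comp, C_add]
    ring
  -- From here on μ is the quotient yᵀMy / (βE) with y = Yu and E = uᵀBu; what remains is to compare
  -- q with E in both directions.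
  obtain ⟨u, hu0, hu⟩ := hμu i
  simp only [smul_mulVec, dotProduct_smul, smul_eq_mul] at hu0 hu
  have hE : 0 < u ⬝ᵥ B *ᵥ u := pos_of_mul_pos_right hu0 hβ.le
  set E := u ⬝ᵥ B *ᵥ u
  set y : ι → ℝ := Y *ᵥ u with hy
  set l : ℝ := Λ ⬝ᵥ u with hl
  have hyM : y ⬝ᵥ M *ᵥ y = μ i * (β * E) := by
    rw [← hu, ← mulVec_mulVec, ← mulVec_mulVec, dotProduct_mulVec u, ← mulVec_transpose,
      transpose_transpose]
  set q := ∑ i, ω i * y i ^ 2 with hq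
  have hq0 : 0 ≤ q := Finset.sum_nonneg fun i _ => mul_nonneg (hω i).le (sq_nonneg _)
  have hyω : ω ⬝ᵥ y = 0 := by rw [hy, dotProduct_mulVec, hY2, zero_dotProduct]
  have hKy : K *ᵥ y + l • ω = N *ᵥ u := by
    rw [← hY1, add_mulVec, vecMulVec_mulVec, hy, mulVec_mulVec]
    simp [hl]
  have hNu : ∀ j, (N *ᵥ u) (e j) = (B *ᵥ u) j := fun j => by
    simp [mulVec, dotProduct, hNb]
  have hNu0 : ∀ k, k ∉ Set.range e → (N *ᵥ u) k = 0 := fun k hk => by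
    simp [mulVec, dotProduct, hN0 k hk]
  -- Testing the state equation with y kills l because ωᵀy = 0. Cauchy–Schwarz for `B` and the
  -- Poincaré inequality give q² ≤ CP² c₃ q E.
  have hup : q ≤ CP ^ 2 * c₃ * E := by
    have h1 : y ⬝ᵥ K *ᵥ y = (y ∘ e) ⬝ᵥ B *ᵥ u := by
      have : y ⬝ᵥ K *ᵥ y = y ⬝ᵥ N *ᵥ u := by
        rw [← hKy, dotProduct_add, dotProduct_smul, dotProduct_comm y ω, hyω, smul_zero, add_zero]
      rw [this, dotProduct, dotProduct]
      refine (Finset.sum_subset (Finset.subset_univ (Finset.univ.image e)) ?_).symm.trans ?_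
      · intro k _ hk
        rw [hNu0 k (by simpa using hk), mul_zero]
      · rw [Finset.sum_image (fun _ _ _ _ h => he h)]
        simp [hNu]
    have h2 := sq_dotProduct_mulVec_le hBs hB0 (y ∘ e) u
    have h3 : (y ∘ e) ⬝ᵥ B *ᵥ (y ∘ e) ≤ c₃ * q := by
      refine (hB2 _).trans (mul_le_mul_of_nonneg_left ?_ hc₃.le)
      rw [hq]
      refine le_trans (le_of_eq ?_) (Finset.sum_le_sum_of_subset_of_nonneg
        (Finset.subset_univ (Finset.univ.image e))
        fun i _ _ => mul_nonneg (hω i).le (sq_nonneg _))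
      rw [Finset.sum_image (fun _ _ _ _ h => he h)]
      rfl
    have h4 := hP y hyω
    rw [h1] at h4
    set z := (y ∘ e) ⬝ᵥ B *ᵥ u
    have h5 : z ^ 2 ≤ c₃ * q * E := h2.trans (mul_le_mul_of_nonneg_right h3 hE.le)
    rcases hq0.eq_or_lt with h0 | h0
    · rw [← h0]; positivity
    · have h6 : q ^ 2 ≤ CP ^ 2 * (c₃ * q * E) :=
        (pow_le_pow_left₀ hq0 h4 2).trans (by rw [mul_pow]; gcongr)
      have : q * q ≤ q * (CP ^ 2 * c₃ * E) := by linarith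
      exact le_of_mul_le_mul_left this h0
  -- Conversely the control is recovered from the residual f = Ky, measured in the dual norm F = Σ
  -- f_i²/ω_i.
  have hlow : c₂ * E ≤ c₅ * (2 * (1 + a / c₄) * k ^ 2) * q := by
    set f := K *ᵥ y with hf
    set F := ∑ i, f i ^ 2 / ω i with hF
    have hF0 : 0 ≤ F := Finset.sum_nonneg fun i _ => div_nonneg (sq_nonneg _) (hω i).le
    have hFq : F ≤ k ^ 2 * q := by
      -- Testing f = Ky with w = f/ω gives F² ≤ (wᵀKw)(yᵀKy) ≤ kF · kq.
      set w : ι → ℝ := fun i => f i / ω i with hw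
      have h1 : w ⬝ᵥ K *ᵥ y = F := by
        simp only [dotProduct, hF, hw, ← hf]
        exact Finset.sum_congr rfl fun i _ => by ring
      have h2 : ∑ i, ω i * w i ^ 2 = F := Finset.sum_congr rfl fun i _ => by
        have := (hω i).ne'
        simp only [hw]; field_simp
      have h3 := sq_dotProduct_mulVec_le hKs hK0 w y
      rw [h1] at h3
      have h4 : F ^ 2 ≤ (k * F) * (k * q) := h3.trans
        (mul_le_mul ((hK1 w).trans_eq (by rw [h2])) (hK1 y) (hK0 y) (by positivity))
      rcases hF0.eq_or_lt with h0 | h0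
      · rw [← h0]; positivity
      · have : F * F ≤ F * (k ^ 2 * q) := by linarith
        exact le_of_mul_le_mul_left this h0
    -- At the nodes of `s` the coupling vanishes, so f = -lω there, and these terms of F already sum
    -- to l² Σ_s ω_i.
    have hlF : l ^ 2 * c₄ ≤ F := by
      refine (mul_le_mul_of_nonneg_left h₄ (sq_nonneg l)).trans ?_
      rw [Finset.mul_sum]
      refine le_trans (Finset.sum_le_sum fun i hi => ?_)
        (Finset.sum_le_sum_of_subset_of_nonneg (Finset.subset_univ s)
          fun i _ _ => div_nonneg (sq_nonneg (f i)) (hω i).le)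
      have h1 := congrFun hKy i
      rw [hNu0 i (hs i hi)] at h1
      simp only [Pi.add_apply, Pi.smul_apply, smul_eq_mul] at h1
      have h2 : f i = -(l * ω i) := by linarith
      have h3 := (hω i).ne'
      rw [h2]; field_simp; rfl
    have hl2 : l ^ 2 ≤ F / c₄ := (le_div_iff₀ hc₄).mpr hlF
    have hBu : ∑ j, (B *ᵥ u) j ^ 2 ≤ c₅ * (2 * F + 2 * l ^ 2 * a) := by
      have h1 : ∀ j, (B *ᵥ u) j ^ 2 ≤
          c₅ * (2 * (f (e j) ^ 2 / ω (e j)) + 2 * l ^ 2 * ω (e j)) := fun j => by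
        have h2 := congrFun hKy (e j)
        rw [hNu j] at h2
        simp only [Pi.add_apply, Pi.smul_apply, smul_eq_mul] at h2
        have h3 := hω (e j)
        calc (B *ᵥ u) j ^ 2 ≤ 2 * f (e j) ^ 2 + 2 * (l * ω (e j)) ^ 2 := by
              rw [← h2]; nlinarith [sq_nonneg (f (e j) - l * ω (e j))]
          _ = ω (e j) * (2 * (f (e j) ^ 2 / ω (e j)) + 2 * l ^ 2 * ω (e j)) := by
              field_simp
          _ ≤ _ := mul_le_mul_of_nonneg_right (h₅ _) (by positivity)
      refine (Finset.sum_le_sum fun j _ => h1 j).trans ?_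
      rw [← Finset.mul_sum]
      refine mul_le_mul_of_nonneg_left ?_ hc₅.le
      have h2 : ∑ j, (2 * (f (e j) ^ 2 / ω (e j)) + 2 * l ^ 2 * ω (e j)) ≤
          ∑ i, (2 * (f i ^ 2 / ω i) + 2 * l ^ 2 * ω i) := by
        refine le_trans (le_of_eq ?_) (Finset.sum_le_sum_of_subset_of_nonneg
          (Finset.subset_univ (Finset.univ.image e)) fun i _ _ => ?_)
        · rw [Finset.sum_image (fun _ _ _ _ h => he h)]
        · have := hω i
          positivity
      refine h2.trans ?_
      rw [Finset.sum_add_distrib, ← Finset.mul_sum, ← Finset.mul_sum]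
      gcongr
    -- Combine E² ≤ |u|²|Bu|² with c₂|u|² ≤ E.
    have hEB : c₂ * E ≤ ∑ j, (B *ᵥ u) j ^ 2 := by
      have h1 : E ^ 2 ≤ (∑ j, u j ^ 2) * ∑ j, (B *ᵥ u) j ^ 2 :=
        Finset.sum_mul_sq_le_sq_mul_sq _ _ _
      have h2 := hB1 u
      have h3 : 0 ≤ ∑ j, (B *ᵥ u) j ^ 2 := Finset.sum_nonneg fun _ _ => sq_nonneg _
      have h4 : E * (c₂ * E) ≤ E * ∑ j, (B *ᵥ u) j ^ 2 := by
        calc E * (c₂ * E) = c₂ * E ^ 2 := by ring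
          _ ≤ c₂ * ((∑ j, u j ^ 2) * ∑ j, (B *ᵥ u) j ^ 2) := by gcongr
          _ = (c₂ * ∑ j, u j ^ 2) * ∑ j, (B *ᵥ u) j ^ 2 := by ring
          _ ≤ _ := mul_le_mul_of_nonneg_right h2 h3
      exact le_of_mul_le_mul_left h4 hE
    calc c₂ * E ≤ c₅ * (2 * F + 2 * l ^ 2 * a) := hEB.trans hBu
      _ ≤ c₅ * (2 * F + 2 * (F / c₄) * a) := by gcongr
      _ = c₅ * (2 * (1 + a / c₄)) * F := by ring
      _ ≤ c₅ * (2 * (1 + a / c₄)) * (k ^ 2 * q) := by gcongr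
      _ = _ := by ring
  have h1 := hM1 y
  have h2 := hM2 y
  rw [hyM] at h1 h2
  constructor
  · refine add_le_add le_rfl ?_
    rw [div_le_iff₀ hβ, div_le_iff₀ (by positivity)]
    refine le_of_mul_le_mul_right ?_ hE
    calc c₁ * c₂ * E = c₁ * (c₂ * E) := by ring
      _ ≤ c₁ * (c₅ * (2 * (1 + a / c₄) * k ^ 2) * q) := by gcongr
      _ = c₅ * (2 * (1 + a / c₄) * k ^ 2) * (c₁ * q) := by ring
      _ ≤ c₅ * (2 * (1 + a / c₄) * k ^ 2) * (μ i * (β * E)) := by gcongr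
      _ = _ := by ring
  · refine add_le_add le_rfl ?_
    rw [le_div_iff₀ hβ]
    refine le_of_mul_le_mul_right ?_ hE
    linarith

end Matrix

end

/-! ### Triangles, barycentric coordinates and hat functions. -/

noncomputable section

namespace NeumannControl

namespace Mesh

variable {Ω : Set Plane}

/-- The triangles of a mesh. -/
def Tri (T : Mesh Ω) : Type := {t : Finset Plane // t ∈ T.faces ∧ t.card = 3}

instance (T : Mesh Ω) : Fintype T.Tri :=
  (T.finite_faces.subset (fun _ h => h.1) : {t | t ∈ T.faces ∧ t.card = 3}.Finite).fintype

/-- The closed region covered by a triangle. -/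
def Tri.hull {T : Mesh Ω} (t : T.Tri) : Set Plane := convexHull ℝ (t.1 : Set Plane)

theorem Tri.convex_hull {T : Mesh Ω} (t : T.Tri) : Convex ℝ t.hull := convex_convexHull ℝ _

theorem Tri.isCompact_hull {T : Mesh Ω} (t : T.Tri) : IsCompact t.hull :=
  t.1.finite_toSet.isCompact_convexHull ℝ

theorem Tri.isClosed_hull {T : Mesh Ω} (t : T.Tri) : IsClosed t.hull := t.isCompact_hull.isClosed

/-- The vertices of a triangle as an affine basis of the plane. -/
def Tri.basis {T : Mesh Ω} (t : T.Tri) : AffineBasis t.1 ℝ Plane where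
  toFun := Subtype.val
  ind' := T.indep t.2.1
  tot' := by
    rw [(T.indep t.2.1).affineSpan_eq_top_iff_card_eq_finrank_add_one]
    simp [t.2.2]

theorem Tri.hull_eq {T : Mesh Ω} (t : T.Tri) : t.hull = convexHull ℝ (Set.range t.basis) := by
  have : Set.range t.basis = (t.1 : Set Plane) := Subtype.range_coe
  rw [this, Tri.hull]

/-- The barycentric coordinate of a triangle at a node, which vanishes identically unless the node
is a vertex of the triangle. -/
def Tri.coord {T : Mesh Ω} (t : T.Tri) (p : T.Node) : Plane →ᵃ[ℝ] ℝ :=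
  if h : p.pos ∈ t.1 then t.basis.coord ⟨p.pos, h⟩ else 0

theorem mem_vertices_of_mem {T : Mesh Ω} {s : Finset Plane} (hs : s ∈ T.faces) {y : Plane}
    (hy : y ∈ s) : y ∈ T.toSimplicialComplex.vertices :=
  T.down_closed hs (Finset.singleton_subset_iff.mpr hy) (Finset.singleton_nonempty y)

theorem exists_node {T : Mesh Ω} {s : Finset Plane} (hs : s ∈ T.faces) {y : Plane}
    (hy : y ∈ s) : ∃ p : T.Node, p.pos = y := ⟨⟨y, mem_vertices_of_mem hs hy⟩, rfl⟩

theorem Tri.coord_of_mem {T : Mesh Ω} (t : T.Tri) {p : T.Node} (h : p.pos ∈ t.1) :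
    t.coord p = t.basis.coord ⟨p.pos, h⟩ := dif_pos h

theorem Tri.coord_of_notMem {T : Mesh Ω} (t : T.Tri) {p : T.Node} (h : p.pos ∉ t.1) :
    t.coord p = 0 := dif_neg h

open Classical in
theorem Tri.sum_node {T : Mesh Ω} (t : T.Tri) {E : Type} [AddCommGroup E] (F : t.1 → E) :
    ∑ p : T.Node, (if h : p.pos ∈ t.1 then F ⟨p.pos, h⟩ else 0) = ∑ y, F y := by
  rw [← Finset.sum_filter_of_ne (p := fun p : T.Node => p.pos ∈ t.1)
    (fun p _ hp => by by_contra h; exact hp (dif_neg h))]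
  refine Finset.sum_bij (fun p hp => ⟨p.pos, (Finset.mem_filter.mp hp).2⟩)
    (fun _ _ => Finset.mem_univ _)
    (fun p _ q _ h => Node.pos_injective T (Subtype.mk.inj h)) (fun y _ => ?_)
    (fun p hp => dif_pos (Finset.mem_filter.mp hp).2)
  obtain ⟨p, hp⟩ := exists_node t.2.1 y.2
  exact ⟨p, by simp [hp], Subtype.ext hp⟩

theorem Tri.sum_coord {T : Mesh Ω} (t : T.Tri) (x : Plane) : ∑ p, t.coord p x = 1 := by
  classical
  rw [← t.basis.sum_coord_apply_eq_one x, ← t.sum_node]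
  refine Finset.sum_congr rfl fun p _ => ?_
  by_cases h : p.pos ∈ t.1
  · rw [dif_pos h, t.coord_of_mem h]
  · rw [dif_neg h, t.coord_of_notMem h]; rfl

theorem Tri.sum_coord_smul {T : Mesh Ω} (t : T.Tri) (x : Plane) :
    ∑ p, t.coord p x • p.pos = x := by
  classical
  refine Eq.trans ?_ (t.basis.linear_combination_coord_eq_self x)
  rw [← t.sum_node]
  refine Finset.sum_congr rfl fun p _ => ?_
  by_cases h : p.pos ∈ t.1
  · rw [dif_pos h, t.coord_of_mem h]; rfl
  · rw [dif_neg h, t.coord_of_notMem h]; exact zero_smul _ _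

theorem Tri.mem_hull_iff {T : Mesh Ω} (t : T.Tri) {x : Plane} :
    x ∈ t.hull ↔ ∀ p, 0 ≤ t.coord p x := by
  rw [t.hull_eq, t.basis.convexHull_eq_nonneg_coord]
  constructor
  · intro h p
    by_cases hp : p.pos ∈ t.1
    · rw [t.coord_of_mem hp]; exact h _
    · rw [t.coord_of_notMem hp]; exact le_rfl
  · intro h y
    obtain ⟨p, hp⟩ := exists_node t.2.1 y.2
    have h1 : p.pos ∈ t.1 := hp ▸ y.2
    have := h p
    rw [t.coord_of_mem h1] at this
    have e : (⟨p.pos, h1⟩ : t.1) = y := Subtype.ext hp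
    rwa [e] at this

theorem Tri.mem_interior_iff {T : Mesh Ω} (t : T.Tri) {x : Plane} :
    x ∈ interior t.hull ↔ ∀ p : T.Node, p.pos ∈ t.1 → 0 < t.coord p x := by
  rw [t.hull_eq, t.basis.interior_convexHull]
  constructor
  · intro h p hp
    rw [t.coord_of_mem hp]; exact h _
  · intro h y
    obtain ⟨p, hp⟩ := exists_node t.2.1 y.2
    have h1 : p.pos ∈ t.1 := hp ▸ y.2
    have := h p h1
    rw [t.coord_of_mem h1] at this
    have e : (⟨p.pos, h1⟩ : t.1) = y := Subtype.ext hp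
    rwa [e] at this

theorem Tri.isBarycentric {T : Mesh Ω} (t : T.Tri) {x : Plane} (hx : x ∈ t.hull) :
    T.IsBarycentric x (fun p => t.coord p x) :=
  ⟨t.mem_hull_iff.mp hx, t.sum_coord x, t.sum_coord_smul x, t.1, t.2.1, fun p hp => by
    by_contra h; exact hp (by simp [t.coord_of_notMem h])⟩

theorem Tri.hat_eq {T : Mesh Ω} (t : T.Tri) {x : Plane} (hx : x ∈ t.hull) (p : T.Node) :
    T.hat p x = t.coord p x := (t.isBarycentric hx).hat_eq p

theorem Tri.hull_subset {T : Mesh Ω} (t : T.Tri) : t.hull ⊆ closure Ω :=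
  T.space_eq_closure ▸ T.convexHull_subset_space t.2.1

theorem exists_tri {T : Mesh Ω} {x : Plane} (hx : x ∈ closure Ω) : ∃ t : T.Tri, x ∈ t.hull := by
  rw [← T.space_eq_closure, Geometry.SimplicialComplex.mem_space_iff] at hx
  obtain ⟨s, hs, hx⟩ := hx
  obtain ⟨t, ht, hst, h3⟩ := T.pure_dim_two s hs
  exact ⟨⟨t, ht, h3⟩, convexHull_mono (by exact_mod_cast hst) hx⟩

theorem IsBarycentric.mem_convexHull {T : Mesh Ω} {x : Plane} {w : T.Node → ℝ}
    (hw : T.IsBarycentric x w) {s : Finset Plane} (hs : ∀ p, w p ≠ 0 → p.pos ∈ s) :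
    x ∈ convexHull ℝ (s : Set Plane) := by
  classical
  obtain ⟨h0, h1, h2, -⟩ := hw
  have e1 : ∑ p with w p ≠ 0, w p = 1 := by rw [Finset.sum_filter_ne_zero, h1]
  have e2 : ∑ p with w p ≠ 0, w p • p.pos = x := by
    rw [Finset.sum_filter_of_ne, h2]
    intro p _ hp h
    exact hp (by rw [h, zero_smul])
  rw [← e2]
  exact (convex_convexHull ℝ _).sum_mem (fun p _ => h0 p) e1
    (fun p hp => subset_convexHull ℝ _ (hs p (Finset.mem_filter.mp hp).2))

theorem IsBarycentric.mem_closure {T : Mesh Ω} {x : Plane} {w : T.Node → ℝ}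
    (hw : T.IsBarycentric x w) : x ∈ closure Ω := by
  obtain ⟨s, hs, h3⟩ := hw.2.2.2
  exact T.space_eq_closure ▸ T.convexHull_subset_space hs (hw.mem_convexHull h3)

theorem hat_of_notMem {T : Mesh Ω} {x : Plane} (hx : x ∉ closure Ω) (p : T.Node) :
    T.hat p x = 0 := dif_neg fun ⟨_, hw⟩ => hx hw.mem_closure

theorem hat_nonneg (T : Mesh Ω) (p : T.Node) (x : Plane) : 0 ≤ T.hat p x := by
  by_cases hx : x ∈ closure Ω
  · obtain ⟨t, ht⟩ := exists_tri (T := T) hx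
    rw [t.hat_eq ht]; exact t.mem_hull_iff.mp ht p
  · rw [hat_of_notMem hx]

theorem sum_hat (T : Mesh Ω) {x : Plane} (hx : x ∈ closure Ω) : ∑ p, T.hat p x = 1 := by
  obtain ⟨t, ht⟩ := exists_tri (T := T) hx
  rw [← t.sum_coord x]
  exact Finset.sum_congr rfl fun p _ => t.hat_eq ht p

theorem hat_le_one (T : Mesh Ω) (p : T.Node) (x : Plane) : T.hat p x ≤ 1 := by
  by_cases hx : x ∈ closure Ω
  · rw [← T.sum_hat hx]
    exact Finset.single_le_sum (f := fun q => T.hat q x) (fun q _ => T.hat_nonneg q x)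
      (Finset.mem_univ p)
  · rw [hat_of_notMem hx]; exact zero_le_one

theorem Tri.continuous_coord {T : Mesh Ω} (t : T.Tri) (p : T.Node) : Continuous (t.coord p) :=
  (t.coord p).continuous_of_finiteDimensional

theorem iUnion_hull (T : Mesh Ω) : ⋃ t : T.Tri, t.hull = closure Ω :=
  Set.Subset.antisymm (Set.iUnion_subset fun t => t.hull_subset)
    fun _ hx => Set.mem_iUnion.mpr (exists_tri hx)

/-- The hat is affine on each of the finitely many closed triangles that cover the closure. -/
theorem continuousOn_hat (T : Mesh Ω) (p : T.Node) : ContinuousOn (T.hat p) (closure Ω) := by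
  rw [← T.iUnion_hull]
  refine (locallyFinite_of_finite _).continuousOn_iUnion (fun t => t.isClosed_hull) fun t => ?_
  exact (t.continuous_coord p).continuousOn.congr fun x hx => t.hat_eq hx p

theorem measurable_hat (T : Mesh Ω) (p : T.Node) : Measurable (T.hat p) := by
  classical
  have := (T.continuousOn_hat p).measurable_piecewise (g := fun _ => 0) continuousOn_const
    isClosed_closure.measurableSet
  convert this using 1
  ext x
  by_cases hx : x ∈ closure Ω
  · simp [hx]
  · simp [hx, hat_of_notMem hx]

theorem isCompact_closure (T : Mesh Ω) : IsCompact (closure Ω) := by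
  rw [← T.iUnion_hull]
  exact isCompact_iUnion fun t => t.isCompact_hull

/-- The gradient of a barycentric coordinate. -/
def Tri.grad {T : Mesh Ω} (t : T.Tri) (p : T.Node) : Plane :=
  (InnerProductSpace.toDual ℝ Plane).symm (LinearMap.toContinuousLinearMap (t.coord p).linear)

theorem Tri.inner_grad {T : Mesh Ω} (t : T.Tri) (p : T.Node) (x : Plane) :
    inner ℝ (t.grad p) x = (t.coord p).linear x := by
  rw [Tri.grad, InnerProductSpace.toDual_symm_apply]; rfl

theorem Tri.coord_sub {T : Mesh Ω} (t : T.Tri) (p : T.Node) (x y : Plane) :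
    t.coord p x - t.coord p y = inner ℝ (t.grad p) (x - y) := by
  rw [t.inner_grad]
  exact ((t.coord p).linearMap_vsub x y).symm

theorem Tri.grad_of_notMem {T : Mesh Ω} (t : T.Tri) {p : T.Node} (h : p.pos ∉ t.1) :
    t.grad p = 0 := by
  rw [Tri.grad, t.coord_of_notMem h]
  simp

theorem Tri.gradient_hat {T : Mesh Ω} (t : T.Tri) {x : Plane} (hx : x ∈ interior t.hull)
    (p : T.Node) : gradient (T.hat p) x = t.grad p := by
  have h1 : T.hat p =ᶠ[nhds x] t.coord p := by
    filter_upwards [mem_interior_iff_mem_nhds.mp hx] with y hy using t.hat_eq hy p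
  have h2 : HasGradientAt (t.coord p) (t.grad p) x := by
    rw [hasGradientAt_iff_hasFDerivAt]
    have e : (t.coord p : Plane → ℝ) =
        fun y => InnerProductSpace.toDual ℝ Plane (t.grad p) (y - x) + t.coord p x := by
      ext y
      rw [InnerProductSpace.toDual_apply_apply, ← t.coord_sub]; ring
    rw [e]
    exact (((InnerProductSpace.toDual ℝ Plane (t.grad p)).hasFDerivAt).comp x
      ((hasFDerivAt_id x).sub_const x)).add_const _
  exact (h2.congr_of_eventuallyEq h1).gradient

end Mesh

end NeumannControl

end

/-! ### Shape regularity: gradients, edge lengths and areas. -/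

noncomputable section

namespace NeumannControl

namespace Mesh

open MeasureTheory

variable {Ω : Set Plane}

/-- The area of a triangle. -/
def Tri.area {T : Mesh Ω} (t : T.Tri) : ℝ := volume.real t.hull

theorem Tri.area_nonneg {T : Mesh Ω} (t : T.Tri) : 0 ≤ t.area := measureReal_nonneg

theorem Tri.volume_ne_top {T : Mesh Ω} (t : T.Tri) : volume t.hull ≠ ⊤ :=
  t.isCompact_hull.measure_ne_top

theorem Tri.diam_le_size {T : Mesh Ω} (t : T.Tri) : Metric.diam t.hull ≤ T.size := by
  refine le_csSup (Set.Finite.bddAbove ?_) ⟨t.1, t.2.1, t.2.2, rfl⟩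
  refine (T.finite_faces.image fun t : Finset Plane => Metric.diam (convexHull ℝ (t : Set Plane))).subset ?_
  rintro r ⟨s, hs, -, rfl⟩
  exact ⟨s, hs, rfl⟩

theorem Tri.dist_le {T : Mesh Ω} (t : T.Tri) {x y : Plane} (hx : x ∈ t.hull) (hy : y ∈ t.hull) :
    dist x y ≤ T.size :=
  (Metric.dist_le_diam_of_mem t.isCompact_hull.isBounded hx hy).trans t.diam_le_size

open Classical in
/-- The nodes which are vertices of a triangle. -/
def Tri.nodes {T : Mesh Ω} (t : T.Tri) : Finset T.Node :=
  Finset.univ.filter fun p => p.pos ∈ t.1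

theorem Tri.mem_nodes {T : Mesh Ω} {t : T.Tri} {p : T.Node} : p ∈ t.nodes ↔ p.pos ∈ t.1 := by
  simp [Tri.nodes]

theorem Tri.card_nodes {T : Mesh Ω} (t : T.Tri) : t.nodes.card = 3 := by
  rw [← t.2.2]
  refine Finset.card_bij (fun p _ => p.pos) (fun p hp => mem_nodes.mp hp)
    (fun p _ q _ h => Node.pos_injective T h) fun y hy => ?_
  obtain ⟨p, hp⟩ := exists_node t.2.1 hy
  exact ⟨p, mem_nodes.mpr (hp ▸ hy), hp⟩

theorem Tri.pos_mem_hull {T : Mesh Ω} {t : T.Tri} {p : T.Node} (h : p ∈ t.nodes) :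
    p.pos ∈ t.hull := subset_convexHull ℝ _ (mem_nodes.mp h)

theorem Tri.coord_of_notMem_nodes {T : Mesh Ω} (t : T.Tri) {p : T.Node} (h : p ∉ t.nodes)
    (x : Plane) : t.coord p x = 0 := by
  rw [t.coord_of_notMem fun h' => h (mem_nodes.mpr h')]; rfl

theorem Tri.coord_pos {T : Mesh Ω} {t : T.Tri} {q : T.Node} (h : q ∈ t.nodes) (p : T.Node) :
    t.coord p q.pos = if p = q then 1 else 0 := by
  rw [← t.hat_eq (pos_mem_hull h), T.hat_pos]

theorem Tri.sum_nodes_coord {T : Mesh Ω} (t : T.Tri) (x : Plane) :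
    ∑ p ∈ t.nodes, t.coord p x = 1 := by
  rw [← t.sum_coord x]
  exact Finset.sum_subset (Finset.subset_univ _) fun p _ hp => t.coord_of_notMem_nodes hp x

theorem exists_tri_node {T : Mesh Ω} (p : T.Node) : ∃ t : T.Tri, p ∈ t.nodes := by
  obtain ⟨t, ht, hpt, h3⟩ := T.pure_dim_two {p.pos} p.2
  exact ⟨⟨t, ht, h3⟩, Tri.mem_nodes.mpr (hpt (Finset.mem_singleton_self _))⟩

theorem dist_le_of_hat_ne_zero {T : Mesh Ω} {p : T.Node} {x : Plane} (h : T.hat p x ≠ 0) :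
    dist x p.pos ≤ T.size := by
  have hx : x ∈ closure Ω := by
    by_contra hx; exact h (hat_of_notMem hx p)
  obtain ⟨t, ht⟩ := exists_tri (T := T) hx
  rw [t.hat_eq ht] at h
  have hp : p ∈ t.nodes := by
    by_contra hp; exact h (t.coord_of_notMem_nodes hp x)
  exact t.dist_le ht (Tri.pos_mem_hull hp)

theorem Tri.size_pos {T : Mesh Ω} (t : T.Tri) : 0 < T.size := by
  obtain ⟨p, q, hp, hq, hpq⟩ : ∃ p q, p ∈ t.nodes ∧ q ∈ t.nodes ∧ p ≠ q := by
    have : 1 < t.nodes.card := by rw [t.card_nodes]; norm_num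
    obtain ⟨p, hp, q, hq, h⟩ := Finset.one_lt_card.mp this
    exact ⟨p, q, hp, hq, h⟩
  refine (dist_pos.mpr ?_).trans_le (t.dist_le (pos_mem_hull hp) (pos_mem_hull hq))
  exact fun h => hpq (Node.pos_injective T h)

/-- Across the inscribed disc, along its diameter 2σh in the direction of the gradient, a coordinate
with values in [0, 1] cannot grow by more than 1. -/
theorem Tri.norm_grad_mul_le {T : Mesh Ω} {σ : ℝ} (hσ : 0 < σ) (hT : T.QuasiUniform σ) (t : T.Tri)
    (p : T.Node) : 2 * σ * T.size * ‖t.grad p‖ ≤ 1 := by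
  obtain ⟨x, hx⟩ := hT t.1 t.2.1 t.2.2
  have hh := t.size_pos
  rcases eq_or_ne (t.grad p) 0 with h0 | h0
  · rw [h0]; simp
  set g := t.grad p
  have hg : 0 < ‖g‖ := norm_pos_iff.mpr h0
  set w : Plane := (σ * T.size / ‖g‖) • g with hw
  have hwn : ‖w‖ = σ * T.size := by
    rw [hw, norm_smul, Real.norm_of_nonneg (by positivity)]; field_simp
  have h1 : x + w ∈ t.hull := hx (by simp [hwn])
  have h2 : x - w ∈ t.hull := hx (by simp [hwn])
  have h3 : t.coord p (x + w) ≤ 1 := t.hat_eq h1 p ▸ T.hat_le_one p _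
  have h4 := t.mem_hull_iff.mp h2 p
  have h5 := t.coord_sub p (x + w) (x - w)
  have h6 : x + w - (x - w) = (2 : ℝ) • w := by rw [two_smul]; abel
  rw [h6, hw, inner_smul_right, inner_smul_right, real_inner_self_eq_norm_sq] at h5
  have h7 : 2 * (σ * T.size / ‖g‖ * ‖g‖ ^ 2) = 2 * σ * T.size * ‖g‖ := by field_simp
  change _ = 2 * (σ * T.size / ‖g‖ * ‖g‖ ^ 2) at h5
  linarith

/-- The coordinate of p drops from 1 to 0 along the edge, and its slope is at most 1/(2σh). -/
theorem Tri.le_dist {T : Mesh Ω} {σ : ℝ} (hσ : 0 < σ) (hT : T.QuasiUniform σ) {t : T.Tri}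
    {p q : T.Node} (hp : p ∈ t.nodes) (hq : q ∈ t.nodes) (hpq : p ≠ q) :
    2 * σ * T.size ≤ dist p.pos q.pos := by
  have h1 := t.coord_sub p p.pos q.pos
  rw [coord_pos hp, coord_pos hq, if_pos rfl, if_neg hpq, sub_zero] at h1
  have h2 := real_inner_le_norm (t.grad p) (p.pos - q.pos)
  rw [← h1] at h2
  have h3 := t.norm_grad_mul_le hσ hT p
  have h4 := t.size_pos
  rw [dist_eq_norm]
  calc 2 * σ * T.size = 2 * σ * T.size * 1 := (mul_one _).symm
    _ ≤ 2 * σ * T.size * (‖t.grad p‖ * ‖p.pos - q.pos‖) := by gcongr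
    _ = (2 * σ * T.size * ‖t.grad p‖) * ‖p.pos - q.pos‖ := by ring
    _ ≤ 1 * ‖p.pos - q.pos‖ := by gcongr
    _ = _ := one_mul _

/-- The area of the unit disc. -/
def discArea : ℝ := volume.real (Metric.ball (0 : Plane) 1)

theorem discArea_pos : 0 < discArea :=
  ENNReal.toReal_pos (Metric.measure_ball_pos volume _ one_pos).ne' measure_ball_lt_top.ne

theorem volume_real_closedBall (x : Plane) {r : ℝ} (hr : 0 ≤ r) :
    volume.real (Metric.closedBall x r) = r ^ 2 * discArea := by
  rw [Measure.real, Measure.addHaar_closedBall _ _ hr, ENNReal.toReal_mul,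
    ENNReal.toReal_ofReal (by positivity)]
  simp [discArea, Measure.real]

theorem Tri.le_area {T : Mesh Ω} {σ : ℝ} (hσ : 0 < σ) (hT : T.QuasiUniform σ) (t : T.Tri) :
    (σ * T.size) ^ 2 * discArea ≤ t.area := by
  obtain ⟨x, hx⟩ := hT t.1 t.2.1 t.2.2
  rw [← volume_real_closedBall x (mul_nonneg hσ.le t.size_pos.le)]
  exact measureReal_mono hx t.volume_ne_top

/-! ### Decomposition of integrals over the triangles -/

/-- At an interior point the nonzero barycentric weights sit exactly at the vertices of the
triangle, and the weights are unique. -/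
theorem Tri.eq_of_mem_interior {T : Mesh Ω} {t t' : T.Tri} {x : Plane}
    (h : x ∈ interior t.hull) (h' : x ∈ interior t'.hull) : t = t' := by
  have hc := (t.isBarycentric (interior_subset h)).unique (t'.isBarycentric (interior_subset h'))
  have key : ∀ {t t' : T.Tri}, x ∈ interior t.hull →
      ((fun p => t.coord p x) = fun p => t'.coord p x) → t.1 ⊆ t'.1 := by
    intro t t' h hc y hy
    obtain ⟨p, rfl⟩ := exists_node t.2.1 hy
    by_contra hn
    have h1 := t.mem_interior_iff.mp h p hy
    have h2 := congrFun hc p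
    simp only [t'.coord_of_notMem hn] at h2
    rw [h2] at h1
    exact lt_irrefl _ h1
  exact Subtype.ext (Finset.Subset.antisymm (key h hc) (key h' hc.symm))

theorem Tri.interior_subset_of_regular {T : Mesh Ω} (hreg : interior (closure Ω) = Ω) (t : T.Tri) :
    interior t.hull ⊆ Ω :=
  (interior_mono t.hull_subset).trans hreg.subset

theorem Tri.interior_ae_eq {T : Mesh Ω} (t : T.Tri) :
    (interior t.hull : Set Plane) =ᵐ[volume] t.hull := by
  refine interior_ae_eq_of_null_frontier ?_
  exact t.convex_hull.addHaar_frontier volume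

/-- The interiors of triangles are disjoint and lie in Ω by regularity, the closed triangles cover
Ω, and frontiers of convex sets are null. -/
theorem restrict_eq_sum (T : Mesh Ω) (hreg : interior (closure Ω) = Ω) :
    (volume : Measure Plane).restrict Ω = ∑ t : T.Tri, volume.restrict t.hull := by
  have h1 : (⋃ t : T.Tri, interior t.hull : Set Plane) =ᵐ[volume] Ω := by
    have h2 : (⋃ t : T.Tri, interior t.hull : Set Plane) =ᵐ[volume] ⋃ t : T.Tri, t.hull :=
      Filter.EventuallyEq.countable_iUnion fun t => t.interior_ae_eq
    refine (LE.le.eventuallyLE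
      (Set.iUnion_subset fun t => t.interior_subset_of_regular hreg)).antisymm ?_
    have h3 : Ω ⊆ ⋃ t : T.Tri, t.hull := by
      rw [T.iUnion_hull]; exact subset_closure
    exact (LE.le.eventuallyLE h3).trans h2.symm.le
  rw [← Measure.restrict_congr_set h1, Measure.restrict_iUnion, Measure.sum_fintype]
  · exact Finset.sum_congr rfl fun t _ => Measure.restrict_congr_set t.interior_ae_eq
  · intro t t' htt'
    refine Set.disjoint_left.mpr fun x hx hx' => htt' (Tri.eq_of_mem_interior hx hx')
  · exact fun t => isOpen_interior.measurableSet

theorem setIntegral_eq_sum (T : Mesh Ω) (hreg : interior (closure Ω) = Ω) {f : Plane → ℝ}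
    (hf : ∀ t : T.Tri, IntegrableOn f t.hull) :
    ∫ x in Ω, f x = ∑ t : T.Tri, ∫ x in t.hull, f x := by
  rw [T.restrict_eq_sum hreg, integral_finsetSum_measure fun t _ => hf t]

/-- The finite element function with prescribed nodal values. -/
def interp (T : Mesh Ω) (y : T.Node → ℝ) (x : Plane) : ℝ := ∑ p, y p * T.hat p x

theorem measurable_interp (T : Mesh Ω) (y : T.Node → ℝ) : Measurable (T.interp y) :=
  Finset.measurable_sum _ fun p _ => (T.measurable_hat p).const_mul _

theorem Tri.interp_eq {T : Mesh Ω} (t : T.Tri) (y : T.Node → ℝ) {x : Plane} (hx : x ∈ t.hull) :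
    T.interp y x = ∑ p ∈ t.nodes, y p * t.coord p x := by
  rw [interp]
  refine (Finset.sum_subset (Finset.subset_univ _) fun p _ hp => ?_).symm.trans
    (Finset.sum_congr rfl fun p _ => ?_)
  · rw [t.hat_eq hx, t.coord_of_notMem_nodes hp, mul_zero]
  · rw [t.hat_eq hx]

/-- Convexity of the square, the hats being weights of sum one. -/
theorem interp_sq_le (T : Mesh Ω) (y : T.Node → ℝ) {x : Plane} (hx : x ∈ closure Ω) :
    T.interp y x ^ 2 ≤ ∑ p, y p ^ 2 * T.hat p x := by
  have h := Finset.sum_sq_le_sum_mul_sum_of_sq_le_mul Finset.univ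
    (r := fun p => y p * T.hat p x) (f := fun p => T.hat p x) (g := fun p => y p ^ 2 * T.hat p x)
    (fun p _ => T.hat_nonneg p x) (fun p _ => mul_nonneg (sq_nonneg _) (T.hat_nonneg p x))
    (fun p _ => by ring_nf; rfl)
  rwa [T.sum_hat hx, one_mul] at h

theorem integrable_hat (T : Mesh Ω) (μ : Measure Plane) [IsFiniteMeasure μ] (p : T.Node) :
    Integrable (T.hat p) μ :=
  Integrable.of_bound (T.measurable_hat p).aestronglyMeasurable 1
    (Filter.Eventually.of_forall fun x => by
      rw [Real.norm_of_nonneg (T.hat_nonneg p x)]; exact T.hat_le_one p x)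

theorem integrable_hat_mul (T : Mesh Ω) (μ : Measure Plane) [IsFiniteMeasure μ] (p q : T.Node) :
    Integrable (fun x => T.hat p x * T.hat q x) μ :=
  Integrable.of_bound ((T.measurable_hat p).mul (T.measurable_hat q)).aestronglyMeasurable 1
    (Filter.Eventually.of_forall fun x => by
      rw [Real.norm_of_nonneg (mul_nonneg (T.hat_nonneg p x) (T.hat_nonneg q x))]
      exact mul_le_one₀ (T.hat_le_one p x) (T.hat_nonneg q x) (T.hat_le_one q x))

theorem interp_sq_eq (T : Mesh Ω) (y : T.Node → ℝ) (x : Plane) :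
    T.interp y x ^ 2 = ∑ p, ∑ q, y p * y q * (T.hat p x * T.hat q x) := by
  rw [interp, sq, Finset.sum_mul_sum]
  exact Finset.sum_congr rfl fun p _ => Finset.sum_congr rfl fun q _ => by ring

theorem integrable_interp_sq (T : Mesh Ω) (μ : Measure Plane) [IsFiniteMeasure μ]
    (y : T.Node → ℝ) : Integrable (fun x => T.interp y x ^ 2) μ := by
  simp only [interp_sq_eq]
  exact integrable_finsetSum _ fun p _ => integrable_finsetSum _ fun q _ =>
    (T.integrable_hat_mul μ p q).const_mul _

theorem integral_interp_sq (T : Mesh Ω) (μ : Measure Plane) [IsFiniteMeasure μ]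
    (y : T.Node → ℝ) :
    ∫ x, T.interp y x ^ 2 ∂μ = ∑ p, ∑ q, y p * y q * ∫ x, T.hat p x * T.hat q x ∂μ := by
  simp only [interp_sq_eq]
  rw [integral_finsetSum _ fun p _ => integrable_finsetSum _ fun q _ =>
    (T.integrable_hat_mul μ p q).const_mul _]
  refine Finset.sum_congr rfl fun p _ => ?_
  rw [integral_finsetSum _ fun q _ => (T.integrable_hat_mul μ p q).const_mul _]
  exact Finset.sum_congr rfl fun q _ => integral_const_mul _ _

theorem isFiniteMeasure_restrict (T : Mesh Ω) :
    IsFiniteMeasure ((volume : Measure Plane).restrict Ω) :=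
  ⟨by
    rw [Measure.restrict_apply_univ]
    exact (measure_mono subset_closure).trans_lt T.isCompact_closure.measure_lt_top⟩

theorem Tri.isFiniteMeasure_restrict {T : Mesh Ω} (t : T.Tri) :
    IsFiniteMeasure ((volume : Measure Plane).restrict t.hull) :=
  ⟨by rw [Measure.restrict_apply_univ]; exact t.volume_ne_top.lt_top⟩

end Mesh

end NeumannControl

end

noncomputable section

namespace NeumannControl

namespace Mesh

open MeasureTheory

variable {Ω : Set Plane}

/-! ### Mass and stiffness matrices -/

/-- On the copy of the triangle shrunk by 1/4 towards p, the weight of p is at least 3/4 and the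
others share at most 1/4. Since |y p| is maximal, the function is at least |y p|/2 there; with area
1/16 of the whole this makes 1/64. -/
theorem Tri.le_integral_interp_sq_of_max {T : Mesh Ω} (t : T.Tri) {p : T.Node} (hp : p ∈ t.nodes)
    (y : T.Node → ℝ) (hy : ∀ q ∈ t.nodes, |y q| ≤ |y p|) :
    t.area / 64 * y p ^ 2 ≤ ∫ x in t.hull, T.interp y x ^ 2 := by
  have := t.isFiniteMeasure_restrict
  set H : Set Plane := AffineMap.homothety p.pos (1 / 4 : ℝ) '' t.hull with hH
  have hsub : H ⊆ t.hull := by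
    rintro _ ⟨x, hx, rfl⟩
    rw [AffineMap.homothety_eq_lineMap]
    exact t.convex_hull.lineMap_mem (pos_mem_hull hp) hx ⟨by norm_num, by norm_num⟩
  have hHc : IsCompact H :=
    t.isCompact_hull.image (AffineMap.continuous_of_finiteDimensional _)
  have hHv : volume.real H = t.area / 16 := by
    rw [hH, Measure.real, Measure.addHaar_image_homothety, ENNReal.toReal_mul,
      ENNReal.toReal_ofReal (by positivity)]
    change _ * t.area = _
    simp
    norm_num [abs_of_pos]
    ring
  have hlow : ∀ x ∈ H, y p ^ 2 / 4 ≤ T.interp y x ^ 2 := by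
    intro x hx
    have hxh := hsub hx
    have hc : 3 / 4 ≤ t.coord p x := by
      obtain ⟨z, hz, rfl⟩ := hx
      rw [AffineMap.homothety_eq_lineMap, AffineMap.apply_lineMap, coord_pos hp, if_pos rfl,
        AffineMap.lineMap_apply_module]
      have := t.mem_hull_iff.mp hz p
      simp only [smul_eq_mul]
      linarith
    have h1 := t.interp_eq y hxh
    have h2 := t.sum_nodes_coord x
    classical
    rw [← Finset.add_sum_erase _ _ hp] at h1 h2
    have h3 : |∑ q ∈ t.nodes.erase p, y q * t.coord q x| ≤ |y p| * (1 / 4) := by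
      refine (Finset.abs_sum_le_sum_abs _ _).trans ?_
      have : ∑ q ∈ t.nodes.erase p, |y q * t.coord q x| ≤
          ∑ q ∈ t.nodes.erase p, |y p| * t.coord q x := by
        refine Finset.sum_le_sum fun q hq => ?_
        have h0 := t.mem_hull_iff.mp hxh q
        rw [abs_mul, abs_of_nonneg h0]
        exact mul_le_mul_of_nonneg_right (hy q (Finset.mem_of_mem_erase hq)) h0
      refine this.trans ?_
      rw [← Finset.mul_sum]
      exact mul_le_mul_of_nonneg_left (by linarith) (abs_nonneg _)
    have h4 : |y p| * (1 / 2) ≤ |T.interp y x| := by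
      have h5 : |y p| * (3 / 4) ≤ |y p * t.coord p x| := by
        rw [abs_mul, abs_of_nonneg ((by norm_num : (0 : ℝ) ≤ 3 / 4).trans hc)]
        exact mul_le_mul_of_nonneg_left hc (abs_nonneg _)
      have h6 := abs_sub_abs_le_abs_add (y p * t.coord p x)
        (∑ q ∈ t.nodes.erase p, y q * t.coord q x)
      rw [← h1] at h6
      linarith
    rw [← sq_abs (y p), ← sq_abs (T.interp y x)]
    nlinarith [abs_nonneg (y p)]
  calc t.area / 64 * y p ^ 2 = ∫ x in H, y p ^ 2 / 4 := by
        rw [setIntegral_const, hHv, smul_eq_mul]; ring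
    _ ≤ ∫ x in H, T.interp y x ^ 2 := by
        refine setIntegral_mono_on (integrableOn_const hHc.measure_ne_top)
          ((T.integrable_interp_sq _ y).mono_measure (Measure.restrict_mono_set _ hsub))
          hHc.isClosed.measurableSet hlow
    _ ≤ _ := setIntegral_mono_set (T.integrable_interp_sq _ y)
        (Filter.Eventually.of_forall fun x => sq_nonneg _) (LE.le.eventuallyLE hsub)

theorem Tri.le_integral_interp_sq {T : Mesh Ω} (t : T.Tri) (y : T.Node → ℝ) :
    t.area / 192 * ∑ q ∈ t.nodes, y q ^ 2 ≤ ∫ x in t.hull, T.interp y x ^ 2 := by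
  have hne : t.nodes.Nonempty := Finset.card_pos.mp (by rw [t.card_nodes]; norm_num)
  obtain ⟨p, hp, hmax⟩ := t.nodes.exists_max_image (fun q => |y q|) hne
  refine le_trans ?_ (t.le_integral_interp_sq_of_max hp y hmax)
  have h1 : ∑ q ∈ t.nodes, y q ^ 2 ≤ 3 * y p ^ 2 := by
    have := Finset.sum_le_card_nsmul t.nodes (fun q => y q ^ 2) (y p ^ 2)
      fun q hq => sq_le_sq.mpr (hmax q hq)
    rwa [t.card_nodes, nsmul_eq_mul] at this
  have := t.area_nonneg
  nlinarith

/-- The area of the union of the triangles around a node. -/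
def starArea (T : Mesh Ω) (p : T.Node) : ℝ :=
  ∑ t : T.Tri, t.nodes.sum fun q => if q = p then t.area else 0

theorem sum_area_mul (T : Mesh Ω) (f : T.Node → ℝ) :
    ∑ t : T.Tri, t.area * ∑ q ∈ t.nodes, f q = ∑ p, T.starArea p * f p := by
  simp only [starArea, Finset.sum_mul]
  rw [Finset.sum_comm]
  refine Finset.sum_congr rfl fun t _ => ?_
  rw [Finset.sum_comm, Finset.mul_sum]
  refine Finset.sum_congr rfl fun q _ => ?_
  simp [ite_mul]

theorem Tri.area_le_starArea {T : Mesh Ω} {t : T.Tri} {p : T.Node} (hp : p ∈ t.nodes) :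
    t.area ≤ T.starArea p := by
  have h1 : ∀ t : T.Tri, 0 ≤ t.nodes.sum fun q => if q = p then t.area else 0 := fun t =>
    Finset.sum_nonneg fun q _ => by
      split_ifs
      · exact t.area_nonneg
      · exact le_rfl
  refine le_trans (le_of_eq ?_) (Finset.single_le_sum (fun t _ => h1 t) (Finset.mem_univ t))
  rw [Finset.sum_ite_eq' t.nodes p (fun _ => t.area), if_pos hp]

theorem dotProduct_mulVec_eq_sum {ι : Type} [Fintype ι] (A : Matrix ι ι ℝ) (y : ι → ℝ) :
    y ⬝ᵥ A *ᵥ y = ∑ p, ∑ q, y p * y q * A p q := by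
  simp only [dotProduct, Matrix.mulVec, Finset.mul_sum]
  exact Finset.sum_congr rfl fun p _ => Finset.sum_congr rfl fun q _ => by ring

theorem dotProduct_consistentMass (T : Mesh Ω) (y : T.Node → ℝ) :
    y ⬝ᵥ T.consistentMass *ᵥ y = ∫ x in Ω, T.interp y x ^ 2 := by
  have := T.isFiniteMeasure_restrict
  rw [T.integral_interp_sq, dotProduct_mulVec_eq_sum]
  rfl

theorem integral_interp_sq_eq_sum (T : Mesh Ω) (hreg : interior (closure Ω) = Ω)
    (y : T.Node → ℝ) :
    ∫ x in Ω, T.interp y x ^ 2 = ∑ t : T.Tri, ∫ x in t.hull, T.interp y x ^ 2 :=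
  T.setIntegral_eq_sum hreg fun t => by
    have := t.isFiniteMeasure_restrict
    exact T.integrable_interp_sq _ y

theorem starArea_le_consistentMass (T : Mesh Ω) (hreg : interior (closure Ω) = Ω)
    (y : T.Node → ℝ) :
    1 / 192 * ∑ p, T.starArea p * y p ^ 2 ≤ y ⬝ᵥ T.consistentMass *ᵥ y := by
  rw [T.dotProduct_consistentMass, T.integral_interp_sq_eq_sum hreg,
    ← T.sum_area_mul fun p => y p ^ 2, Finset.mul_sum]
  refine Finset.sum_le_sum fun t _ => le_trans (le_of_eq (by ring)) (t.le_integral_interp_sq y)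

theorem consistentMass_le (T : Mesh Ω) (y : T.Node → ℝ) :
    y ⬝ᵥ T.consistentMass *ᵥ y ≤ ∑ p, T.omega p * y p ^ 2 := by
  have := T.isFiniteMeasure_restrict
  rw [T.dotProduct_consistentMass]
  have h1 : ∑ p, T.omega p * y p ^ 2 = ∫ x in Ω, ∑ p, y p ^ 2 * T.hat p x := by
    rw [integral_finsetSum _ fun p _ => (T.integrable_hat _ p).const_mul _]
    refine Finset.sum_congr rfl fun p _ => ?_
    rw [integral_const_mul, omega, mul_comm]
  rw [h1]
  refine integral_mono_of_nonneg (Filter.Eventually.of_forall fun x => sq_nonneg _)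
    (integrable_finsetSum _ fun p _ => (T.integrable_hat _ p).const_mul _) ?_
  -- Measurability of Ω is not assumed; in the remaining case the bound is checked at every point,
  -- all hats being zero off the closure.
  by_cases hΩ : NullMeasurableSet Ω (volume : Measure Plane)
  · filter_upwards [ae_restrict_mem₀ hΩ] with x hx using T.interp_sq_le y (subset_closure hx)
  · refine Filter.Eventually.of_forall fun x => ?_
    by_cases hx : x ∈ closure Ω
    · exact T.interp_sq_le y hx
    · simp [interp, hat_of_notMem hx]

/-- Both bounds on the mass matrix, tested with one unit vector, are compared. -/
theorem starArea_le_omega (T : Mesh Ω) (hreg : interior (closure Ω) = Ω) (p : T.Node) :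
    T.starArea p ≤ 192 * T.omega p := by
  have h := (T.starArea_le_consistentMass hreg (Pi.single p 1)).trans (T.consistentMass_le _)
  have e : ∀ f : T.Node → ℝ, ∑ q, f q * (Pi.single p (1 : ℝ) : T.Node → ℝ) q ^ 2 = f p :=
    fun f => by
      rw [Finset.sum_eq_single p]
      · simp
      · intro q _ hq; simp [hq]
      · intro h; exact absurd (Finset.mem_univ p) h
  rw [e, e] at h
  linarith

theorem omega_le_starArea (T : Mesh Ω) (hreg : interior (closure Ω) = Ω) (p : T.Node) :
    T.omega p ≤ T.starArea p := by
  rw [omega, T.setIntegral_eq_sum hreg fun t => by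
    have := t.isFiniteMeasure_restrict
    exact T.integrable_hat _ p]
  refine Finset.sum_le_sum fun t _ => ?_
  have := t.isFiniteMeasure_restrict
  rw [Finset.sum_ite_eq' t.nodes p (fun _ => t.area)]
  split_ifs with hp
  · calc ∫ x in t.hull, T.hat p x ≤ ∫ x in t.hull, (1 : ℝ) :=
          integral_mono (T.integrable_hat _ p) (integrable_const _) fun x => T.hat_le_one p x
      _ = t.area := by simp [Tri.area]
  · refine (setIntegral_eq_zero_of_forall_eq_zero fun x hx => ?_).le
    rw [t.hat_eq hx, t.coord_of_notMem_nodes hp]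

theorem consistentMass_lower (T : Mesh Ω) (hreg : interior (closure Ω) = Ω) (y : T.Node → ℝ) :
    1 / 192 * ∑ p, T.omega p * y p ^ 2 ≤ y ⬝ᵥ T.consistentMass *ᵥ y := by
  refine le_trans ?_ (T.starArea_le_consistentMass hreg y)
  gcongr with p
  exact T.omega_le_starArea hreg p

theorem le_omega (T : Mesh Ω) (hreg : interior (closure Ω) = Ω) {σ : ℝ} (hσ : 0 < σ)
    (hT : T.QuasiUniform σ) (p : T.Node) :
    (σ * T.size) ^ 2 * discArea / 192 ≤ T.omega p := by
  obtain ⟨t, ht⟩ := exists_tri_node p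
  have h1 := t.le_area hσ hT
  have h2 := Tri.area_le_starArea ht
  have h3 := T.starArea_le_omega hreg p
  linarith

theorem size_pos_of_node {T : Mesh Ω} (p : T.Node) : 0 < T.size := by
  obtain ⟨t, -⟩ := exists_tri_node p
  exact t.size_pos

theorem omega_pos (T : Mesh Ω) (hreg : interior (closure Ω) = Ω) {σ : ℝ} (hσ : 0 < σ)
    (hT : T.QuasiUniform σ) (p : T.Node) : 0 < T.omega p := by
  have := discArea_pos
  have := size_pos_of_node p
  exact lt_of_lt_of_le (by positivity) (T.le_omega hreg hσ hT p)

/-- A hat is at most one and lives within distance h of its node. -/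
theorem omega_le (T : Mesh Ω) (p : T.Node) : T.omega p ≤ T.size ^ 2 * discArea := by
  have := T.isFiniteMeasure_restrict
  rw [← volume_real_closedBall p.pos (size_pos_of_node p).le, omega]
  have h1 : ∀ x, T.hat p x ≤ (Metric.closedBall p.pos T.size).indicator 1 x := fun x => by
    by_cases hx : x ∈ Metric.closedBall p.pos T.size
    · simpa [hx] using T.hat_le_one p x
    · have : T.hat p x = 0 := by
        by_contra h; exact hx (dist_le_of_hat_ne_zero h)
      simp [hx, this]
  have hm : MeasurableSet (Metric.closedBall p.pos T.size) :=
    Metric.isClosed_closedBall.measurableSet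
  calc ∫ x in Ω, T.hat p x
      ≤ ∫ x in Ω, (Metric.closedBall p.pos T.size).indicator (1 : Plane → ℝ) x :=
        integral_mono (T.integrable_hat _ p) ((integrable_const (1 : ℝ)).indicator hm) h1
    _ = (volume.restrict Ω).real (Metric.closedBall p.pos T.size) := integral_indicator_one hm
    _ ≤ _ := by
        refine ENNReal.toReal_mono (isCompact_closedBall _ _).measure_ne_top ?_
        exact Measure.restrict_apply_le _ _

theorem sum_omega (T : Mesh Ω) (hreg : interior (closure Ω) = Ω) :
    ∑ p, T.omega p = volume.real Ω := by
  have := T.isFiniteMeasure_restrict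
  have hm : MeasurableSet Ω := by rw [← hreg]; exact isOpen_interior.measurableSet
  simp only [omega]
  rw [← integral_finsetSum _ fun p _ => T.integrable_hat _ p,
    setIntegral_congr_fun hm (g := fun _ => (1 : ℝ)) fun x hx => T.sum_hat (subset_closure hx)]
  simp

theorem consistentMass_transpose (T : Mesh Ω) : T.consistentMassᵀ = T.consistentMass := by
  ext i j
  simp only [consistentMass, Matrix.transpose_apply, Matrix.of_apply, mul_comm]

/-- The hats sum to one on the closure; consequently the lumped mass matrix is exactly diag(ω). -/
theorem sum_consistentMass (T : Mesh Ω) (p : T.Node) :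
    ∑ q, T.consistentMass p q = T.omega p := by
  have := T.isFiniteMeasure_restrict
  simp only [consistentMass, Matrix.of_apply, omega]
  rw [← integral_finsetSum _ fun q _ => T.integrable_hat_mul _ p q]
  refine integral_congr_ae (Filter.Eventually.of_forall fun x => ?_)
  simp only [← Finset.mul_sum]
  by_cases hx : x ∈ closure Ω
  · rw [T.sum_hat hx, mul_one]
  · rw [hat_of_notMem hx, zero_mul]

theorem dotProduct_lump {ι : Type} [Fintype ι] [DecidableEq ι] (A : Matrix ι ι ℝ) (y : ι → ℝ) :
    y ⬝ᵥ lump A *ᵥ y = ∑ i, (∑ j, A i j) * y i ^ 2 := by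
  simp only [lump, dotProduct, Matrix.mulVec_diagonal]
  exact Finset.sum_congr rfl fun i _ => by ring

theorem massMatrix_transpose (T : Mesh Ω) (r : MassRule) : (T.massMatrix r)ᵀ = T.massMatrix r := by
  cases r
  · exact T.consistentMass_transpose
  · exact Matrix.diagonal_transpose _

theorem massMatrix_le (T : Mesh Ω) (r : MassRule) (y : T.Node → ℝ) :
    y ⬝ᵥ T.massMatrix r *ᵥ y ≤ ∑ p, T.omega p * y p ^ 2 := by
  cases r
  · exact T.consistentMass_le y
  · rw [massMatrix, dotProduct_lump]
    simp only [T.sum_consistentMass]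
    exact le_rfl

theorem massMatrix_lower (T : Mesh Ω) (hreg : interior (closure Ω) = Ω) (r : MassRule)
    (y : T.Node → ℝ) :
    1 / 192 * ∑ p, T.omega p * y p ^ 2 ≤ y ⬝ᵥ T.massMatrix r *ᵥ y := by
  cases r
  · exact T.consistentMass_lower hreg y
  · rw [massMatrix, dotProduct_lump]
    simp only [T.sum_consistentMass]
    have h := (T.consistentMass_lower hreg y).trans (T.consistentMass_le y)
    linarith

/-- The gradient on a triangle of a finite element function. -/
def Tri.interpGrad {T : Mesh Ω} (t : T.Tri) (y : T.Node → ℝ) : Plane :=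
  ∑ p, y p • t.grad p

theorem stiffnessMatrix_apply (T : Mesh Ω) (hreg : interior (closure Ω) = Ω) (p q : T.Node) :
    T.stiffnessMatrix p q = ∑ t : T.Tri, t.area * inner ℝ (t.grad p) (t.grad q) := by
  have h1 : ∀ t : T.Tri, ∀ᵐ x ∂(volume.restrict t.hull),
      inner ℝ (gradient (T.hat p) x) (gradient (T.hat q) x) =
        (inner ℝ (t.grad p) (t.grad q) : ℝ) := fun t => by
    rw [← Measure.restrict_congr_set t.interior_ae_eq]
    filter_upwards [ae_restrict_mem isOpen_interior.measurableSet] with x hx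
    rw [t.gradient_hat hx, t.gradient_hat hx]
  rw [stiffnessMatrix, Matrix.of_apply, T.setIntegral_eq_sum hreg]
  · refine Finset.sum_congr rfl fun t _ => ?_
    rw [integral_congr_ae (h1 t), setIntegral_const, smul_eq_mul, Tri.area]
  · intro t
    have := t.isFiniteMeasure_restrict
    exact (integrable_const _).congr ((h1 t).mono fun x hx => hx.symm)

theorem stiffnessMatrix_transpose (T : Mesh Ω) : T.stiffnessMatrixᵀ = T.stiffnessMatrix := by
  ext i j
  simp only [stiffnessMatrix, Matrix.transpose_apply, Matrix.of_apply]
  exact integral_congr_ae (Filter.Eventually.of_forall fun x => real_inner_comm _ _)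

theorem dotProduct_stiffnessMatrix (T : Mesh Ω) (hreg : interior (closure Ω) = Ω)
    (y : T.Node → ℝ) :
    y ⬝ᵥ T.stiffnessMatrix *ᵥ y = ∑ t : T.Tri, t.area * ‖t.interpGrad y‖ ^ 2 := by
  have h1 : ∀ t : T.Tri, ‖t.interpGrad y‖ ^ 2 =
      ∑ p, ∑ q, y p * y q * inner ℝ (t.grad p) (t.grad q) := fun t => by
    rw [← real_inner_self_eq_norm_sq, Tri.interpGrad, sum_inner]
    refine Finset.sum_congr rfl fun p _ => ?_
    rw [inner_sum]
    refine Finset.sum_congr rfl fun q _ => ?_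
    rw [real_inner_smul_left, real_inner_smul_right, mul_assoc]
  rw [dotProduct_mulVec_eq_sum]
  simp only [h1, T.stiffnessMatrix_apply hreg, Finset.mul_sum]
  rw [Finset.sum_comm (s := (Finset.univ : Finset T.Tri))]
  refine Finset.sum_congr rfl fun p _ => ?_
  rw [Finset.sum_comm (s := (Finset.univ : Finset T.Tri))]
  exact Finset.sum_congr rfl fun q _ => Finset.sum_congr rfl fun t _ => by ring

/-- Three basis gradients, each of length at most 1/(2σh), and Cauchy–Schwarz for three terms. -/
theorem Tri.norm_interpGrad_sq_le {T : Mesh Ω} {σ : ℝ} (hσ : 0 < σ) (hT : T.QuasiUniform σ)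
    (t : T.Tri) (y : T.Node → ℝ) :
    ‖t.interpGrad y‖ ^ 2 ≤ 3 / (2 * σ * T.size) ^ 2 * ∑ q ∈ t.nodes, y q ^ 2 := by
  have hh := t.size_pos
  set d := 2 * σ * T.size with hd
  have hd0 : 0 < d := by positivity
  have h1 : ‖t.interpGrad y‖ ≤ d⁻¹ * ∑ q ∈ t.nodes, |y q| := by
    have : t.interpGrad y = ∑ q ∈ t.nodes, y q • t.grad q := by
      refine (Finset.sum_subset (Finset.subset_univ _) fun p _ hp => ?_).symm
      rw [t.grad_of_notMem fun h => hp (mem_nodes.mpr h), smul_zero]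
    rw [this, Finset.mul_sum]
    refine norm_sum_le_of_le _ fun q _ => ?_
    rw [norm_smul, Real.norm_eq_abs, mul_comm]
    refine mul_le_mul_of_nonneg_right ?_ (abs_nonneg _)
    rw [← one_div, le_div_iff₀ hd0, mul_comm]
    exact t.norm_grad_mul_le hσ hT q
  have h2 : (∑ q ∈ t.nodes, |y q|) ^ 2 ≤ 3 * ∑ q ∈ t.nodes, y q ^ 2 := by
    have := sq_sum_le_card_mul_sum_sq (s := t.nodes) (f := fun q => |y q|)
    simpa [t.card_nodes] using this
  calc ‖t.interpGrad y‖ ^ 2 ≤ (d⁻¹ * ∑ q ∈ t.nodes, |y q|) ^ 2 := by gcongr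
    _ = (d ^ 2)⁻¹ * (∑ q ∈ t.nodes, |y q|) ^ 2 := by rw [mul_pow, inv_pow]
    _ ≤ (d ^ 2)⁻¹ * (3 * ∑ q ∈ t.nodes, y q ^ 2) := by gcongr
    _ = _ := by ring

theorem stiffnessMatrix_nonneg (T : Mesh Ω) (hreg : interior (closure Ω) = Ω)
    (y : T.Node → ℝ) : 0 ≤ y ⬝ᵥ T.stiffnessMatrix *ᵥ y := by
  rw [T.dotProduct_stiffnessMatrix hreg]
  exact Finset.sum_nonneg fun t _ => mul_nonneg t.area_nonneg (sq_nonneg _)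

/-- The inverse estimate, summed over triangles; 144 = 3 · 192 / 4, with 192 from replacing star
areas by ω. -/
theorem stiffnessMatrix_le (T : Mesh Ω) (hreg : interior (closure Ω) = Ω) {σ : ℝ} (hσ : 0 < σ)
    (hT : T.QuasiUniform σ) (y : T.Node → ℝ) :
    y ⬝ᵥ T.stiffnessMatrix *ᵥ y ≤
      144 / (σ * T.size) ^ 2 * ∑ p, T.omega p * y p ^ 2 := by
  rw [T.dotProduct_stiffnessMatrix hreg]
  calc ∑ t : T.Tri, t.area * ‖t.interpGrad y‖ ^ 2
      ≤ ∑ t : T.Tri, t.area * (3 / (2 * σ * T.size) ^ 2 * ∑ q ∈ t.nodes, y q ^ 2) := by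
        gcongr with t
        · exact t.area_nonneg
        · exact t.norm_interpGrad_sq_le hσ hT y
    _ = 3 / (2 * σ * T.size) ^ 2 * ∑ p, T.starArea p * y p ^ 2 := by
        rw [← T.sum_area_mul fun p => y p ^ 2, Finset.mul_sum]
        exact Finset.sum_congr rfl fun t _ => by ring
    _ ≤ 3 / (2 * σ * T.size) ^ 2 * ∑ p, 192 * T.omega p * y p ^ 2 := by
        gcongr with p
        exact T.starArea_le_omega hreg p
    _ = _ := by
        simp only [mul_assoc, ← Finset.mul_sum]
        ring

end Mesh

end NeumannControl

end

noncomputable section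

namespace NeumannControl

namespace Mesh

open MeasureTheory

variable {Ω : Set Plane}

/-! ### The boundary of a triangulated domain -/

theorem isOpen_of_regular (hreg : interior (closure Ω) = Ω) : IsOpen Ω := by
  rw [← hreg]; exact isOpen_interior

theorem mem_of_mem_closure {x : Plane} (hx : x ∈ closure Ω)
    (hx' : x ∉ frontier Ω) : x ∈ Ω := by
  by_contra h
  exact hx' ⟨hx, fun hi => h (interior_subset hi)⟩

theorem notMem_frontier (hreg : interior (closure Ω) = Ω) {x : Plane} (hx : x ∈ Ω) :
    x ∉ frontier Ω := fun h => h.2 ((isOpen_of_regular hreg).interior_eq.symm ▸ hx)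

/-- Points in the relative interior of the same simplex of the mesh are either all interior points
of the domain or all boundary points. -/
theorem mem_of_hat_support_eq (T : Mesh Ω) (hreg : interior (closure Ω) = Ω) {x x' : Plane}
    (hx : x ∈ Ω) (hx' : x' ∈ closure Ω) (h : ∀ p, T.hat p x = 0 ↔ T.hat p x' = 0) : x' ∈ Ω := by
  obtain ⟨t', ht'⟩ := exists_tri (T := T) hx'
  -- Small translations that keep x in a triangle keep x' in it: coordinates vanishing at x' vanish
  -- at x and change by the same amount, the others stay positive near x'.
  have hT : ∀ t : T.Tri, ∀ᶠ z in nhds (0 : Plane), x + z ∈ t.hull → x' + z ∈ t.hull := by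
    intro t
    by_cases hxt : x ∈ t.hull
    · have hx't : x' ∈ t.hull := by
        refine (t'.isBarycentric ht').mem_convexHull fun p hp => ?_
        by_contra hn
        refine hp ?_
        rw [← t'.hat_eq ht', ← h, t.hat_eq hxt, t.coord_of_notMem hn]
        rfl
      have hp : ∀ p : T.Node, ∀ᶠ z in nhds (0 : Plane),
          0 ≤ t.coord p (x + z) → 0 ≤ t.coord p (x' + z) := by
        intro p
        by_cases h0 : T.hat p x' = 0
        · refine Filter.Eventually.of_forall fun z hz => ?_
          have e1 := t.coord_sub p (x + z) x
          have e2 := t.coord_sub p (x' + z) x'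
          rw [add_sub_cancel_left] at e1 e2
          rw [← t.hat_eq hxt, (h p).mpr h0] at e1
          rw [← t.hat_eq hx't, h0] at e2
          linarith
        · have h1 : 0 < t.coord p (x' + 0) := by
            rw [add_zero, ← t.hat_eq hx't]
            exact lt_of_le_of_ne (T.hat_nonneg p x') (Ne.symm h0)
          have hc : Continuous fun z => t.coord p (x' + z) :=
            (t.continuous_coord p).comp (continuous_const.add continuous_id)
          filter_upwards [hc.continuousAt.eventually (lt_mem_nhds h1)] with z hz _ using hz.le
      filter_upwards [Filter.eventually_all.mpr hp] with z hz hxz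
      rw [t.mem_hull_iff] at hxz ⊢
      exact fun p => hz p (hxz p)
    · have hc : Continuous fun z => x + z := continuous_const.add continuous_id
      have : ∀ᶠ z in nhds (0 : Plane), x + z ∈ t.hullᶜ :=
        hc.continuousAt.eventually
          (t.isClosed_hull.isOpen_compl.mem_nhds (by simpa using hxt))
      filter_upwards [this] with z hz hz' using absurd hz' hz
  have h1 : ∀ᶠ z in nhds (0 : Plane), x + z ∈ Ω := by
    have hc : Continuous fun z => x + z := continuous_const.add continuous_id
    exact hc.continuousAt.eventually ((isOpen_of_regular hreg).mem_nhds (by simpa using hx))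
  -- All small translates of x lie in triangles, so those of x' do too, and x' is interior to the
  -- closure.
  have h2 : ∀ᶠ z in nhds (0 : Plane), x' + z ∈ closure Ω := by
    filter_upwards [h1, Filter.eventually_all.mpr hT] with z hz hzT
    obtain ⟨t, ht⟩ := exists_tri (T := T) (subset_closure hz)
    exact t.hull_subset (hzT t ht)
  rw [← hreg, mem_interior_iff_mem_nhds]
  have hc : Continuous fun y => y - x' := continuous_id.sub continuous_const
  have h3 : ∀ᶠ y in nhds x', x' + (y - x') ∈ closure Ω := by
    have h4 : Filter.Tendsto (fun y => y - x') (nhds x') (nhds 0) := by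
      simpa using hc.tendsto x'
    exact h4.eventually h2
  filter_upwards [h3] with y hy
  rwa [add_sub_cancel] at hy

theorem pos_mem_closure {T : Mesh Ω} (p : T.Node) : p.pos ∈ closure Ω := by
  obtain ⟨t, ht⟩ := exists_tri_node p
  exact t.hull_subset (Tri.pos_mem_hull ht)

/-- The basis functions of interior nodes vanish on the boundary. -/
theorem hat_eq_zero_of_mem_frontier (T : Mesh Ω) (hreg : interior (closure Ω) = Ω) {p : T.Node}
    (hp : p.pos ∉ frontier Ω) {x : Plane} (hx : x ∈ frontier Ω) : T.hat p x = 0 := by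
  by_contra h
  have hpΩ := mem_of_mem_closure (pos_mem_closure p) hp
  have hxc : x ∈ closure Ω := frontier_subset_closure hx
  obtain ⟨t, ht⟩ := exists_tri (T := T) hxc
  have hpt : p ∈ t.nodes := by
    by_contra hn
    exact h (by rw [t.hat_eq ht, t.coord_of_notMem_nodes hn])
  have hc : Continuous fun s : ℝ => AffineMap.lineMap p.pos x s := AffineMap.lineMap_continuous
  have h1 : ∀ᶠ s in nhds (0 : ℝ), AffineMap.lineMap p.pos x s ∈ Ω :=
    hc.continuousAt.eventually ((isOpen_of_regular hreg).mem_nhds (by simpa using hpΩ))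
  -- A point of Ω on the way from p to x, close to p. If the hat of p were nonzero at x, both points
  -- would have the same nonzero weights, putting x in Ω.
  obtain ⟨s, hs, hs0, hs1⟩ : ∃ s : ℝ, AffineMap.lineMap p.pos x s ∈ Ω ∧ 0 < s ∧ s < 1 := by
    have h2 : ∀ᶠ s in nhdsWithin (0 : ℝ) (Set.Ioi 0), AffineMap.lineMap p.pos x s ∈ Ω :=
      h1.filter_mono nhdsWithin_le_nhds
    obtain ⟨s, hs, hs'⟩ := (h2.and (Ioo_mem_nhdsGT one_pos)).exists
    exact ⟨s, hs, hs'.1, hs'.2⟩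
  have hst : AffineMap.lineMap p.pos x s ∈ t.hull :=
    t.convex_hull.lineMap_mem (Tri.pos_mem_hull hpt) ht ⟨hs0.le, hs1.le⟩
  refine notMem_frontier hreg (T.mem_of_hat_support_eq hreg hs hxc fun q => ?_) hx
  rw [t.hat_eq hst, t.hat_eq ht, AffineMap.apply_lineMap, Tri.coord_pos hpt,
    AffineMap.lineMap_apply_module]
  by_cases hq : q = p
  · subst hq
    have h3 := t.mem_hull_iff.mp ht q
    rw [t.hat_eq ht] at h
    simp only [if_pos, smul_eq_mul]
    constructor
    · intro h4
      nlinarith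
    · intro h4; exact absurd h4 h
  · simp [hq, hs0.ne']

theorem Tri.exists_eq_lineMap {T : Mesh Ω} {t : T.Tri} {p q : T.Node} (hp : p ∈ t.nodes)
    (hq : q ∈ t.nodes) (hpq : p ≠ q) {x : Plane} (hx : x ∈ segment ℝ p.pos q.pos) :
    x ∈ t.hull ∧ ∃ s ∈ Set.Icc (0 : ℝ) 1, x = AffineMap.lineMap p.pos q.pos s ∧
      ∀ r, T.hat r x = if r = p then 1 - s else if r = q then s else 0 := by
  have hxt : x ∈ t.hull :=
    t.convex_hull.segment_subset (pos_mem_hull hp) (pos_mem_hull hq) hx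
  rw [segment_eq_image_lineMap] at hx
  obtain ⟨s, hs, rfl⟩ := hx
  refine ⟨hxt, s, hs, rfl, fun r => ?_⟩
  rw [t.hat_eq hxt, AffineMap.apply_lineMap, coord_pos hp, coord_pos hq,
    AffineMap.lineMap_apply_module]
  by_cases h1 : r = p
  · subst h1; simp [hpq]
  · by_cases h2 : r = q
    · simp [h2, Ne.symm hpq]
    · simp [h1, h2]

/-- Polar coordinates: the punctured disc is the image of an interval times the unit circle, which
is connected as the dimension exceeds one. -/
theorem isPreconnected_ball_diff (x : Plane) (r : ℝ) :
    IsPreconnected (Metric.ball x r \ {x}) := by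
  have hrank : 1 < Module.rank ℝ Plane := by
    rw [← Module.finrank_eq_rank, finrank_euclideanSpace_fin]; norm_num
  have h := (isPreconnected_Ioo (a := (0 : ℝ)) (b := r)).prod
    (isPreconnected_sphere hrank (0 : Plane) 1)
  convert h.image (fun z : ℝ × Plane => x + z.1 • z.2) (by fun_prop) using 1
  ext y
  simp only [Set.mem_sdiff, Metric.mem_ball, Set.mem_singleton_iff, Set.mem_image, Set.mem_prod,
    Set.mem_Ioo, mem_sphere_zero_iff_norm, Prod.exists]
  constructor
  · rintro ⟨hy, hne⟩
    have h0 : 0 < ‖y - x‖ := norm_pos_iff.mpr (sub_ne_zero.mpr hne)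
    refine ⟨‖y - x‖, ‖y - x‖⁻¹ • (y - x), ⟨⟨h0, by rwa [← dist_eq_norm]⟩, ?_⟩, ?_⟩
    · rw [norm_smul, norm_inv, norm_norm, inv_mul_cancel₀ h0.ne']
    · rw [smul_smul, mul_inv_cancel₀ h0.ne', one_smul, add_sub_cancel]
  · rintro ⟨s, u, ⟨⟨h1, h2⟩, h3⟩, rfl⟩
    refine ⟨by rw [dist_eq_norm, add_sub_cancel_left, norm_smul, h3, Real.norm_of_nonneg h1.le,
      mul_one]; exact h2, fun h => ?_⟩
    rw [add_eq_left, smul_eq_zero] at h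
    rcases h with h | h
    · exact h1.ne' h
    · rw [h, norm_zero] at h3; exact zero_ne_one h3

/-- Every boundary node is the endpoint of an edge contained in the boundary. -/
theorem exists_boundary_edge (T : Mesh Ω) (hreg : interior (closure Ω) = Ω) {p : T.Node}
    (hp : p.pos ∈ frontier Ω) :
    ∃ (t : T.Tri) (q : T.Node), p ∈ t.nodes ∧ q ∈ t.nodes ∧ p ≠ q ∧
      segment ℝ p.pos q.pos ⊆ frontier Ω := by
  by_contra! hcon
  -- If no edge at p lies in the boundary, then near p the closure minus p itself lies in Ω. The
  -- case to settle is x on an edge pq, where all weights other than those of p and q vanish.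
  have key : ∀ (t : T.Tri), p ∈ t.nodes → ∀ x ∈ t.hull, 0 < t.coord p x → x ≠ p.pos → x ∈ Ω := by
    intro t hpt x hx hxp hne
    by_cases hall : ∀ q ∈ t.nodes, 0 < t.coord q x
    · exact t.interior_subset_of_regular hreg
        (t.mem_interior_iff.mpr fun q hq => hall q (Tri.mem_nodes.mpr hq))
    push Not at hall
    obtain ⟨r, hr, hr0⟩ := hall
    have hr0' : t.coord r x = 0 := le_antisymm hr0 (t.mem_hull_iff.mp hx r)
    have hrp : r ≠ p := by rintro rfl; linarith
    obtain ⟨q, hqr, hqt, hqp⟩ : ∃ q, q ≠ r ∧ q ∈ t.nodes ∧ q ≠ p := by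
      classical
      have h3 : ((t.nodes.erase p).erase r).card = 1 := by
        rw [Finset.card_erase_of_mem (Finset.mem_erase.mpr ⟨hrp, hr⟩),
          Finset.card_erase_of_mem hpt, t.card_nodes]
      obtain ⟨q, hq⟩ := Finset.card_pos.mp (h3 ▸ one_pos)
      simp only [Finset.mem_erase] at hq
      exact ⟨q, hq.1, hq.2.2, hq.2.1⟩
    have hnodes : ∀ q', q' ≠ p → q' ≠ q → t.coord q' x = 0 := by
      classical
      intro q' h1 h2
      by_cases h3 : q' = r
      · rw [h3, hr0']
      · refine t.coord_of_notMem_nodes (fun h4 => ?_) x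
        have h5 : ({p, q, r, q'} : Finset T.Node).card ≤ 3 := by
          rw [← t.card_nodes]
          refine Finset.card_le_card ?_
          intro z hz
          simp only [Finset.mem_insert, Finset.mem_singleton] at hz
          rcases hz with rfl | rfl | rfl | rfl <;> assumption
        rw [Finset.card_insert_of_notMem (by simp [hqp.symm, hrp.symm, h1.symm]),
          Finset.card_insert_of_notMem (by simp [hqr, h2.symm]),
          Finset.card_insert_of_notMem (by simp [Ne.symm h3]), Finset.card_singleton] at h5
        omega
    have hsum := t.sum_coord_smul x
    have hone := t.sum_coord x
    have hpq : ∀ {E : Type} [AddCommGroup E] (f : T.Node → E),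
        (∀ q', q' ≠ p → q' ≠ q → f q' = 0) → ∑ q', f q' = f p + f q := by
      intro E _ f hf
      classical
      rw [← Finset.sum_subset (Finset.subset_univ {p, q})
        (fun z _ hz => by
          simp only [Finset.mem_insert, Finset.mem_singleton, not_or] at hz
          exact hf z hz.1 hz.2), Finset.sum_pair hqp.symm]
    rw [hpq _ hnodes] at hone
    rw [hpq _ fun q' h1 h2 => by rw [hnodes q' h1 h2, zero_smul]] at hsum
    have hq0 : t.coord q x ≠ 0 := by
      intro h0
      rw [h0, add_zero] at hone
      rw [h0, hone, one_smul, zero_smul, add_zero] at hsum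
      exact hne hsum.symm
    -- The edge has a point z of Ω. Inside the edge, z has the same nonzero weights as x; if z = q,
    -- the hat of q vanishes on the boundary but not at x.
    obtain ⟨z, hz, hzf⟩ := Set.not_subset.mp (hcon t q hpt hqt hqp.symm)
    obtain ⟨hzt, s, hs, hzs, hzh⟩ := Tri.exists_eq_lineMap hpt hqt hqp.symm hz
    have hzΩ := mem_of_mem_closure (t.hull_subset hzt) hzf
    have hs0 : s ≠ 0 := by
      rintro rfl
      rw [AffineMap.lineMap_apply_zero] at hzs
      exact hzf (hzs ▸ hp)
    by_cases hs1 : s = 1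
    · rw [hs1, AffineMap.lineMap_apply_one] at hzs
      refine mem_of_mem_closure (t.hull_subset hx) fun hxf => hq0 ?_
      rw [← t.hat_eq hx]
      exact T.hat_eq_zero_of_mem_frontier hreg (hzs ▸ hzf) hxf
    · refine T.mem_of_hat_support_eq hreg hzΩ (t.hull_subset hx) fun q' => ?_
      rw [hzh, t.hat_eq hx]
      by_cases h1 : q' = p
      · subst h1; simp [hxp.ne', sub_eq_zero, Ne.symm hs1]
      · by_cases h2 : q' = q
        · subst h2; simp [h1, hs0, hq0]
        · simp [h1, h2, hnodes q' h1 h2]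
  have hev : ∀ t : T.Tri, ∀ᶠ x in nhds p.pos, x ∈ t.hull → x ≠ p.pos → x ∈ Ω := by
    intro t
    by_cases hpt : p ∈ t.nodes
    · have h1 : 0 < t.coord p p.pos := by rw [Tri.coord_pos hpt, if_pos rfl]; exact one_pos
      filter_upwards [(t.continuous_coord p).continuousAt.eventually (lt_mem_nhds h1)] with x hx
        using fun hxt hne => key t hpt x hxt hx hne
    · have h1 : p.pos ∉ t.hull := fun h => by
        have := t.hat_eq h p
        rw [T.hat_pos, if_pos rfl, t.coord_of_notMem_nodes hpt] at this
        exact one_ne_zero this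
      filter_upwards [t.isClosed_hull.isOpen_compl.mem_nhds h1] with x hx hx' using absurd hx' hx
  obtain ⟨ε, hε, hball⟩ := Metric.eventually_nhds_iff_ball.mp (Filter.eventually_all.mpr hev)
  have hloc : ∀ x ∈ Metric.ball p.pos ε, x ∈ closure Ω → x ≠ p.pos → x ∈ Ω := by
    intro x hx hxc hne
    obtain ⟨t, ht⟩ := exists_tri (T := T) hxc
    exact hball x hx t ht hne
  -- In the punctured disc, which is connected and meets Ω, the open set Ω is also relatively
  -- closed, hence everything. Then p is interior to the closure, so p ∈ Ω: a contradiction.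
  have hsub : Metric.ball p.pos ε \ {p.pos} ⊆ Ω := by
    refine (isPreconnected_ball_diff p.pos ε).subset_of_closure_inter_subset
      (isOpen_of_regular hreg) ?_ fun x hx => hloc x hx.2.1 hx.1 hx.2.2
    obtain ⟨x, hxΩ, hx⟩ := Metric.mem_closure_iff.mp (pos_mem_closure p) ε hε
    refine ⟨x, ⟨by rwa [Metric.mem_ball, dist_comm], fun h => ?_⟩, hxΩ⟩
    rw [Set.mem_singleton_iff] at h
    exact notMem_frontier hreg hxΩ (h ▸ hp)
  refine notMem_frontier hreg (hreg.subset (mem_interior.mpr ?_)) hp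
  refine ⟨Metric.ball p.pos ε, fun x hx => ?_, Metric.isOpen_ball, Metric.mem_ball_self hε⟩
  by_cases h : x = p.pos
  · rw [h]; exact pos_mem_closure p
  · exact subset_closure (hsub ⟨hx, h⟩)

end Mesh

end NeumannControl

end

/-! ### Arc length on the boundary and the boundary mass matrix. -/

noncomputable section

namespace NeumannControl

namespace Mesh

open MeasureTheory

variable {Ω : Set Plane}

/-- Arc length on the boundary of the domain. -/
abbrev arcLength (Ω : Set Plane) : Measure Plane := μH[1].restrict (frontier Ω)

/-- Boundary points of Ω avoid the interior of a triangle, so they lie on its three edges, each of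
length at most h. -/
theorem Tri.arcLength_hull_le {T : Mesh Ω} (hreg : interior (closure Ω) = Ω) (t : T.Tri) :
    arcLength Ω t.hull ≤ ENNReal.ofReal (3 * T.size) := by
  classical
  have hsub : t.hull ∩ frontier Ω ⊆
      ⋃ p ∈ t.nodes, convexHull ℝ ((t.1.erase p.pos : Finset Plane) : Set Plane) := by
    rintro x ⟨hx, hxf⟩
    have hni : x ∉ interior t.hull := fun h =>
      notMem_frontier hreg (t.interior_subset_of_regular hreg h) hxf
    rw [t.mem_interior_iff] at hni
    push Not at hni
    obtain ⟨p, hp, hp0⟩ := hni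
    simp only [Set.mem_iUnion]
    refine ⟨p, mem_nodes.mpr hp, (t.isBarycentric hx).mem_convexHull fun q hq => ?_⟩
    rw [Finset.mem_erase]
    constructor
    · intro h
      rw [Node.pos_injective T h] at hq
      exact hq (le_antisymm hp0 (t.mem_hull_iff.mp hx p))
    · by_contra h
      exact hq (by simp [t.coord_of_notMem h])
  have hedge : ∀ p ∈ t.nodes,
      μH[1] (convexHull ℝ ((t.1.erase p.pos : Finset Plane) : Set Plane)) ≤
        ENNReal.ofReal T.size := by
    intro p hp
    have h2 : (t.1.erase p.pos).card = 2 := by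
      rw [Finset.card_erase_of_mem (mem_nodes.mp hp), t.2.2]
    obtain ⟨a, b, -, hab⟩ := Finset.card_eq_two.mp h2
    have ha : a ∈ t.1 := Finset.mem_of_mem_erase (hab ▸ by simp : a ∈ t.1.erase p.pos)
    have hb : b ∈ t.1 := Finset.mem_of_mem_erase (hab ▸ by simp : b ∈ t.1.erase p.pos)
    rw [hab, Finset.coe_pair, convexHull_pair, hausdorffMeasure_segment, edist_dist]
    exact ENNReal.ofReal_le_ofReal
      (t.dist_le (subset_convexHull ℝ _ ha) (subset_convexHull ℝ _ hb))
  rw [Measure.restrict_apply t.isClosed_hull.measurableSet]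
  calc μH[1] (t.hull ∩ frontier Ω)
      ≤ ∑ p ∈ t.nodes, μH[1] (convexHull ℝ ((t.1.erase p.pos : Finset Plane) : Set Plane)) :=
        (measure_mono hsub).trans (measure_biUnion_finset_le _ _)
    _ ≤ ∑ p ∈ t.nodes, ENNReal.ofReal T.size := Finset.sum_le_sum hedge
    _ = ENNReal.ofReal (3 * T.size) := by
        rw [Finset.sum_const, t.card_nodes, nsmul_eq_mul, ENNReal.ofReal_mul (by norm_num)]
        norm_num

theorem isFiniteMeasure_arcLength (T : Mesh Ω) (hreg : interior (closure Ω) = Ω) :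
    IsFiniteMeasure (arcLength Ω) := by
  refine ⟨?_⟩
  have h1 : arcLength Ω Set.univ = arcLength Ω (⋃ t : T.Tri, t.hull) := by
    rw [T.iUnion_hull, Measure.restrict_apply MeasurableSet.univ, Set.univ_inter,
      Measure.restrict_apply isClosed_closure.measurableSet,
      Set.inter_eq_self_of_subset_right frontier_subset_closure]
  rw [h1]
  refine (measure_iUnion_fintype_le _ _).trans_lt (ENNReal.sum_lt_top.mpr fun t _ => ?_)
  exact (t.arcLength_hull_le hreg).trans_lt ENNReal.ofReal_lt_top

/-- Each triangle around p carries boundary length at most 3h and area at least σ²h² times that of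
the unit disc; summing areas over the star gives 576 = 3 · 192. -/
theorem integral_arcLength_hat_le (T : Mesh Ω) (hreg : interior (closure Ω) = Ω) {σ : ℝ}
    (hσ : 0 < σ) (hT : T.QuasiUniform σ) (p : T.Node) :
    ∫ x, T.hat p x ∂(arcLength Ω) ≤
      576 / (σ ^ 2 * discArea) * T.size⁻¹ * T.omega p := by
  classical
  have := T.isFiniteMeasure_arcLength hreg
  have hh := size_pos_of_node p
  have hd := discArea_pos
  have h1 : ∀ x, T.hat p x ≤ ∑ t : T.Tri, if p ∈ t.nodes then
      t.hull.indicator (1 : Plane → ℝ) x else 0 := by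
    intro x
    have hnn : ∀ t : T.Tri, 0 ≤ if p ∈ t.nodes then t.hull.indicator (1 : Plane → ℝ) x else 0 :=
      fun t => by
        split_ifs
        · exact Set.indicator_nonneg (fun _ _ => zero_le_one) x
        · exact le_rfl
    by_cases hx : T.hat p x = 0
    · rw [hx]; exact Finset.sum_nonneg fun t _ => hnn t
    · have hxc : x ∈ closure Ω := by
        by_contra hx'; exact hx (hat_of_notMem hx' p)
      obtain ⟨t, ht⟩ := exists_tri (T := T) hxc
      have hp : p ∈ t.nodes := by
        by_contra hp; exact hx (by rw [t.hat_eq ht, t.coord_of_notMem_nodes hp])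
      refine (T.hat_le_one p x).trans (le_trans (le_of_eq ?_)
        (Finset.single_le_sum (fun t _ => hnn t) (Finset.mem_univ t)))
      simp [hp, ht]
  have hint : ∀ t : T.Tri, Integrable (t.hull.indicator (1 : Plane → ℝ)) (arcLength Ω) := fun t =>
    (integrable_const (1 : ℝ)).indicator t.isClosed_hull.measurableSet
  have hint' : ∀ t : T.Tri, Integrable (fun x => if p ∈ t.nodes then
      t.hull.indicator (1 : Plane → ℝ) x else 0) (arcLength Ω) := fun t => by
    split_ifs
    · exact hint t
    · exact integrable_zero _ _ _
  calc ∫ x, T.hat p x ∂(arcLength Ω)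
      ≤ ∫ x, (∑ t : T.Tri, if p ∈ t.nodes then
          t.hull.indicator (1 : Plane → ℝ) x else 0) ∂(arcLength Ω) :=
        integral_mono (T.integrable_hat _ p) (integrable_finsetSum _ fun t _ => hint' t) h1
    _ = ∑ t : T.Tri, if p ∈ t.nodes then (arcLength Ω).real t.hull else 0 := by
        rw [integral_finsetSum _ fun t _ => hint' t]
        refine Finset.sum_congr rfl fun t _ => ?_
        split_ifs
        · exact integral_indicator_one t.isClosed_hull.measurableSet
        · exact integral_zero _ _
    _ ≤ ∑ t : T.Tri, 3 / (σ ^ 2 * T.size * discArea) * if p ∈ t.nodes then t.area else 0 := by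
        refine Finset.sum_le_sum fun t _ => ?_
        split_ifs with hp
        · have h2 : (arcLength Ω).real t.hull ≤ 3 * T.size := by
            have := ENNReal.toReal_mono ENNReal.ofReal_ne_top (t.arcLength_hull_le hreg)
            rwa [ENNReal.toReal_ofReal (by positivity)] at this
          refine h2.trans ?_
          rw [div_mul_eq_mul_div, le_div_iff₀ (by positivity)]
          have := t.le_area hσ hT
          nlinarith
        · rw [mul_zero]
    _ = 3 / (σ ^ 2 * T.size * discArea) * T.starArea p := by
        rw [← Finset.mul_sum, starArea]
        congr 1
        refine Finset.sum_congr rfl fun t _ => ?_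
        rw [Finset.sum_ite_eq' t.nodes p (fun _ => t.area)]
    _ ≤ 3 / (σ ^ 2 * T.size * discArea) * (192 * T.omega p) := by
        gcongr
        exact T.starArea_le_omega hreg p
    _ = _ := by field_simp; ring

/-- Integrating only where the hat of p exceeds 1/2 keeps the regions of different nodes disjoint,
so that the bounds can later be added. -/
theorem le_integral_arcLength_interp_sq (T : Mesh Ω) (hreg : interior (closure Ω) = Ω) {σ : ℝ}
    (hσ : 0 < σ) (hT : T.QuasiUniform σ) {p : T.Node} (hp : p.pos ∈ frontier Ω)
    (y : T.Node → ℝ) :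
    σ / 128 * T.size * y p ^ 2 ≤
      ∫ x in {x | 1 / 2 < T.hat p x}, T.interp y x ^ 2 ∂(arcLength Ω) := by
  have := T.isFiniteMeasure_arcLength hreg
  obtain ⟨t, q, hpt, hqt, hpq, hseg⟩ := T.exists_boundary_edge hreg hp
  have hdist := Tri.le_dist hσ hT hpt hqt hpq
  -- It suffices to find a piece of a boundary edge, of parameter length 1/16 and within s < 1/2, on
  -- which |v| ≥ |y p|/4. As the edge has length at least 2σh, the piece has length at least σh/8.
  have key : ∀ a b : ℝ, 0 ≤ a → a + 1 / 16 ≤ b → b < 1 / 2 →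
      (∀ s ∈ Set.Icc a b, y p ^ 2 / 16 ≤ ((1 - s) * y p + s * y q) ^ 2) →
      σ / 128 * T.size * y p ^ 2 ≤
        ∫ x in {x | 1 / 2 < T.hat p x}, T.interp y x ^ 2 ∂(arcLength Ω) := by
    intro a b ha hab hb hs
    set f : ℝ → Plane := fun s => AffineMap.lineMap p.pos q.pos s with hf
    set S := segment ℝ (f a) (f b) with hS
    have hSeq : S = f '' Set.Icc a b := by
      rw [← segment_eq_Icc (by linarith : a ≤ b)]
      exact (image_segment ℝ (AffineMap.lineMap p.pos q.pos : ℝ →ᵃ[ℝ] Plane) a b).symm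
    have hSp : ∀ x ∈ S, x ∈ segment ℝ p.pos q.pos ∧ 1 / 2 < T.hat p x ∧
        y p ^ 2 / 16 ≤ T.interp y x ^ 2 := by
      intro x hx
      rw [hSeq] at hx
      obtain ⟨s, hsab, rfl⟩ := hx
      have hs01 : s ∈ Set.Icc (0 : ℝ) 1 := ⟨ha.trans hsab.1, by linarith [hsab.2]⟩
      have hmem : f s ∈ segment ℝ p.pos q.pos := by
        rw [segment_eq_image_lineMap]; exact ⟨s, hs01, rfl⟩
      have hft : f s ∈ t.hull :=
        t.convex_hull.segment_subset (Tri.pos_mem_hull hpt) (Tri.pos_mem_hull hqt) hmem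
      have hc : ∀ r, T.hat r (f s) = if r = p then 1 - s else if r = q then s else 0 := by
        intro r
        rw [t.hat_eq hft, hf, AffineMap.apply_lineMap, Tri.coord_pos hpt, Tri.coord_pos hqt,
          AffineMap.lineMap_apply_module]
        by_cases h1 : r = p
        · subst h1; simp [hpq]
        · by_cases h2 : r = q
          · simp [h2, Ne.symm hpq]
          · simp [h1, h2]
      refine ⟨hmem, ?_, ?_⟩
      · rw [hc, if_pos rfl]; linarith [hsab.2]
      · have : T.interp y (f s) = (1 - s) * y p + s * y q := by
          classical
          rw [interp, ← Finset.sum_subset (Finset.subset_univ {p, q}), Finset.sum_pair hpq, hc, hc]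
          · simp [Ne.symm hpq]; ring
          · intro r _ hr
            simp only [Finset.mem_insert, Finset.mem_singleton, not_or] at hr
            rw [hc, if_neg hr.1, if_neg hr.2, mul_zero]
        rw [this]
        exact hs s hsab
    have hSm : MeasurableSet S := by
      rw [hSeq]
      exact ((isCompact_Icc).image AffineMap.lineMap_continuous).isClosed.measurableSet
    have hSμ : σ / 8 * T.size ≤ (arcLength Ω).real S := by
      have h1 : arcLength Ω S = edist (f a) (f b) := by
        rw [Measure.restrict_apply hSm, Set.inter_eq_self_of_subset_left
          (fun x hx => hseg (hSp x hx).1), hausdorffMeasure_segment]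
      rw [Measure.real, h1, edist_dist, ENNReal.toReal_ofReal dist_nonneg, hf,
        dist_lineMap_lineMap, Real.dist_eq, abs_sub_comm, abs_of_nonneg (by linarith)]
      have hpos : 0 ≤ dist p.pos q.pos := dist_nonneg
      nlinarith
    calc σ / 128 * T.size * y p ^ 2 = (σ / 8 * T.size) * (y p ^ 2 / 16) := by ring
      _ ≤ (arcLength Ω).real S * (y p ^ 2 / 16) := by gcongr
      _ = ∫ x in S, y p ^ 2 / 16 ∂(arcLength Ω) := by rw [setIntegral_const, smul_eq_mul]
      _ ≤ ∫ x in S, T.interp y x ^ 2 ∂(arcLength Ω) :=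
          setIntegral_mono_on (integrable_const _).integrableOn
            (T.integrable_interp_sq _ y).integrableOn hSm fun x hx => (hSp x hx).2.2
      _ ≤ _ := setIntegral_mono_set (T.integrable_interp_sq _ y).integrableOn
          (Filter.Eventually.of_forall fun x => sq_nonneg _)
          (LE.le.eventuallyLE fun x hx => (hSp x hx).2.1)
  have habs : ∀ s, |y p| / 4 ≤ |(1 - s) * y p + s * y q| →
      y p ^ 2 / 16 ≤ ((1 - s) * y p + s * y q) ^ 2 := fun s h => by
    rw [← sq_abs (y p), ← sq_abs ((1 - s) * y p + s * y q)]
    nlinarith [abs_nonneg (y p)]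
  -- If y varies little along the edge, v stays near y p close to p: 1 - 6/8 = 1/4. Otherwise the
  -- variation dominates further along: 6 · 3/8 - 1 > 1/4.
  rcases le_or_gt |y q - y p| (6 * |y p|) with h | h
  · refine key 0 (1 / 8) le_rfl (by norm_num) (by norm_num) fun s hs => habs s ?_
    have h1 := abs_sub_abs_le_abs_add (y p) (s * (y q - y p))
    rw [abs_mul, abs_of_nonneg hs.1] at h1
    have h2 : y p + s * (y q - y p) = (1 - s) * y p + s * y q := by ring
    rw [h2] at h1
    have h3 : s * |y q - y p| ≤ 1 / 8 * (6 * |y p|) :=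
      mul_le_mul hs.2 h (abs_nonneg _) (by norm_num)
    linarith
  · refine key (3 / 8) (7 / 16) (by norm_num) (by norm_num) (by norm_num) fun s hs => habs s ?_
    have hs0 : 0 ≤ s := by linarith [hs.1]
    have h1 := abs_sub_abs_le_abs_add (s * (y q - y p)) (y p)
    rw [abs_mul, abs_of_nonneg hs0] at h1
    have h2 : s * (y q - y p) + y p = (1 - s) * y p + s * y q := by ring
    rw [h2] at h1
    have h3 : 3 / 8 * (6 * |y p|) ≤ s * |y q - y p| :=
      mul_le_mul hs.1 h.le (by positivity) hs0
    linarith [abs_nonneg (y p)]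

/-- Extension by zero of a vector of boundary nodal values. -/
def extend (T : Mesh Ω) (u : T.BNode → ℝ) (p : T.Node) : ℝ :=
  open Classical in if h : p.pos ∈ frontier Ω then u ⟨p, h⟩ else 0

theorem sum_extend (T : Mesh Ω) (u : T.BNode → ℝ) (F : T.Node → ℝ → ℝ)
    (hF : ∀ p, F p 0 = 0) : ∑ p, F p (T.extend u p) = ∑ i, F i.toNode (u i) := by
  classical
  rw [← Finset.sum_filter_of_ne (p := fun p : T.Node => p.pos ∈ frontier Ω)
    (fun p _ hp => by by_contra h; exact hp (by rw [extend, dif_neg h, hF]))]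
  symm
  refine Finset.sum_bij (fun i _ => i.toNode)
    (fun i _ => Finset.mem_filter.mpr ⟨Finset.mem_univ _, i.2⟩)
    (fun i _ j _ h => Subtype.ext h) (fun p hp => ⟨⟨p, (Finset.mem_filter.mp hp).2⟩,
      Finset.mem_univ _, rfl⟩) (fun i _ => ?_)
  rw [extend, dif_pos (show i.toNode.pos ∈ frontier Ω from i.2)]
  rfl

theorem extend_toNode (T : Mesh Ω) (u : T.BNode → ℝ) (i : T.BNode) :
    T.extend u i.toNode = u i := dif_pos i.2

theorem dotProduct_consistentBoundaryMass (T : Mesh Ω) (hreg : interior (closure Ω) = Ω)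
    (u : T.BNode → ℝ) :
    u ⬝ᵥ T.consistentBoundaryMass *ᵥ u = ∫ x, T.interp (T.extend u) x ^ 2 ∂(arcLength Ω) := by
  have := T.isFiniteMeasure_arcLength hreg
  rw [T.integral_interp_sq, dotProduct_mulVec_eq_sum]
  rw [T.sum_extend u (fun p a => ∑ q, a * T.extend u q *
    ∫ x, T.hat p x * T.hat q x ∂(arcLength Ω)) (by simp)]
  refine Finset.sum_congr rfl fun i _ => ?_
  rw [T.sum_extend u (fun q a => u i * a *
    ∫ x, T.hat i.toNode x * T.hat q x ∂(arcLength Ω)) (by simp)]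
  rfl

theorem consistentBoundaryMass_transpose (T : Mesh Ω) :
    T.consistentBoundaryMassᵀ = T.consistentBoundaryMass := by
  ext i j
  simp only [consistentBoundaryMass, Matrix.transpose_apply, Matrix.of_apply, mul_comm]

theorem consistentBoundaryMass_lower (T : Mesh Ω) (hreg : interior (closure Ω) = Ω) {σ : ℝ}
    (hσ : 0 < σ) (hT : T.QuasiUniform σ) (u : T.BNode → ℝ) :
    σ / 128 * T.size * ∑ i, u i ^ 2 ≤ u ⬝ᵥ T.consistentBoundaryMass *ᵥ u := by
  have := T.isFiniteMeasure_arcLength hreg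
  rw [T.dotProduct_consistentBoundaryMass hreg, Finset.mul_sum]
  have hm : ∀ i : T.BNode, MeasurableSet {x | 1 / 2 < T.hat i.toNode x} := fun i =>
    measurableSet_lt measurable_const (T.measurable_hat _)
  calc ∑ i, σ / 128 * T.size * u i ^ 2
      ≤ ∑ i : T.BNode, ∫ x in {x | 1 / 2 < T.hat i.toNode x},
          T.interp (T.extend u) x ^ 2 ∂(arcLength Ω) := by
        refine Finset.sum_le_sum fun i _ => ?_
        have := T.le_integral_arcLength_interp_sq hreg hσ hT i.2 (T.extend u)
        rwa [show T.extend u i.1 = u i from T.extend_toNode u i] at this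
    _ = ∫ x in ⋃ i : T.BNode, {x | 1 / 2 < T.hat i.toNode x},
          T.interp (T.extend u) x ^ 2 ∂(arcLength Ω) := by
        rw [integral_iUnion_fintype hm]
        · intro i j hij
          refine Set.disjoint_left.mpr fun x hx hx' => ?_
          have hne : i.toNode ≠ j.toNode := fun h => hij (Subtype.ext h)
          have h1 : T.hat i.toNode x + T.hat j.toNode x ≤ 1 := by
            classical
            by_cases hxc : x ∈ closure Ω
            · rw [← T.sum_hat hxc, ← Finset.sum_pair hne (f := fun p => T.hat p x)]
              exact Finset.sum_le_sum_of_subset_of_nonneg (Finset.subset_univ _)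
                fun p _ _ => T.hat_nonneg p x
            · simp [hat_of_notMem hxc]
          simp only [Set.mem_ofPred_eq] at hx hx'
          linarith
        · exact fun i => (T.integrable_interp_sq _ _).integrableOn
    _ ≤ _ := setIntegral_le_integral (T.integrable_interp_sq _ _)
        (Filter.Eventually.of_forall fun x => sq_nonneg _)

/-- The traces of the boundary hats sum to at most one. -/
theorem sum_consistentBoundaryMass_le (T : Mesh Ω) (hreg : interior (closure Ω) = Ω) {σ : ℝ}
    (hσ : 0 < σ) (hT : T.QuasiUniform σ) (i : T.BNode) :
    ∑ j, T.consistentBoundaryMass i j ≤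
      576 / (σ ^ 2 * discArea) * T.size⁻¹ * T.omega i.toNode := by
  have := T.isFiniteMeasure_arcLength hreg
  refine le_trans ?_ (T.integral_arcLength_hat_le hreg hσ hT i.toNode)
  simp only [consistentBoundaryMass, Matrix.of_apply]
  rw [← integral_finsetSum _ fun j _ => T.integrable_hat_mul _ _ _]
  refine integral_mono (integrable_finsetSum _ fun j _ => T.integrable_hat_mul _ _ _)
    (T.integrable_hat _ _) fun x => ?_
  simp only [← Finset.mul_sum]
  refine mul_le_of_le_one_right (T.hat_nonneg _ x) ?_
  by_cases hx : x ∈ closure Ω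
  · rw [← T.sum_hat hx]
    classical
    rw [← Finset.sum_image (s := Finset.univ) (g := BNode.toNode) (f := fun p => T.hat p x)
      fun i _ j _ h => Subtype.ext h]
    exact Finset.sum_le_sum_of_subset_of_nonneg (Finset.subset_univ _)
      fun p _ _ => T.hat_nonneg p x
  · simp [hat_of_notMem hx]

/-- Uses 2 u_i u_j ≤ u_i² + u_j² entrywise. It gives both the upper bound for the consistent
boundary mass and the lower bound for the lumped one. -/
theorem dotProduct_mulVec_le_lump {ι : Type} [Fintype ι] [DecidableEq ι] {A : Matrix ι ι ℝ}
    (hA : Aᵀ = A) (h0 : ∀ i j, 0 ≤ A i j) (u : ι → ℝ) :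
    u ⬝ᵥ A *ᵥ u ≤ ∑ i, (∑ j, A i j) * u i ^ 2 := by
  have hs : ∀ i j, A j i = A i j := fun i j => congrFun (congrFun hA i) j
  have h1 : ∑ i, (∑ j, A i j) * u i ^ 2 = ∑ i, ∑ j, (u i ^ 2 + u j ^ 2) / 2 * A i j := by
    have h2 : ∑ i, ∑ j, u j ^ 2 * A i j = ∑ i, ∑ j, u i ^ 2 * A i j := by
      rw [Finset.sum_comm]
      exact Finset.sum_congr rfl fun i _ => Finset.sum_congr rfl fun j _ => by rw [hs]
    have h3 : ∑ i, (∑ j, A i j) * u i ^ 2 = ∑ i, ∑ j, u i ^ 2 * A i j :=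
      Finset.sum_congr rfl fun i _ => by rw [mul_comm, Finset.mul_sum]
    have h4 : ∑ i, ∑ j, (u i ^ 2 + u j ^ 2) / 2 * A i j =
        (∑ i, ∑ j, u i ^ 2 * A i j) / 2 + (∑ i, ∑ j, u j ^ 2 * A i j) / 2 := by
      simp only [Finset.sum_div, ← Finset.sum_add_distrib]
      exact Finset.sum_congr rfl fun i _ => Finset.sum_congr rfl fun j _ => by ring
    rw [h3, h4, h2]; ring
  rw [dotProduct_mulVec_eq_sum, h1]
  refine Finset.sum_le_sum fun i _ => Finset.sum_le_sum fun j _ =>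
    mul_le_mul_of_nonneg_right ?_ (h0 i j)
  nlinarith [sq_nonneg (u i - u j)]

theorem consistentBoundaryMass_nonneg (T : Mesh Ω) (i j : T.BNode) :
    0 ≤ T.consistentBoundaryMass i j :=
  integral_nonneg fun x => mul_nonneg (T.hat_nonneg _ x) (T.hat_nonneg _ x)

theorem boundaryMassMatrix_transpose (T : Mesh Ω) (r : MassRule) :
    (T.boundaryMassMatrix r)ᵀ = T.boundaryMassMatrix r := by
  cases r
  · exact T.consistentBoundaryMass_transpose
  · exact Matrix.diagonal_transpose _

theorem boundaryMassMatrix_le (T : Mesh Ω) (hreg : interior (closure Ω) = Ω) {σ : ℝ}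
    (hσ : 0 < σ) (hT : T.QuasiUniform σ) (r : MassRule) (u : T.BNode → ℝ) :
    u ⬝ᵥ T.boundaryMassMatrix r *ᵥ u ≤
      576 / (σ ^ 2 * discArea) * T.size⁻¹ * ∑ i : T.BNode, T.omega i.toNode * u i ^ 2 := by
  have h : ∑ i, (∑ j, T.consistentBoundaryMass i j) * u i ^ 2 ≤
      576 / (σ ^ 2 * discArea) * T.size⁻¹ * ∑ i : T.BNode, T.omega i.toNode * u i ^ 2 := by
    rw [Finset.mul_sum]
    refine Finset.sum_le_sum fun i _ => ?_
    rw [← mul_assoc]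
    exact mul_le_mul_of_nonneg_right (T.sum_consistentBoundaryMass_le hreg hσ hT i) (sq_nonneg _)
  cases r
  · exact (dotProduct_mulVec_le_lump T.consistentBoundaryMass_transpose
      T.consistentBoundaryMass_nonneg u).trans h
  · rw [boundaryMassMatrix, dotProduct_lump]; exact h

theorem boundaryMassMatrix_lower (T : Mesh Ω) (hreg : interior (closure Ω) = Ω) {σ : ℝ}
    (hσ : 0 < σ) (hT : T.QuasiUniform σ) (r : MassRule) (u : T.BNode → ℝ) :
    σ / 128 * T.size * ∑ i, u i ^ 2 ≤ u ⬝ᵥ T.boundaryMassMatrix r *ᵥ u := by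
  have h := T.consistentBoundaryMass_lower hreg hσ hT u
  cases r
  · exact h
  · rw [boundaryMassMatrix, dotProduct_lump]
    exact h.trans (dotProduct_mulVec_le_lump T.consistentBoundaryMass_transpose
      T.consistentBoundaryMass_nonneg u)

theorem BNode.toNode_injective (T : Mesh Ω) : Function.Injective (BNode.toNode (T := T)) :=
  Subtype.val_injective

theorem couplingMatrix_toNode (T : Mesh Ω) (r : MassRule) (i j : T.BNode) :
    T.couplingMatrix r i.toNode j = T.boundaryMassMatrix r i j := by
  cases r
  · rfl
  · by_cases h : i = j
    · subst h
      simp [couplingMatrix, boundaryMassMatrix, lump]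
    · have h' : i.toNode ≠ j.toNode := fun h' => h (BNode.toNode_injective T h')
      simp [couplingMatrix, boundaryMassMatrix, lump, h, h']

theorem couplingMatrix_eq_zero (T : Mesh Ω) (hreg : interior (closure Ω) = Ω) (r : MassRule)
    {k : T.Node} (hk : k ∉ Set.range (BNode.toNode (T := T))) (j : T.BNode) :
    T.couplingMatrix r k j = 0 := by
  have hk' : k.pos ∉ frontier Ω := fun h => hk ⟨⟨k, h⟩, rfl⟩
  cases r
  · simp only [couplingMatrix, Matrix.of_apply]
    refine setIntegral_eq_zero_of_forall_eq_zero fun x hx => ?_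
    rw [T.hat_eq_zero_of_mem_frontier hreg hk' hx, zero_mul]
  · simp only [couplingMatrix, Matrix.of_apply]
    exact if_neg fun h => hk ⟨j, h.symm⟩

end Mesh

end NeumannControl

end

noncomputable section

namespace NeumannControl

namespace Mesh

open MeasureTheory
open scoped ENNReal

variable {Ω : Set Plane}

/-! ### The Poincaré inequality -/

/-- The squared norm of the gradient of a finite element function, with the contributions of
all triangles containing the point added up. -/
def gradSq (T : Mesh Ω) (y : T.Node → ℝ) (x : Plane) : ℝ≥0∞ :=
  ∑ t : T.Tri, t.hull.indicator (fun _ => ENNReal.ofReal (‖t.interpGrad y‖ ^ 2)) x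

theorem measurable_gradSq (T : Mesh Ω) (y : T.Node → ℝ) : Measurable (T.gradSq y) :=
  Finset.measurable_sum _ fun t _ => measurable_const.indicator t.isClosed_hull.measurableSet

/-- Valid at every point, edges included, as needed for segments that run along an edge of the mesh.
-/
theorem Tri.le_gradSq {T : Mesh Ω} (t : T.Tri) (y : T.Node → ℝ) {x : Plane} (hx : x ∈ t.hull) :
    ENNReal.ofReal (‖t.interpGrad y‖ ^ 2) ≤ T.gradSq y x := by
  refine le_trans (le_of_eq ?_) (Finset.single_le_sum (fun t _ => zero_le) (Finset.mem_univ t))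
  rw [Set.indicator_of_mem hx]

theorem lintegral_gradSq (T : Mesh Ω) (hreg : interior (closure Ω) = Ω) (y : T.Node → ℝ) :
    ∫⁻ x, T.gradSq y x = ENNReal.ofReal (y ⬝ᵥ T.stiffnessMatrix *ᵥ y) := by
  simp only [gradSq]
  rw [lintegral_finsetSum _ fun t _ => measurable_const.indicator t.isClosed_hull.measurableSet,
    T.dotProduct_stiffnessMatrix hreg, ENNReal.ofReal_sum_of_nonneg
      fun t _ => mul_nonneg t.area_nonneg (sq_nonneg _)]
  refine Finset.sum_congr rfl fun t _ => ?_
  rw [lintegral_indicator t.isClosed_hull.measurableSet, setLIntegral_const,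
    ENNReal.ofReal_mul t.area_nonneg, Tri.area, ofReal_measureReal t.volume_ne_top, mul_comm]

theorem Tri.interp_sub {T : Mesh Ω} (t : T.Tri) (y : T.Node → ℝ) (x z : Plane) :
    ∑ p, y p * t.coord p z = ∑ p, y p * t.coord p x + inner ℝ (t.interpGrad y) (z - x) := by
  rw [Tri.interpGrad, sum_inner, ← Finset.sum_add_distrib]
  refine Finset.sum_congr rfl fun p _ => ?_
  rw [real_inner_smul_left, ← t.coord_sub]
  ring

theorem continuousOn_interp (T : Mesh Ω) (y : T.Node → ℝ) :
    ContinuousOn (T.interp y) (closure Ω) :=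
  continuousOn_finsetSum _ fun p _ => continuousOn_const.mul (T.continuousOn_hat p)

theorem countable_frontier_of_convex {s : Set ℝ} (hs : Convex ℝ s) (hc : IsCompact s) :
    (frontier s).Countable := by
  rcases s.eq_empty_or_nonempty with rfl | hne
  · simp
  · rw [eq_Icc_of_connected_compact ⟨hne, hs.isPreconnected⟩ hc, frontier_Icc
      (Real.sInf_le_sSup _ hc.bddBelow hc.bddAbove)]
    exact Set.Countable.insert _ (Set.countable_singleton _)

/-- The increment of a finite element function along a segment is controlled by the integral of
its squared gradient. -/
theorem sq_interp_sub_le (T : Mesh Ω) (y : T.Node → ℝ) {x z : Plane}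
    (hxz : segment ℝ x z ⊆ closure Ω) :
    ENNReal.ofReal ((T.interp y z - T.interp y x) ^ 2) ≤
      ENNReal.ofReal (‖z - x‖ ^ 2) *
        ∫⁻ s in Set.Icc (0 : ℝ) 1, T.gradSq y (x + s • (z - x)) := by
  set l : ℝ → Plane := fun s => x + s • (z - x) with hl
  have hlc : Continuous l := by fun_prop
  have hl01 : ∀ s ∈ Set.Icc (0 : ℝ) 1, l s ∈ closure Ω := fun s hs =>
    hxz (by rw [segment_eq_image']; exact ⟨s, hs, rfl⟩)
  set f : ℝ → ℝ := fun s => T.interp y (l s) with hf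
  let I : T.Tri → Set ℝ := fun t => Set.Icc 0 1 ∩ l ⁻¹' t.hull
  have hIconv : ∀ t, Convex ℝ (I t) := fun t => by
    refine (convex_Icc 0 1).inter ?_
    have : l = (AffineMap.lineMap x z : ℝ →ᵃ[ℝ] Plane) := by
      ext s; simp [hl, AffineMap.lineMap_apply, add_comm]
    rw [this]
    exact t.convex_hull.affine_preimage _
  have hIcomp : ∀ t, IsCompact (I t) := fun t =>
    isCompact_Icc.inter_right (t.isClosed_hull.preimage hlc)
  -- Each triangle is met in a compact interval of parameters, so leaving out the endpoints discards
  -- countably many; elsewhere f is locally affine.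
  set N : Set ℝ := ⋃ t, frontier (I t) with hN
  have hNc : N.Countable := Set.countable_iUnion fun t =>
    countable_frontier_of_convex (hIconv t) (hIcomp t)
  have hgood : ∀ s ∈ Set.Ioo (0 : ℝ) 1 \ N, ∃ t : T.Tri, l s ∈ t.hull ∧
      HasDerivAt f (inner ℝ (t.interpGrad y) (z - x)) s := by
    rintro s ⟨hs, hsN⟩
    obtain ⟨t, ht⟩ := exists_tri (T := T) (hl01 s (Set.Ioo_subset_Icc_self hs))
    refine ⟨t, ht, ?_⟩
    have hsi : s ∈ interior (I t) := by
      by_contra h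
      exact hsN (Set.mem_iUnion.mpr ⟨t, subset_closure ⟨Set.Ioo_subset_Icc_self hs, ht⟩, h⟩)
    have hfe : f =ᶠ[nhds s] fun s' => ∑ p, y p * t.coord p x +
        s' * inner ℝ (t.interpGrad y) (z - x) := by
      filter_upwards [mem_interior_iff_mem_nhds.mp hsi] with s' hs'
      have h1 : f s' = ∑ p, y p * t.coord p (l s') :=
        Finset.sum_congr rfl fun p _ => by rw [t.hat_eq hs'.2]
      rw [h1, t.interp_sub y x (l s'), hl, add_sub_cancel_left, inner_smul_right]
    refine HasDerivAt.congr_of_eventuallyEq ?_ hfe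
    simpa using ((hasDerivAt_id s).mul_const (inner ℝ (t.interpGrad y) (z - x))).const_add
      (∑ p, y p * t.coord p x)
  set ν : Measure ℝ := volume.restrict (Set.Icc (0 : ℝ) 1) with hν
  have hprob : IsProbabilityMeasure ν := ⟨by simp [hν]⟩
  have hae : ∀ᵐ s ∂ν, ∃ t : T.Tri, l s ∈ t.hull ∧
      deriv f s = inner ℝ (t.interpGrad y) (z - x) := by
    rw [hν, ← Measure.restrict_congr_set Ioo_ae_eq_Icc]
    have h1 : ∀ᵐ s ∂(volume.restrict (Set.Ioo (0 : ℝ) 1)), s ∉ N :=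
      ae_restrict_of_ae (hNc.ae_notMem volume)
    filter_upwards [h1, ae_restrict_mem measurableSet_Ioo] with s hsN hs
    obtain ⟨t, ht, hd⟩ := hgood s ⟨hs, hsN⟩
    exact ⟨t, ht, hd.deriv⟩
  have hmem : MemLp (deriv f) 2 ν := by
    refine MemLp.of_bound (measurable_deriv f).aestronglyMeasurable
      (∑ t : T.Tri, ‖(inner ℝ (t.interpGrad y) (z - x) : ℝ)‖) ?_
    filter_upwards [hae] with s ⟨t, _, hd⟩
    rw [hd]
    exact Finset.single_le_sum
      (f := fun t : T.Tri => ‖(inner ℝ (t.interpGrad y) (z - x) : ℝ)‖)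
      (fun t _ => norm_nonneg _) (Finset.mem_univ t)
  have hint : ∫ s, deriv f s ∂ν = T.interp y z - T.interp y x := by
    have h1 := integral_eq_of_hasDerivAt_off_countable_of_le f (deriv f) zero_le_one hNc
      ((T.continuousOn_interp y).comp hlc.continuousOn hl01)
      (fun s hs => by
        obtain ⟨t, -, hd⟩ := hgood s hs
        exact hd.deriv ▸ hd)
      (by
        rw [intervalIntegrable_iff_integrableOn_Icc_of_le zero_le_one]
        exact hmem.integrable (by norm_num))
    rw [intervalIntegral.integral_of_le zero_le_one, ← integral_Icc_eq_integral_Ioc] at h1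
    rw [hν, h1]
    simp [hf, hl]
  -- Jensen's inequality, in the form that a variance is nonnegative.
  have hvar : (∫ s, deriv f s ∂ν) ^ 2 ≤ ∫ s, deriv f s ^ 2 ∂ν := by
    have h1 := ProbabilityTheory.variance_nonneg (deriv f) ν
    rw [ProbabilityTheory.variance_eq_sub hmem] at h1
    simpa using h1
  have hgl : Measurable fun s : ℝ => T.gradSq y (x + s • (z - x)) :=
    (T.measurable_gradSq y).comp hlc.measurable
  rw [← hint]
  refine (ENNReal.ofReal_le_ofReal hvar).trans ?_
  rw [ofReal_integral_eq_lintegral_ofReal hmem.integrable_sq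
    (Filter.Eventually.of_forall fun s => sq_nonneg _),
    ← lintegral_const_mul _ hgl]
  refine lintegral_mono_ae ?_
  filter_upwards [hae] with s ⟨t, ht, hd⟩
  refine le_trans ?_ (mul_le_mul_right (t.le_gradSq y ht) _)
  rw [← ENNReal.ofReal_mul (sq_nonneg _), hd]
  refine ENNReal.ofReal_le_ofReal ?_
  have h1 := abs_real_inner_le_norm (t.interpGrad y) (z - x)
  rw [← sq_abs, ← mul_pow, mul_comm ‖z - x‖]
  exact pow_le_pow_left₀ (abs_nonneg _) h1 2

/-- The Jacobian factor in the plane is s⁻² ≤ 4. -/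
theorem lintegral_comp_add_smul (g : Plane → ℝ≥0∞) (hg : Measurable g) (x : Plane) {s : ℝ}
    (hs : 1 / 2 ≤ s) : ∫⁻ z, g (x + s • z) ≤ 4 * ∫⁻ z, g z := by
  have hs0 : s ≠ 0 := by linarith
  have h1 : ∫⁻ z, g (x + s • z) = ∫⁻ z, g (x + z) ∂(Measure.map (s • ·) volume) := by
    exact (lintegral_map (f := fun z => g (x + z)) (hg.comp (measurable_const_add x))
      (measurable_const_smul s)).symm
  rw [h1, Measure.map_addHaar_smul _ hs0, lintegral_smul_measure, smul_eq_mul,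
    lintegral_add_left_eq_self g x]
  gcongr
  rw [finrank_euclideanSpace_fin, ← ENNReal.ofReal_ofNat]
  refine ENNReal.ofReal_le_ofReal ?_
  rw [abs_of_nonneg (by positivity), ← inv_pow]
  have : s⁻¹ ≤ 2 := by
    rw [inv_le_comm₀ (by linarith) two_pos]; linarith
  have h0 : 0 ≤ s⁻¹ := inv_nonneg.mpr (by linarith)
  nlinarith

theorem lintegral_segments_le (g : Plane → ℝ≥0∞) (hg : Measurable g) (D : Set Plane) :
    ∫⁻ x in D, ∫⁻ z in D, (∫⁻ s in Set.Icc (0 : ℝ) 1, g (x + s • (z - x))) ≤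
      volume D * 4 * ∫⁻ x, g x := by
  generalize hν : (volume : Measure Plane).restrict D = ν
  have : SFinite ν := by rw [← hν]; infer_instance
  have hm3 : Measurable fun w : (Plane × ℝ) × Plane => g (w.1.1 + w.1.2 • (w.2 - w.1.1)) :=
    hg.comp (by fun_prop)
  have hm4 : ∀ x, Measurable fun w : Plane × ℝ => g (x + w.2 • (w.1 - x)) := fun x =>
    hg.comp (by fun_prop)
  have hm5 : ∀ s : ℝ, Measurable fun w : Plane × Plane => g (w.1 + s • (w.2 - w.1)) := fun s =>
    hg.comp (by fun_prop)
  have hswap : ∫⁻ x, ∫⁻ z, (∫⁻ s in Set.Icc (0 : ℝ) 1, g (x + s • (z - x))) ∂ν ∂ν =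
      ∫⁻ s in Set.Icc (0 : ℝ) 1, (∫⁻ x, ∫⁻ z, g (x + s • (z - x)) ∂ν ∂ν) := by
    have h2 : ∀ x, ∫⁻ z, (∫⁻ s in Set.Icc (0 : ℝ) 1, g (x + s • (z - x))) ∂ν =
        ∫⁻ s in Set.Icc (0 : ℝ) 1, (∫⁻ z, g (x + s • (z - x)) ∂ν) := fun x =>
      lintegral_lintegral_swap (f := fun z s => g (x + s • (z - x))) (hm4 x).aemeasurable
    simp only [h2]
    exact lintegral_lintegral_swap (f := fun x s => ∫⁻ z, g (x + s • (z - x)) ∂ν)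
      (hm3.lintegral_prod_right' (ν := ν)).aemeasurable
  have hle : ∀ f : Plane → ℝ≥0∞, ∫⁻ x, f x ∂ν ≤ ∫⁻ x, f x := fun f => by
    rw [← hν]; exact setLIntegral_le_lintegral _ _
  have hνc : ∫⁻ _, 4 * (∫⁻ x, g x) ∂ν = volume D * 4 * ∫⁻ x, g x := by
    rw [lintegral_const, ← hν, Measure.restrict_apply_univ]; ring
  have hs : ∀ s ∈ Set.Icc (0 : ℝ) 1,
      ∫⁻ x, ∫⁻ z, g (x + s • (z - x)) ∂ν ∂ν ≤ volume D * 4 * ∫⁻ x, g x := by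
    intro s hs
    rw [← hνc]
    -- The point x + s(z - x) depends on z with factor s and on x with factor 1 - s; integrate first
    -- over the variable whose factor is at least 1/2.
    rcases le_total (1 / 2) s with h | h
    · refine lintegral_mono fun x => (hle _).trans ?_
      have : ∀ z, x + s • (z - x) = (x - s • x) + s • z := fun z => by
        rw [smul_sub]; abel
      simp only [this]
      exact lintegral_comp_add_smul g hg _ h
    · rw [lintegral_lintegral_swap (f := fun x z => g (x + s • (z - x))) (hm5 s).aemeasurable]
      refine lintegral_mono fun z => (hle _).trans ?_
      have : ∀ x, x + s • (z - x) = s • z + (1 - s) • x := fun x => by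
        rw [smul_sub, sub_smul, one_smul]; abel
      simp only [this]
      exact lintegral_comp_add_smul g hg _ (by linarith)
  rw [hswap]
  refine (setLIntegral_mono' measurableSet_Icc hs).trans ?_
  rw [setLIntegral_const]; simp

theorem lintegral_lintegral_le_const_mul {c : ℝ≥0∞} (hc : c ≠ ⊤) {D : Set Plane}
    (hD : MeasurableSet D) (F G : Plane → Plane → ℝ≥0∞)
    (h : ∀ x ∈ D, ∀ z ∈ D, F x z ≤ c * G x z) :
    ∫⁻ x in D, ∫⁻ z in D, F x z ≤ c * ∫⁻ x in D, ∫⁻ z in D, G x z := by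
  rw [← lintegral_const_mul' _ _ hc]
  refine setLIntegral_mono' hD fun x hx => ?_
  rw [← lintegral_const_mul' _ _ hc]
  exact setLIntegral_mono' hD fun z hz => h x hx z hz

/-- The double integral of the squared increments of a finite element function. -/
def incr (T : Mesh Ω) (y : T.Node → ℝ) (A B : Set Plane) : ℝ≥0∞ :=
  ∫⁻ x in A, ∫⁻ z in B, ENNReal.ofReal ((T.interp y z - T.interp y x) ^ 2)

theorem incr_le_of_convex (T : Mesh Ω) (y : T.Node → ℝ) {D : Set Plane} (hD : Convex ℝ D)
    (hm : MeasurableSet D) (hDΩ : D ⊆ closure Ω) {δ : ℝ} (hδ : ∀ x ∈ D, ∀ z ∈ D, ‖z - x‖ ≤ δ) :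
    T.incr y D D ≤ ENNReal.ofReal (δ ^ 2) * (volume D * 4 * ∫⁻ x, T.gradSq y x) := by
  refine le_trans (lintegral_lintegral_le_const_mul ENNReal.ofReal_ne_top hm _
    (fun x z => ∫⁻ s in Set.Icc (0 : ℝ) 1, T.gradSq y (x + s • (z - x))) fun x hx z hz => ?_)
    (mul_le_mul_right (lintegral_segments_le _ (T.measurable_gradSq y) D) _)
  refine (T.sq_interp_sub_le y ((hD.segment_subset hx hz).trans hDΩ)).trans ?_
  gcongr
  exact hδ x hx z hz

theorem measurable_incr (T : Mesh Ω) (y : T.Node → ℝ) :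
    Measurable fun w : Plane × Plane =>
      ENNReal.ofReal ((T.interp y w.2 - T.interp y w.1) ^ 2) :=
  ((((T.measurable_interp y).comp measurable_snd).sub
    ((T.measurable_interp y).comp measurable_fst)).pow_const 2).ennreal_ofReal

theorem incr_comm (T : Mesh Ω) (y : T.Node → ℝ) (A B : Set Plane) :
    T.incr y A B = T.incr y B A := by
  rw [incr, lintegral_lintegral_swap
    (f := fun x z => ENNReal.ofReal ((T.interp y z - T.interp y x) ^ 2))
    (T.measurable_incr y).aemeasurable, incr]
  exact lintegral_congr fun z => lintegral_congr fun x => by rw [sub_sq_comm]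

theorem incr_mono (T : Mesh Ω) (y : T.Node → ℝ) {A A' B B' : Set Plane} (hA : A ⊆ A')
    (hB : B ⊆ B') : T.incr y A B ≤ T.incr y A' B' :=
  (lintegral_mono_set hA).trans (lintegral_mono fun _ => lintegral_mono_set hB)

/-- The pointwise relaxed triangle inequality is averaged over the intermediate point b in B. -/
theorem measure_mul_lintegral_le (F : Plane → Plane → ℝ≥0∞)
    (hF : Measurable fun w : Plane × Plane => F w.1 w.2)
    (hpt : ∀ x z b, F x z ≤ 2 * F x b + 2 * F b z) (A B C : Set Plane) :
    volume B * ∫⁻ x in A, ∫⁻ z in C, F x z ≤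
      2 * (volume C * ∫⁻ x in A, ∫⁻ b in B, F x b) +
        2 * (volume A * ∫⁻ b in B, ∫⁻ z in C, F b z) := by
  have hF1 : ∀ x, Measurable (F x) := fun x => hF.comp measurable_prodMk_left
  have hF2 : ∀ z, Measurable fun x => F x z := fun z => hF.comp measurable_prodMk_right
  have h1 : ∀ x z, volume B * F x z ≤
      2 * (∫⁻ b in B, F x b) + 2 * ∫⁻ b in B, F b z := fun x z => by
    rw [← lintegral_const_mul _ (hF1 x), ← lintegral_const_mul _ (hF2 z),
      ← lintegral_add_left ((hF1 x).const_mul _), mul_comm, ← setLIntegral_const]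
    exact lintegral_mono fun b => hpt x z b
  have hm1 : Measurable fun x => ∫⁻ b in B, F x b := hF.lintegral_prod_right'
  have hm2 : Measurable fun z => ∫⁻ b in B, F b z := hF.lintegral_prod_left'
  have hm3 : Measurable fun x => ∫⁻ z in C, F x z := hF.lintegral_prod_right'
  calc volume B * ∫⁻ x in A, ∫⁻ z in C, F x z
      = ∫⁻ x in A, ∫⁻ z in C, volume B * F x z := by
        rw [← lintegral_const_mul _ hm3]
        exact lintegral_congr fun x => (lintegral_const_mul _ (hF1 x)).symm
    _ ≤ ∫⁻ x in A, ∫⁻ z in C, (2 * (∫⁻ b in B, F x b) + 2 * ∫⁻ b in B, F b z) :=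
        lintegral_mono fun x => lintegral_mono fun z => h1 x z
    _ = ∫⁻ x in A, (2 * volume C * (∫⁻ b in B, F x b) +
          2 * ∫⁻ z in C, ∫⁻ b in B, F b z) := by
        refine lintegral_congr fun x => ?_
        rw [lintegral_add_left measurable_const, setLIntegral_const, lintegral_const_mul _ hm2]
        ring
    _ = 2 * volume C * (∫⁻ x in A, ∫⁻ b in B, F x b) +
          volume A * (2 * ∫⁻ b in B, ∫⁻ z in C, F b z) := by
        rw [lintegral_add_right _ measurable_const, setLIntegral_const,
          lintegral_const_mul _ hm1, lintegral_lintegral_swap (f := fun z b => F b z)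
            (hF.comp measurable_swap).aemeasurable]
        ring
    _ = _ := by ring

theorem incr_trans (T : Mesh Ω) (y : T.Node → ℝ) (A B C : Set Plane) :
    volume B * T.incr y A C ≤
      2 * (volume C * T.incr y A B) + 2 * (volume A * T.incr y B C) := by
  refine measure_mul_lintegral_le _ (T.measurable_incr y) (fun x z b => ?_) A B C
  rw [← ENNReal.ofReal_ofNat, ← ENNReal.ofReal_mul (by norm_num),
    ← ENNReal.ofReal_mul (by norm_num), ← ENNReal.ofReal_add (by positivity) (by positivity)]
  refine ENNReal.ofReal_le_ofReal ?_
  nlinarith [sq_nonneg ((T.interp y b - T.interp y x) - (T.interp y z - T.interp y b))]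

end Mesh

end NeumannControl

end

/-! ### Linked sets and constants uniform over all meshes. -/

noncomputable section

namespace NeumannControl

namespace Mesh

open MeasureTheory
open scoped ENNReal

variable {Ω : Set Plane}

/-- The squared increments of finite element functions between two sets are controlled by their
energy, uniformly over all meshes of the domain. -/
def Linked (Ω A B : Set Plane) : Prop :=
  ∃ C : ℝ≥0∞, C ≠ ⊤ ∧ ∀ (T : Mesh Ω) (y : T.Node → ℝ),
    T.incr y A B ≤ C * ∫⁻ x, T.gradSq y x

theorem Linked.symm {A B : Set Plane} (h : Linked Ω A B) : Linked Ω B A := by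
  obtain ⟨C, hC, h⟩ := h
  exact ⟨C, hC, fun T y => T.incr_comm y B A ▸ h T y⟩

theorem Linked.mono {A A' B B' : Set Plane} (h : Linked Ω A' B') (hA : A ⊆ A') (hB : B ⊆ B') :
    Linked Ω A B := by
  obtain ⟨C, hC, h⟩ := h
  exact ⟨C, hC, fun T y => (T.incr_mono y hA hB).trans (h T y)⟩

theorem Linked.trans {A B C : Set Plane} (h : Linked Ω A B) (h' : Linked Ω B C)
    (hA : volume A ≠ ⊤) (hB0 : volume B ≠ 0) (hB : volume B ≠ ⊤) (hC : volume C ≠ ⊤) :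
    Linked Ω A C := by
  obtain ⟨c, hc, h⟩ := h
  obtain ⟨c', hc', h'⟩ := h'
  refine ⟨(volume B)⁻¹ * (2 * (volume C * c) + 2 * (volume A * c')), ?_, fun T y => ?_⟩
  · refine ENNReal.mul_ne_top (ENNReal.inv_ne_top.mpr hB0) (ENNReal.add_ne_top.mpr ⟨?_, ?_⟩)
    · exact ENNReal.mul_ne_top (by norm_num) (ENNReal.mul_ne_top hC hc)
    · exact ENNReal.mul_ne_top (by norm_num) (ENNReal.mul_ne_top hA hc')
  · have h1 := T.incr_trans y A B C
    calc T.incr y A C = (volume B)⁻¹ * (volume B * T.incr y A C) := by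
          rw [← mul_assoc, ENNReal.inv_mul_cancel hB0 hB, one_mul]
      _ ≤ (volume B)⁻¹ * (2 * (volume C * (c * ∫⁻ x, T.gradSq y x)) +
            2 * (volume A * (c' * ∫⁻ x, T.gradSq y x))) := by
          refine mul_le_mul_right (h1.trans ?_) _
          gcongr
          · exact h T y
          · exact h' T y
      _ = _ := by ring

theorem linked_of_convex {D : Set Plane} (hD : Convex ℝ D) (hm : MeasurableSet D)
    (hb : Bornology.IsBounded D) (hDΩ : D ⊆ closure Ω) : Linked Ω D D := by
  refine ⟨ENNReal.ofReal (Metric.diam D ^ 2) * (volume D * 4), ?_, fun T y => ?_⟩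
  · exact ENNReal.mul_ne_top ENNReal.ofReal_ne_top
      (ENNReal.mul_ne_top hb.measure_lt_top.ne (by norm_num))
  · refine (T.incr_le_of_convex y hD hm hDΩ fun x hx z hz => ?_).trans (le_of_eq (by ring))
    rw [← dist_eq_norm]
    exact Metric.dist_le_diam_of_mem hb hz hx

theorem linked_ball {x : Plane} {r : ℝ} (h : Metric.ball x r ⊆ Ω) :
    Linked Ω (Metric.ball x r) (Metric.ball x r) :=
  linked_of_convex (convex_ball x r) Metric.isOpen_ball.measurableSet Metric.isBounded_ball
    (h.trans subset_closure)

theorem volume_ball_ne_zero (x : Plane) {r : ℝ} (hr : 0 < r) : volume (Metric.ball x r) ≠ 0 :=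
  (Metric.measure_ball_pos volume x hr).ne'

/-- Any two points of a domain have neighbourhoods linked through a chain of discs. -/
theorem exists_linked_ball (hΩ : IsOpen Ω) (hconn : IsPreconnected Ω) {x x' : Plane}
    (hx : x ∈ Ω) (hx' : x' ∈ Ω) :
    ∃ r > 0, Metric.ball x r ⊆ Ω ∧ Metric.ball x' r ⊆ Ω ∧
      Linked Ω (Metric.ball x r) (Metric.ball x' r) := by
  -- A symmetric and transitive relation that holds locally holds on the whole of a preconnected
  -- set.
  refine hconn.induction₂ (fun x x' => ∃ r > 0, Metric.ball x r ⊆ Ω ∧ Metric.ball x' r ⊆ Ω ∧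
      Linked Ω (Metric.ball x r) (Metric.ball x' r)) ?_ ?_ ?_ hx hx'
  · intro x hx
    obtain ⟨r, hr, hrΩ⟩ := Metric.isOpen_iff.mp hΩ x hx
    refine nhdsWithin_le_nhds ?_
    filter_upwards [Metric.ball_mem_nhds x (half_pos hr)] with x' hx'
    have h1 : Metric.ball x' (r / 2) ⊆ Metric.ball x r := by
      refine Metric.ball_subset_ball' ?_
      rw [Metric.mem_ball] at hx'
      linarith
    have h2 : Metric.ball x (r / 2) ⊆ Metric.ball x r := Metric.ball_subset_ball (by linarith)
    exact ⟨r / 2, half_pos hr, h2.trans hrΩ, h1.trans hrΩ, (linked_ball hrΩ).mono h2 h1⟩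
  · rintro x x' x'' - - - ⟨r, hr, h1, h2, h3⟩ ⟨r', hr', h1', h2', h3'⟩
    have hl : ∀ z : Plane, Metric.ball z (min r r') ⊆ Metric.ball z r := fun z =>
      Metric.ball_subset_ball (min_le_left _ _)
    have hr2 : ∀ z : Plane, Metric.ball z (min r r') ⊆ Metric.ball z r' := fun z =>
      Metric.ball_subset_ball (min_le_right _ _)
    refine ⟨min r r', lt_min hr hr', (hl x).trans h1, (hr2 x'').trans h2', ?_⟩
    exact (h3.mono (hl x) (hl x')).trans (h3'.mono (hr2 x') (hr2 x'')) measure_ball_lt_top.ne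
      (volume_ball_ne_zero x' (lt_min hr hr')) measure_ball_lt_top.ne measure_ball_lt_top.ne
  · rintro x x' - - ⟨r, hr, h1, h2, h3⟩
    exact ⟨r, hr, h2, h1, h3.symm⟩

theorem Tri.interior_nonempty {T : Mesh Ω} (t : T.Tri) : (interior t.hull).Nonempty := by
  rw [t.hull_eq]
  exact ⟨_, t.basis.centroid_mem_interior_convexHull⟩

theorem Tri.linked_ball_of_mem {T : Mesh Ω} (t : T.Tri) {x : Plane}
    (hx : x ∈ interior t.hull) : ∃ r > 0, Linked Ω t.hull (Metric.ball x r) := by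
  obtain ⟨r, hr, h⟩ := Metric.isOpen_iff.mp isOpen_interior x hx
  refine ⟨r, hr, Linked.mono (linked_of_convex t.convex_hull t.isClosed_hull.measurableSet
    t.isCompact_hull.isBounded t.hull_subset) le_rfl (h.trans interior_subset)⟩

/-- Pass from t to a disc inside it, along a chain of discs to one inside t', and on to t'. -/
theorem Tri.linked (hreg : interior (closure Ω) = Ω) (hconn : IsPreconnected Ω) {T : Mesh Ω}
    (t t' : T.Tri) : Linked Ω t.hull t'.hull := by
  obtain ⟨x, hx⟩ := t.interior_nonempty
  obtain ⟨x', hx'⟩ := t'.interior_nonempty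
  obtain ⟨r, hr, -, -, h⟩ := exists_linked_ball (isOpen_of_regular hreg) hconn
    (t.interior_subset_of_regular hreg hx) (t'.interior_subset_of_regular hreg hx')
  obtain ⟨r₁, hr₁, h₁⟩ := t.linked_ball_of_mem hx
  obtain ⟨r₂, hr₂, h₂⟩ := t'.linked_ball_of_mem hx'
  set s := min r (min r₁ r₂)
  have hs : 0 < s := lt_min hr (lt_min hr₁ hr₂)
  have hs1 : s ≤ r := min_le_left _ _
  have hs2 : s ≤ r₁ := (min_le_right _ _).trans (min_le_left _ _)
  have hs3 : s ≤ r₂ := (min_le_right _ _).trans (min_le_right _ _)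
  have h₁' : Linked Ω t.hull (Metric.ball x s) := h₁.mono le_rfl (Metric.ball_subset_ball hs2)
  have h₂' : Linked Ω (Metric.ball x' s) t'.hull :=
    (h₂.mono le_rfl (Metric.ball_subset_ball hs3)).symm
  have h' : Linked Ω (Metric.ball x s) (Metric.ball x' s) :=
    h.mono (Metric.ball_subset_ball hs1) (Metric.ball_subset_ball hs1)
  exact (h₁'.trans h' t.volume_ne_top (volume_ball_ne_zero x hs) measure_ball_lt_top.ne
    measure_ball_lt_top.ne).trans h₂' t.volume_ne_top (volume_ball_ne_zero x' hs)
    measure_ball_lt_top.ne t'.volume_ne_top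

/-- One fixed mesh `T₀` cuts Ω into finitely many pairwise linked pieces; the resulting constant
depends on `T₀` but serves every mesh. -/
theorem linked_self (hreg : interior (closure Ω) = Ω) (hconn : IsPreconnected Ω) (T₀ : Mesh Ω) :
    Linked Ω Ω Ω := by
  choose C hC h using fun t t' : T₀.Tri => Tri.linked hreg hconn t t'
  refine ⟨∑ t, ∑ t', C t t', ENNReal.sum_ne_top.mpr fun t _ => ENNReal.sum_ne_top.mpr
    fun t' _ => hC t t', fun T y => ?_⟩
  have hm : ∀ t' : T₀.Tri, Measurable fun x => ∫⁻ z in t'.hull,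
      ENNReal.ofReal ((T.interp y z - T.interp y x) ^ 2) := fun t' =>
    (T.measurable_incr y).lintegral_prod_right'
  rw [incr, T₀.restrict_eq_sum hreg, lintegral_finsetSum_measure, Finset.sum_mul]
  refine Finset.sum_le_sum fun t _ => ?_
  simp only [lintegral_finsetSum_measure]
  rw [lintegral_finsetSum _ fun t' _ => hm t', Finset.sum_mul]
  exact Finset.sum_le_sum fun t' _ => h t t' T y

theorem volume_real_pos (hΩ : IsOpen Ω) (hne : Ω.Nonempty) (T : Mesh Ω) :
    0 < volume.real Ω :=
  ENNReal.toReal_pos (hΩ.measure_pos volume hne).ne'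
    ((measure_mono subset_closure).trans_lt T.isCompact_closure.measure_lt_top).ne

theorem sum_omega_mul (T : Mesh Ω) (y : T.Node → ℝ) :
    ∑ p, T.omega p * y p = ∫ x in Ω, T.interp y x := by
  have := T.isFiniteMeasure_restrict
  simp only [interp]
  rw [integral_finsetSum _ fun p _ => (T.integrable_hat _ p).const_mul _]
  exact Finset.sum_congr rfl fun p _ => by rw [integral_const_mul, mul_comm, omega]

/-- The Poincaré inequality for finite element functions, with a constant depending only on the
domain. -/
theorem exists_poincare (hreg : interior (closure Ω) = Ω) (hconn : IsConnected Ω) :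
    ∃ C : ℝ, 0 < C ∧ ∀ (T : Mesh Ω) (y : T.Node → ℝ), T.omega ⬝ᵥ y = 0 →
      ∑ p, T.omega p * y p ^ 2 ≤ C * (y ⬝ᵥ T.stiffnessMatrix *ᵥ y) := by
  by_cases hT : Nonempty (Mesh Ω)
  swap
  · exact ⟨1, one_pos, fun T => absurd ⟨T⟩ hT⟩
  obtain ⟨T₀⟩ := hT
  obtain ⟨c, hc, h⟩ := linked_self hreg hconn.isPreconnected T₀
  have hV := volume_real_pos (isOpen_of_regular hreg) hconn.nonempty T₀
  set V := volume.real Ω with hVdef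
  -- The factor 192 passes from the integral of v² to the ω-weighted sum; the summand 1 only ensures
  -- positivity.
  refine ⟨192 * (c.toReal / V) + 1, by positivity, fun T y hy => ?_⟩
  have hfin := T.isFiniteMeasure_restrict
  set v := T.interp y with hv
  have hvint : Integrable v (volume.restrict Ω) :=
    integrable_finsetSum _ fun p _ => (T.integrable_hat _ p).const_mul _
  have hv2 : Integrable (fun x => v x ^ 2) (volume.restrict Ω) := T.integrable_interp_sq _ y
  have hmean : ∫ x in Ω, v x = 0 := by rw [← T.sum_omega_mul]; exact hy
  -- As v has mean zero, ∫(v(z) - v(x))² dz = ∫v² + V v(x)².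
  have h1 : ∀ x, ENNReal.ofReal (V * v x ^ 2) ≤
      ∫⁻ z in Ω, ENNReal.ofReal ((v z - v x) ^ 2) := fun x => by
    have e : ∀ z, (v z - v x) ^ 2 = v z ^ 2 - 2 * v x * v z + v x ^ 2 := fun z => by ring
    have hi : Integrable (fun z => (v z - v x) ^ 2) (volume.restrict Ω) := by
      simp only [e]
      exact (hv2.sub (hvint.const_mul _)).add (integrable_const _)
    rw [← ofReal_integral_eq_lintegral_ofReal hi (Filter.Eventually.of_forall fun z => sq_nonneg _)]
    refine ENNReal.ofReal_le_ofReal ?_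
    simp only [e]
    have hi' : Integrable (fun z => v z ^ 2 - 2 * v x * v z) (volume.restrict Ω) :=
      hv2.sub (hvint.const_mul _)
    rw [integral_add hi' (integrable_const _),
      integral_sub hv2 (hvint.const_mul _), integral_const_mul, hmean, integral_const,
      measureReal_restrict_apply_univ, smul_eq_mul]
    have : 0 ≤ ∫ z in Ω, v z ^ 2 := integral_nonneg fun z => sq_nonneg _
    linarith
  have h2 : ENNReal.ofReal (V * ∫ x in Ω, v x ^ 2) ≤ T.incr y Ω Ω := by
    rw [← integral_const_mul, ofReal_integral_eq_lintegral_ofReal (hv2.const_mul _)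
      (Filter.Eventually.of_forall fun z => mul_nonneg hV.le (sq_nonneg _))]
    exact lintegral_mono fun x => h1 x
  have h3 := h2.trans (h T y)
  have hK := T.stiffnessMatrix_nonneg hreg y
  rw [T.lintegral_gradSq hreg, ← ENNReal.ofReal_toReal hc,
    ← ENNReal.ofReal_mul ENNReal.toReal_nonneg,
    ENNReal.ofReal_le_ofReal_iff (mul_nonneg ENNReal.toReal_nonneg hK)] at h3
  have h4 := T.consistentMass_lower hreg y
  rw [T.dotProduct_consistentMass] at h4
  set k := y ⬝ᵥ T.stiffnessMatrix *ᵥ y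
  have h5 : ∫ x in Ω, v x ^ 2 ≤ c.toReal / V * k := by
    rw [div_mul_eq_mul_div, le_div_iff₀ hV]; linarith
  linarith

/-- The basis functions of interior nodes have a total integral bounded below in terms of the
domain and the quasi-uniformity constant only. -/
theorem exists_le_sum_interior_omega (hreg : interior (closure Ω) = Ω) (hne : Ω.Nonempty)
    {σ : ℝ} (hσ : 0 < σ) :
    ∃ c : ℝ, 0 < c ∧ ∀ T : Mesh Ω, T.QuasiUniform σ → (∃ p : T.Node, p.pos ∉ frontier Ω) →
      ∀ s : Finset T.Node, (∀ p, p ∈ s ↔ p.pos ∉ frontier Ω) → c ≤ ∑ p ∈ s, T.omega p := by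
  obtain ⟨x₀, hx₀⟩ := hne
  obtain ⟨r, hr, hrΩ⟩ := Metric.isOpen_iff.mp (isOpen_of_regular hreg) x₀ hx₀
  have hd := discArea_pos
  refine ⟨min ((σ * (r / 2)) ^ 2 * discArea / 192) ((r / 4) ^ 2 * discArea), by positivity,
    fun T hT hint s hs => ?_⟩
  obtain ⟨p, hp⟩ := hint
  have hω : ∀ p, 0 ≤ T.omega p := fun p => (T.omega_pos hreg hσ hT p).le
  -- On a coarse mesh a single interior node has enough weight. On a fine one, hats not vanishing on
  -- the disc of radius r/4 have their nodes within 3r/4 of x₀, hence in Ω, and sum to one on that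
  -- disc.
  rcases le_or_gt (r / 2) T.size with h | h
  · refine (min_le_left _ _).trans (le_trans ?_ ((T.le_omega hreg hσ hT p).trans
      (Finset.single_le_sum (fun p _ => hω p) ((hs p).mpr hp))))
    gcongr
  · refine (min_le_right _ _).trans ?_
    have := T.isFiniteMeasure_restrict
    have hbΩ : Metric.closedBall x₀ (r / 4) ⊆ Ω :=
      (Metric.closedBall_subset_ball (by linarith)).trans hrΩ
    have hbm : MeasurableSet (Metric.closedBall x₀ (r / 4)) :=
      Metric.isClosed_closedBall.measurableSet
    rw [← volume_real_closedBall x₀ (by linarith)]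
    simp only [omega]
    rw [← integral_finsetSum _ fun p _ => T.integrable_hat _ p]
    have h1 : ∀ x, (Metric.closedBall x₀ (r / 4)).indicator (1 : Plane → ℝ) x ≤
        ∑ p ∈ s, T.hat p x := fun x => by
      by_cases hx : x ∈ Metric.closedBall x₀ (r / 4)
      · rw [Set.indicator_of_mem hx, Pi.one_apply, ← T.sum_hat (subset_closure (hbΩ hx))]
        refine (Finset.sum_subset (Finset.subset_univ s) fun q _ hq => ?_).symm.le
        by_contra hqx
        have h2 := dist_le_of_hat_ne_zero hqx
        rw [Metric.mem_closedBall] at hx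
        refine hq ((hs q).mpr (notMem_frontier hreg (hrΩ ?_)))
        rw [Metric.mem_ball]
        have := dist_triangle_left q.pos x₀ x
        linarith
      · rw [Set.indicator_of_notMem hx]
        exact Finset.sum_nonneg fun q _ => T.hat_nonneg q x
    calc volume.real (Metric.closedBall x₀ (r / 4))
        = ∫ x in Ω, (Metric.closedBall x₀ (r / 4)).indicator (1 : Plane → ℝ) x := by
          rw [integral_indicator_one hbm, measureReal_restrict_apply hbm,
            Set.inter_eq_self_of_subset_left hbΩ]
      _ ≤ _ := integral_mono ((integrable_const (1 : ℝ)).indicator hbm)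
          (integrable_finsetSum _ fun p _ => T.integrable_hat _ p) h1

end Mesh

end NeumannControl

end

/-! ### Assembly of the constants. -/

theorem mainTheorem1 (Ω : Set NeumannControl.Plane) (hconn : IsConnected Ω)
    (hreg : interior (closure Ω) = Ω) (σ : ℝ) (hσ : 0 < σ) :
    ∃ c d : ℝ, 0 < c ∧ 0 < d ∧
      ∀ T : NeumannControl.Mesh Ω, T.QuasiUniform σ →
        (∃ p : T.Node, p.pos ∉ frontier Ω) →
        ∀ (r : NeumannControl.Mesh.MassRule) (β : ℝ), 0 < β →
          IsUnit (T.preconditioner r β) ∧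
          ∃ μ : T.BNode → ℝ,
            ((T.preconditioner r β)⁻¹ * T.systemMatrix r β).charpoly =
              (Polynomial.X - Polynomial.C 1) ^ (2 * Fintype.card T.Node + 3) *
                ∏ i, (Polynomial.X - Polynomial.C (μ i)) ∧
            ∀ i, μ i ∈ Set.Icc (1 + c * T.size ^ 3 / β) (1 + d * T.size⁻¹ / β) := by
  classical
  obtain ⟨CP, hCP, hP⟩ := NeumannControl.Mesh.exists_poincare hreg hconn
  obtain ⟨c₄, hc₄, h₄⟩ :=
    NeumannControl.Mesh.exists_le_sum_interior_omega hreg hconn.nonempty hσ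
  have hd := NeumannControl.Mesh.discArea_pos
  set D := NeumannControl.Mesh.discArea
  set V := MeasureTheory.volume.real Ω with hV
  have hV0 : 0 ≤ V := MeasureTheory.measureReal_nonneg
  -- Powers of h below: c₂ ~ h, c₅ ~ h² and k ~ h⁻² give h / (h² · h⁻⁴) = h³; above, c₃ ~ h⁻¹.
  refine ⟨1 / 192 * (σ / 128) / (D * (2 * (1 + V / c₄) * (144 / σ ^ 2) ^ 2)),
    CP ^ 2 * (576 / (σ ^ 2 * D)), by positivity, by positivity, fun T hT hint r β hβ => ?_⟩
  obtain ⟨p₀, hp₀⟩ := hint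
  have hne : Nonempty T.Node := ⟨p₀⟩
  have hh := NeumannControl.Mesh.size_pos_of_node p₀
  set s : Finset T.Node := Finset.univ.filter fun p => p.pos ∉ frontier Ω with hs
  have hmem : ∀ p, p ∈ s ↔ p.pos ∉ frontier Ω := fun p => by simp [hs]
  obtain ⟨hu, μ, hμ, hb⟩ := Matrix.preconditioned_saddle_spectrum T.stiffnessMatrix
    (T.massMatrix r) T.omega (T.boundaryMassMatrix r) (T.couplingMatrix r)
    NeumannControl.Mesh.BNode.toNode (NeumannControl.Mesh.BNode.toNode_injective T) β (1 / 192)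
    (144 / (σ * T.size) ^ 2) CP (σ / 128 * T.size) (576 / (σ ^ 2 * D) * T.size⁻¹) c₄
    (T.size ^ 2 * D) V hβ (by norm_num) hCP (by positivity) (by positivity) hc₄ (by positivity)
    (by positivity) (T.omega_pos hreg hσ hT) T.stiffnessMatrix_transpose
    (T.stiffnessMatrix_nonneg hreg) (T.stiffnessMatrix_le hreg hσ hT) (hP T)
    (T.massMatrix_transpose r) (T.massMatrix_lower hreg r) (T.massMatrix_le r)
    (T.boundaryMassMatrix_transpose r) (T.boundaryMassMatrix_lower hreg hσ hT r)
    (T.boundaryMassMatrix_le hreg hσ hT r) (T.couplingMatrix_toNode r)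
    (fun k hk => T.couplingMatrix_eq_zero hreg r hk) s
    (fun p hp hp' => by
      obtain ⟨i, rfl⟩ := hp'
      exact (hmem _).mp hp i.2)
    (h₄ T hT ⟨p₀, hp₀⟩ s hmem) (T.sum_omega hreg).le T.omega_le
  refine ⟨hu, μ, hμ, fun i => ?_⟩
  convert hb i using 4
  · field_simp
  · ring
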